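/- Let $n\ge 1$. For an $n\times n$ complex matrix $A$ write $\det(tI_n-A)=t^n+\sum_{j=1}^n(-1)^j\sigma_j(A)t^{n-j}$ and $\sigma(A)=(\sigma_1(A),\dots,\sigma_n(A))$. Let $\Omega_n$ be the spectral unit ball, i.e. the set of $n\times n$ complex matrices with spectral radius $<1$, and let $\mathbb G_n=\sigma(\Omega_n)\subset\mathbb C^n$ be the symmetrized polydisk. For a domain $D\subset\mathbb C^m$ and $z,w\in D$, the Lempert function is $$l_D(z,w)=\inf\{|\alpha| : \alpha\in\mathbb D,\ \exists\,\varphi:\mathbb D\to D \text{ holomorphic with } \varphi(0)=z,\ \varphi(\alpha)=w\},$$ where $\mathbb D\subset\mathbb C$ is the open unit disc. A matrix $A$ is called cyclic (non-derogatory) if there is a vector $v\in\mathbb C^n$ such that the vectors $A^kv$, $k\ge 0$, span $\mathbb C^n$. Let $A\in\Omega_n$. Then the function $l_{\Omega_n}(A,\cdot)$ is continuous on $\Omega_n$ if and only if either $A$ is a scalar matrix, or $n=2$ and $A$ is cyclic with two equal eigenvalues. Moreover, if $n\ge 2$, the following conditions are equivalent: (i) the function $l_{\Omega_n}:\Omega_n\times\Omega_n\to[0,1)$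 is (jointly) continuous at $(A,B)$ for every $B\in\Omega_n$; (ii) $l_{\Omega_n}(A,B)=l_{\mathbb G_n}(\sigma(A),\sigma(B))$ for every $B\in\Omega_n$; (iii) $n=2$ and $A$ is cyclic with two equal eigenvalues. -/

import Mathlib

open scoped ENNReal

/-- The Lempert function of a subset `D` of a complex topological vector space, an infimum
in `[0, ∞]` (so the infimum over no disc at all would be `∞`). -/
noncomputable def lempert {E : Type*} [AddCommGroup E] [Module ℂ E] [TopologicalSpace E]
    (D : Set E) (z w : E) : ℝ≥0∞ :=
  sInf {r | ∃ α ∈ Metric.ball (0 : ℂ) 1, r = ‖α‖ₑ ∧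
    ∃ φ : ℂ → E, DifferentiableOn ℂ φ (Metric.ball 0 1) ∧
      Set.MapsTo φ (Metric.ball 0 1) D ∧ φ 0 = z ∧ φ α = w}

/-- The spectral unit ball `Ω_n`. -/
def spectralBall (n : ℕ) : Set (Matrix (Fin n) (Fin n) ℂ) :=
  {A | spectralRadius ℂ A < 1}

/-- `σ(A) = (σ_1(A), …, σ_n(A))`, where
`det (t I - A) = t ^ n + ∑_{j=1}^n (-1) ^ j σ_j(A) t ^ (n - j)`.
The entry with index `j : Fin n` is `σ_{j+1}(A)`. -/
noncomputable def sigma {n : ℕ} (A : Matrix (Fin n) (Fin n) ℂ) : Fin n → ℂ :=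
  fun j => (-1) ^ ((j : ℕ) + 1) * A.charpoly.coeff (n - ((j : ℕ) + 1))

/-- The symmetrized polydisk `G_n = σ(Ω_n)`. -/
def symPolydisk (n : ℕ) : Set (Fin n → ℂ) := sigma '' spectralBall n

/-- A matrix is cyclic (non-derogatory) if it admits a cyclic vector. -/
def IsCyclicMatrix {n : ℕ} (A : Matrix (Fin n) (Fin n) ℂ) : Prop :=
  ∃ v : Fin n → ℂ,
    Submodule.span ℂ (Set.range fun k : ℕ => Matrix.mulVec (A ^ k) v) = ⊤

/-- `A` is a scalar matrix. -/
def IsScalarMatrix {n : ℕ} (A : Matrix (Fin n) (Fin n) ℂ) : Prop :=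
  ∃ c : ℂ, A = c • (1 : Matrix (Fin n) (Fin n) ℂ)

/-- `A` is a cyclic `2 × 2` matrix with two equal eigenvalues
(eigenvalues counted with algebraic multiplicity). -/
def IsCyclicTwoDouble {n : ℕ} (A : Matrix (Fin n) (Fin n) ℂ) : Prop :=
  n = 2 ∧ IsCyclicMatrix A ∧ ∃ μ : ℂ, A.charpoly.roots = {μ, μ}

open scoped Topology
open Metric

/-! ### The Lempert function of a general set: symmetry, contraction, upper semicontinuity. -/

section General

variable {E F : Type*} [NormedAddCommGroup E] [NormedSpace ℂ E]
  [NormedAddCommGroup F] [NormedSpace ℂ F] {D : Set E} {z w : E}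

/-! On the spectral ball the Lempert function is always upper semicontinuous and invariant under
conjugation of either argument, and the conjugation orbit of any matrix accumulates at a diagonal
matrix with the same eigenvalues. Hence continuity in the second argument, and equally agreement
with the symmetrized polydisk, forces `LempertInvariant A`: the value at B depends only on the
characteristic polynomial of B. The core of the proof is that only scalar matrices and the
exceptional 2 × 2 matrices have this property.

Several eigenvalues are impossible. The value at 0 is the spectral radius (`lempert_zero_left`).
After a Möbius map some eigenvalue of multiplicity at most n/2 strictly dominates, and a
perturbation of the radial disc then joins A to some nilpotent N at smaller cost
(`exists_nilpotent_lempert_lt`), although N and 0 have the same characteristic polynomial. So A has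
one eigenvalue, and a Möbius map moves it to 0.

Nonzero nilpotent matrices M with n ≥ 3 are impossible. If M has index n, take the eigenvalues t (n
- 1 times) and -(n - 1)t: the companion matrix costs O(t²), while the diagonal matrix costs at least
a constant times t^(n/(n-1)) (`LempertInvariant.false_of_pow_ne_zero`). If M has smaller index,
compare matrices with a single nonzero eigenvalue τ: one of them costs at most τ/(n - 1/4), but the
diagonal one costs at least τ/(n - 1/2) when τ is small (`LempertInvariant.false_of_pow_eq_zero`).

Conversely, for scalar A the function is the spectral radius of a Möbius image, which is lower
semicontinuous. In the exceptional 2 × 2 case it equals the Lempert function of the symmetrized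
polydisk, and a normal family argument gives lower semicontinuity
(`continuousWithinAt_lempert_of_eq`). Scalar matrices with n ≥ 2 drop out of the second statement
because 0 is a limit of conjugates of a regular nilpotent matrix from which some B is strictly
cheaper to reach. -/

theorem lempert_lt_iff {c : ℝ≥0∞} : lempert D z w < c ↔
    ∃ α ∈ ball (0 : ℂ) 1, ‖α‖ₑ < c ∧ ∃ φ : ℂ → E, DifferentiableOn ℂ φ (ball 0 1) ∧
      Set.MapsTo φ (ball 0 1) D ∧ φ 0 = z ∧ φ α = w := by
  unfold lempert
  rw [sInf_lt_iff]
  constructor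
  · rintro ⟨r, ⟨α, hα, rfl, h⟩, hr⟩
    exact ⟨α, hα, hr, h⟩
  · rintro ⟨α, hα, hr, h⟩
    exact ⟨_, ⟨α, hα, rfl, h⟩, hr⟩

theorem lempert_le {α : ℂ} (hα : α ∈ ball (0 : ℂ) 1) {φ : ℂ → E}
    (hφ : DifferentiableOn ℂ φ (ball 0 1)) (hm : Set.MapsTo φ (ball 0 1) D) (h0 : φ 0 = z)
    (h1 : φ α = w) : lempert D z w ≤ ‖α‖ₑ :=
  sInf_le ⟨α, hα, rfl, φ, hφ, hm, h0, h1⟩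

/-- The disc in the definition of the Lempert function may be taken with `α ≠ 0`. -/
theorem exists_disc_of_lempert_lt {c : ℝ≥0∞} (h : lempert D z w < c) :
    ∃ α ∈ ball (0 : ℂ) 1, α ≠ 0 ∧ ‖α‖ₑ < c ∧ ∃ φ : ℂ → E, DifferentiableOn ℂ φ (ball 0 1) ∧
      Set.MapsTo φ (ball 0 1) D ∧ φ 0 = z ∧ φ α = w := by
  obtain ⟨α, hα, hc, φ, hφ, hm, h0, h1⟩ := lempert_lt_iff.1 h
  by_cases hα0 : α = 0
  · subst hα0
    -- The two points coincide when α = 0, so the constant disc serves with any small positive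
    -- parameter.
    obtain ⟨r, hr0, hr1⟩ := exists_between (show (0 : ℝ≥0∞) < min c 1 by
      refine lt_min ?_ one_pos
      simpa using hc)
    have hrt : r ≠ ∞ := (hr1.trans_le (min_le_right _ _)).ne_top
    lift r to NNReal using hrt
    have hz : z ∈ D := h0 ▸ hm (by simp)
    refine ⟨(r : ℝ), ?_, ?_, ?_, fun _ => z, differentiableOn_const _, fun _ _ => hz, rfl, ?_⟩
    · have := hr1.trans_le (min_le_right _ _)
      simp only [mem_ball_zero_iff, Complex.norm_real, Real.norm_eq_abs, NNReal.abs_eq]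
      exact_mod_cast this
    · have : (r : ℝ) ≠ 0 := by
        have : (0 : NNReal) < r := by exact_mod_cast hr0
        exact_mod_cast this.ne'
      exact_mod_cast this
    · have h2 := hr1.trans_le (min_le_left _ _)
      have h3 : ‖((r : ℝ) : ℂ)‖ₑ = r := by
        rw [enorm_eq_nnnorm]; congr 1; ext; simp
      rwa [h3]
    · rw [← h0, h1]
  · exact ⟨α, hα, hα0, hc, φ, hφ, hm, h0, h1⟩

theorem lempert_comp_le {D' : Set F} {f : E → F} (hf : DifferentiableOn ℂ f D)
    (hm : Set.MapsTo f D D') : lempert D' (f z) (f w) ≤ lempert D z w := by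
  refine le_of_forall_gt fun c hc => ?_
  obtain ⟨α, hα, hαc, φ, hφ, hm', rfl, rfl⟩ := lempert_lt_iff.1 hc
  exact lempert_lt_iff.2 ⟨α, hα, hαc, f ∘ φ, hf.comp hφ hm', hm.comp hm', rfl, rfl⟩

theorem norm_sub_lt_norm_one_sub {a x : ℂ} (ha : ‖a‖ < 1) (hx : ‖x‖ < 1) :
    ‖a - x‖ < ‖1 - (starRingEnd ℂ) a * x‖ := by
  have h : ‖1 - (starRingEnd ℂ) a * x‖ ^ 2 - ‖a - x‖ ^ 2 = (1 - ‖a‖ ^ 2) * (1 - ‖x‖ ^ 2) := by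
    rw [← Complex.normSq_eq_norm_sq, ← Complex.normSq_eq_norm_sq, ← Complex.normSq_eq_norm_sq,
      ← Complex.normSq_eq_norm_sq]
    simp only [Complex.normSq_apply, Complex.sub_re, Complex.sub_im, Complex.mul_re,
      Complex.mul_im, Complex.conj_re, Complex.conj_im, Complex.one_re, Complex.one_im]
    ring
  have : 0 < (1 - ‖a‖ ^ 2) * (1 - ‖x‖ ^ 2) := by
    apply mul_pos <;> nlinarith [norm_nonneg a, norm_nonneg x]
  exact lt_of_pow_lt_pow_left₀ 2 (norm_nonneg _) (by linarith)

theorem one_sub_conj_mul_ne_zero {a x : ℂ} (ha : ‖a‖ < 1) (hx : ‖x‖ < 1) :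
    1 - (starRingEnd ℂ) a * x ≠ 0 := by
  rw [← norm_pos_iff]
  exact (norm_nonneg _).trans_lt (norm_sub_lt_norm_one_sub ha hx)

/-- The involution x ↦ (α - x) / (1 - conj α * x) of the unit disc exchanges 0 and α. -/
theorem lempert_comm_le : lempert D z w ≤ lempert D w z := by
  refine le_of_forall_gt fun c hc => ?_
  obtain ⟨α, hα, hc, φ, hφ, hm, h0, h1⟩ := lempert_lt_iff.1 hc
  rw [mem_ball_zero_iff] at hα
  have hmaps : Set.MapsTo (fun x => (α - x) / (1 - (starRingEnd ℂ) α * x)) (ball 0 1)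
      (ball (0 : ℂ) 1) := by
    intro x hx
    rw [mem_ball_zero_iff] at hx ⊢
    rw [norm_div, div_lt_one (norm_pos_iff.2 (one_sub_conj_mul_ne_zero hα hx))]
    exact norm_sub_lt_norm_one_sub hα hx
  refine lempert_lt_iff.2 ⟨α, by simpa using hα, hc,
    φ ∘ fun x => (α - x) / (1 - (starRingEnd ℂ) α * x), hφ.comp ?_ hmaps, hm.comp hmaps, ?_, ?_⟩
  · intro x hx
    have := one_sub_conj_mul_ne_zero hα (mem_ball_zero_iff.1 hx)
    apply DifferentiableAt.differentiableWithinAt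
    fun_prop (disch := assumption)
  · simpa using h1
  · simpa using h0

theorem lempert_comm : lempert D z w = lempert D w z :=
  le_antisymm lempert_comm_le lempert_comm_le

/-- By compactness φ still maps a disc of radius greater than 1 into D; rescaling that disc to the
unit disc shrinks the parameter strictly. -/
theorem lempert_lt_norm {φ : ℂ → E} (hD : IsOpen D) (hφ : Differentiable ℂ φ)
    (hm : Set.MapsTo φ (closedBall 0 1) D) {α : ℂ} (hα : ‖α‖ < 1) (hα0 : α ≠ 0) :
    lempert D (φ 0) (φ α) < ‖α‖ₑ := by
  obtain ⟨δ, hδ, hsub⟩ := (isCompact_closedBall (0 : ℂ) 1).exists_thickening_subset_open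
    (hD.preimage hφ.continuous) hm
  rw [thickening_closedBall hδ zero_le_one] at hsub
  have h1 : (1 : ℝ) < δ + 1 := by linarith
  have hR : (0 : ℝ) < δ + 1 := by linarith
  have hmul : ∀ x ∈ ball (0 : ℂ) 1, ((δ + 1 : ℝ) : ℂ) * x ∈ ball (0 : ℂ) (δ + 1) := by
    intro x hx
    rw [mem_ball_zero_iff] at hx ⊢
    rw [norm_mul, Complex.norm_real, Real.norm_of_nonneg hR.le]
    nlinarith
  have hlt : ‖α / ((δ + 1 : ℝ) : ℂ)‖ < ‖α‖ := by
    rw [norm_div, Complex.norm_real, Real.norm_of_nonneg hR.le]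
    exact div_lt_self (norm_pos_iff.2 hα0) h1
  refine lempert_lt_iff.2 ⟨α / ((δ + 1 : ℝ) : ℂ), ?_, ?_, fun x => φ (((δ + 1 : ℝ) : ℂ) * x),
    ?_, ?_, ?_, ?_⟩
  · rw [mem_ball_zero_iff]; exact hlt.trans hα
  · rw [enorm_eq_nnnorm, enorm_eq_nnnorm, ENNReal.coe_lt_coe]
    exact hlt
  · exact (hφ.comp (differentiable_id.const_mul _)).differentiableOn
  · intro x hx
    exact hsub (by simpa [add_comm] using hmul x hx)
  · simp
  · have : ((δ + 1 : ℝ) : ℂ) ≠ 0 := by exact_mod_cast hR.ne'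
    simp only
    rw [mul_div_cancel₀ _ this]

/-- The Lempert function of an open set is upper semicontinuous. -/
theorem eventually_lempert_lt (hD : IsOpen D) {c : ℝ≥0∞} (h : lempert D z w < c) :
    ∀ᶠ p : E × E in 𝓝 (z, w), lempert D p.1 p.2 < c := by
  obtain ⟨α, hα, hα0, hc, φ, hφ, hm, h0, h1⟩ := exists_disc_of_lempert_lt h
  rw [mem_ball_zero_iff] at hα
  have hα1 : 0 < ‖α‖ := norm_pos_iff.2 hα0
  -- a radius `r < 1` with `‖α / r‖` still small
  obtain ⟨r, hrα, hr1, hrc⟩ : ∃ r : ℝ, ‖α‖ < r ∧ r < 1 ∧ ‖α / r‖ₑ < c := by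
    have hcont : ContinuousAt (fun r : ℝ => ‖α / r‖ₑ) 1 := by
      apply ContinuousAt.enorm
      apply ContinuousAt.div continuousAt_const
      · exact Complex.continuous_ofReal.continuousAt
      · simp
    have h1 : ∀ᶠ r : ℝ in 𝓝[<] 1, ‖α / r‖ₑ < c :=
      (hcont.eventually_lt continuousAt_const (by simpa using hc)).filter_mono nhdsWithin_le_nhds
    have h2 : ∀ᶠ r : ℝ in 𝓝[<] 1, ‖α‖ < r :=
      (lt_mem_nhds hα).filter_mono nhdsWithin_le_nhds
    have h3 : ∀ᶠ r : ℝ in 𝓝[<] 1, r < 1 := self_mem_nhdsWithin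
    obtain ⟨r, a, b, c⟩ := (h1.and (h2.and h3)).exists
    exact ⟨r, b, c, a⟩
  have hr0 : 0 < r := hα1.trans hrα
  set β : ℂ := α / r with hβ
  have hβ0 : β ≠ 0 := div_ne_zero hα0 (by exact_mod_cast hr0.ne')
  have hβ1 : ‖β‖ < 1 := by
    rw [hβ, norm_div, Complex.norm_real, Real.norm_of_nonneg hr0.le, div_lt_one hr0]
    exact hrα
  have hsubset : closedBall (0 : ℂ) r ⊆ ball 0 1 := closedBall_subset_ball hr1
  have hK : IsCompact (φ '' closedBall 0 r) :=
    (isCompact_closedBall _ _).image_of_continuousOn (hφ.continuousOn.mono hsubset)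
  obtain ⟨δ, hδ, hsub⟩ := hK.exists_thickening_subset_open hD
    (by rintro _ ⟨x, hx, rfl⟩; exact hm (hsubset hx))
  have hev : ∀ᶠ p : E × E in 𝓝 (z, w), ‖p.1 - z‖ * (1 + 1 / ‖β‖) + ‖p.2 - w‖ * (1 / ‖β‖) < δ := by
    have : ContinuousAt
        (fun p : E × E => ‖p.1 - z‖ * (1 + 1 / ‖β‖) + ‖p.2 - w‖ * (1 / ‖β‖)) (z, w) := by fun_prop
    exact this.eventually_lt continuousAt_const (by simpa using hδ)
  filter_upwards [hev] with p hp
  -- Shrinking to radius r leaves room around the image; the affine correction takes the values p.1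
  -- - z at 0 and p.2 - w at β.
  refine lempert_lt_iff.2 ⟨β, by simpa using hβ1, hrc,
    fun x => φ (r * x) + ((1 - x / β) • (p.1 - z) + (x / β) • (p.2 - w)), ?_, ?_, ?_, ?_⟩
  · refine DifferentiableOn.add (hφ.comp (by fun_prop) ?_) (by fun_prop)
    intro x hx
    rw [mem_ball_zero_iff] at hx ⊢
    rw [norm_mul, Complex.norm_real, Real.norm_of_nonneg hr0.le]
    nlinarith [norm_nonneg x]
  · intro x hx
    rw [mem_ball_zero_iff] at hx
    apply hsub
    rw [mem_thickening_iff]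
    refine ⟨φ (r * x), ⟨r * x, ?_, rfl⟩, ?_⟩
    · rw [mem_closedBall_zero_iff, norm_mul, Complex.norm_real, Real.norm_of_nonneg hr0.le]
      nlinarith [norm_nonneg x]
    · rw [dist_eq_norm, add_sub_cancel_left]
      refine lt_of_le_of_lt ?_ hp
      refine (norm_add_le _ _).trans (add_le_add ?_ ?_)
      · rw [norm_smul, mul_comm]
        gcongr
        refine (norm_sub_le _ _).trans ?_
        rw [norm_one, norm_div]
        gcongr
      · rw [norm_smul, mul_comm, norm_div]
        gcongr
  · simp [h0]
  · have : (r : ℂ) * β = α := by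
      rw [hβ, mul_div_cancel₀]; exact_mod_cast hr0.ne'
    simp [this, h1, hβ0]

end General

/-! ### Eigenvalues, spectral radius and conjugation. -/

section Roots

variable {n : ℕ} {A B : Matrix (Fin n) (Fin n) ℂ}

theorem mem_spectralBall_iff :
    A ∈ spectralBall n ↔ ∀ t, A.charpoly.IsRoot t → ‖t‖ < 1 := by
  have h0 : A.charpoly ≠ 0 := A.charpoly_monic.ne_zero
  constructor
  · intro h t ht
    have h1 : (‖t‖₊ : ℝ≥0∞) ≤ spectralRadius ℂ A :=
      le_iSup₂ (f := fun k (_ : k ∈ spectrum ℂ A) => (‖k‖₊ : ℝ≥0∞)) t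
        (Matrix.mem_spectrum_iff_isRoot_charpoly.2 ht)
    have h2 := h1.trans_lt h
    exact_mod_cast h2
  · intro h
    have h1 : spectralRadius ℂ A ≤ (A.charpoly.roots.toFinset.sup fun t => ‖t‖₊ : NNReal) := by
      refine iSup₂_le fun t ht => ?_
      rw [Matrix.mem_spectrum_iff_isRoot_charpoly] at ht
      exact_mod_cast Finset.le_sup (f := fun t : ℂ => ‖t‖₊)
        (by simpa [h0] using ht : t ∈ A.charpoly.roots.toFinset)
    refine h1.trans_lt ?_
    have : (A.charpoly.roots.toFinset.sup fun t => ‖t‖₊) < 1 := by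
      rw [Finset.sup_lt_iff (by simp)]
      intro t ht
      exact_mod_cast h t (by simpa [h0] using ht)
    exact_mod_cast this

theorem enorm_le_spectralRadius {t : ℂ} (ht : A.charpoly.IsRoot t) :
    ‖t‖ₑ ≤ spectralRadius ℂ A :=
  le_iSup₂ (f := fun k (_ : k ∈ spectrum ℂ A) => (‖k‖₊ : ℝ≥0∞)) t
    (Matrix.mem_spectrum_iff_isRoot_charpoly.2 ht)

theorem spectralRadius_le_iff {c : ℝ≥0∞} :
    spectralRadius ℂ A ≤ c ↔ ∀ t, A.charpoly.IsRoot t → ‖t‖ₑ ≤ c := by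
  constructor
  · exact fun h t ht => (enorm_le_spectralRadius ht).trans h
  · exact fun h => iSup₂_le fun t ht => h t (Matrix.mem_spectrum_iff_isRoot_charpoly.1 ht)

theorem lt_spectralRadius_iff {c : ℝ≥0∞} :
    c < spectralRadius ℂ A ↔ ∃ t, A.charpoly.IsRoot t ∧ c < ‖t‖ₑ := by
  rw [← not_le, spectralRadius_le_iff]
  push Not
  rfl

theorem isRoot_charpoly_iff_det {t : ℂ} :
    A.charpoly.IsRoot t ↔ (t • (1 : Matrix (Fin n) (Fin n) ℂ) - A).det = 0 := by
  rw [Polynomial.IsRoot, Matrix.eval_charpoly]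
  simp [Matrix.scalar_apply, ← Matrix.smul_one_eq_diagonal]

theorem eval_charpoly_eq_det (t : ℂ) :
    A.charpoly.eval t = (t • (1 : Matrix (Fin n) (Fin n) ℂ) - A).det := by
  rw [Matrix.eval_charpoly]
  simp [Matrix.scalar_apply, ← Matrix.smul_one_eq_diagonal]

theorem isRoot_charpoly_pow {k : ℕ} (hk : 0 < k) {t : ℂ} :
    (A ^ k).charpoly.IsRoot t ↔ ∃ x, A.charpoly.IsRoot x ∧ x ^ k = t := by
  rw [← Matrix.mem_spectrum_iff_isRoot_charpoly, spectrum.map_pow_of_pos A hk]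
  simp [Matrix.mem_spectrum_iff_isRoot_charpoly]

theorem isRoot_charpoly_smul {c : ℂ} (hc : c ≠ 0) {t : ℂ} :
    (c • A).charpoly.IsRoot (c * t) ↔ A.charpoly.IsRoot t := by
  rw [isRoot_charpoly_iff_det, isRoot_charpoly_iff_det, mul_smul, ← smul_sub, Matrix.det_smul]
  simp [hc]

theorem exists_mulVec_eq_of_isRoot {t : ℂ} (ht : A.charpoly.IsRoot t) :
    ∃ v : Fin n → ℂ, v ≠ 0 ∧ A.mulVec v = t • v := by
  rw [isRoot_charpoly_iff_det] at ht
  obtain ⟨v, hv, h⟩ := Matrix.exists_mulVec_eq_zero_iff.2 ht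
  refine ⟨v, hv, ?_⟩
  rw [Matrix.sub_mulVec, Matrix.smul_mulVec, Matrix.one_mulVec, sub_eq_zero] at h
  exact h.symm

theorem exists_isRoot_charpoly (hn : 1 ≤ n) (A : Matrix (Fin n) (Fin n) ℂ) :
    ∃ t, A.charpoly.IsRoot t := by
  apply IsAlgClosed.exists_root
  rw [Matrix.charpoly_degree_eq_dim]
  simp; omega

/-- Every eigenvalue is bounded by some absolute row sum. -/
theorem exists_norm_le_row_sum {t : ℂ} (ht : A.charpoly.IsRoot t) :
    ∃ i, ‖t‖ ≤ ∑ j, ‖A i j‖ := by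
  obtain ⟨v, hv, h⟩ := exists_mulVec_eq_of_isRoot ht
  have : Nonempty (Fin n) := by
    by_contra hne
    rw [not_nonempty_iff] at hne
    exact hv (Subsingleton.elim _ _)
  obtain ⟨i, hi⟩ := Finite.exists_max fun i => ‖v i‖
  refine ⟨i, ?_⟩
  have hpos : 0 < ‖v i‖ := by
    rw [norm_pos_iff]
    intro h0
    apply hv
    ext j
    have := hi j
    rw [h0, norm_zero] at this
    simpa using this
  have h1 := congrFun h i
  simp only [Matrix.mulVec, dotProduct, Pi.smul_apply, smul_eq_mul] at h1
  have h2 : ‖t‖ * ‖v i‖ ≤ (∑ j, ‖A i j‖) * ‖v i‖ := by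
    rw [← norm_mul, ← h1, Finset.sum_mul]
    refine (norm_sum_le _ _).trans (Finset.sum_le_sum fun j _ => ?_)
    rw [norm_mul]
    gcongr
    exact hi j
  exact le_of_mul_le_mul_right h2 hpos

theorem mem_spectralBall_of_row_sum (h : ∀ i, ∑ j, ‖A i j‖ < 1) : A ∈ spectralBall n := by
  rw [mem_spectralBall_iff]
  intro t ht
  obtain ⟨i, hi⟩ := exists_norm_le_row_sum ht
  exact hi.trans_lt (h i)

theorem IsConj.charpoly_eq (h : IsConj A B) : A.charpoly = B.charpoly := by
  obtain ⟨c, hc⟩ := h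
  have : B = c * A * (c⁻¹ : (Matrix (Fin n) (Fin n) ℂ)ˣ) := by
    rw [hc.eq, Units.mul_inv_cancel_right]
  rw [this, Matrix.coe_units_inv, Matrix.charpoly_units_conj]

theorem mem_spectralBall_of_charpoly_eq (h : A.charpoly = B.charpoly) (hA : A ∈ spectralBall n) :
    B ∈ spectralBall n := by
  rw [mem_spectralBall_iff] at hA ⊢
  rwa [← h]

theorem isConj_of_mul_eq {P Q : Matrix (Fin n) (Fin n) ℂ} (hPQ : P * Q = 1)
    (h : P * A = B * P) : IsConj A B :=
  ⟨⟨P, Q, hPQ, mul_eq_one_comm.1 hPQ⟩, h⟩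

theorem isConj_of_det_ne_zero {P : Matrix (Fin n) (Fin n) ℂ} (hP : P.det ≠ 0)
    (h : P * A = B * P) : IsConj A B :=
  isConj_of_mul_eq (Matrix.mul_nonsing_inv P (isUnit_iff_ne_zero.2 hP)) h

/-- Conjugation by a diagonal matrix. -/
theorem isConj_diagonal (d : Fin n → ℂ) (hd : ∀ i, d i ≠ 0) (A : Matrix (Fin n) (Fin n) ℂ) :
    IsConj A (Matrix.of fun i j => d i * A i j * (d j)⁻¹) := by
  refine isConj_of_det_ne_zero (P := Matrix.diagonal d) ?_ ?_
  · rw [Matrix.det_diagonal]; exact Finset.prod_ne_zero_iff.2 fun i _ => hd i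
  · ext i j
    simp [Matrix.diagonal_mul, Matrix.mul_diagonal, hd]

end Roots

/-! ### Triangular form, degeneration to diagonal matrices, openness of the spectral ball. -/

section Triangular

/-- A change of basis carries an eigenvector to the first basis vector. -/
theorem exists_isConj_first_column {n : ℕ} (A : Matrix (Fin (n + 1)) (Fin (n + 1)) ℂ) :
    ∃ B, IsConj A B ∧ ∀ i : Fin n, B i.succ 0 = 0 := by
  obtain ⟨t, ht⟩ := exists_isRoot_charpoly (Nat.succ_pos n) A
  obtain ⟨v, hv, hAv⟩ := exists_mulVec_eq_of_isRoot ht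
  obtain ⟨e, he⟩ := SeparatingDual.exists_continuousLinearEquiv_apply_eq (R := ℂ) hv
    (show (Pi.single 0 1 : Fin (n + 1) → ℂ) ≠ 0 by simp)
  let P := LinearMap.toMatrix' (e.toLinearEquiv : (Fin (n + 1) → ℂ) →ₗ[ℂ] (Fin (n + 1) → ℂ))
  let Q := LinearMap.toMatrix' (e.symm.toLinearEquiv : (Fin (n + 1) → ℂ) →ₗ[ℂ] (Fin (n + 1) → ℂ))
  have hPQ : P * Q = 1 := by
    rw [← LinearMap.toMatrix'_comp]
    convert LinearMap.toMatrix'_id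
    ext; simp
  have hQP := mul_eq_one_comm.1 hPQ
  refine ⟨P * A * Q, isConj_of_mul_eq hPQ (by rw [mul_assoc, hQP, mul_one]), fun i => ?_⟩
  have hQ : Q.mulVec (Pi.single 0 1) = v := by
    rw [LinearMap.toMatrix'_mulVec, ← he]; simp
  have hP : P.mulVec v = Pi.single 0 1 := by
    rw [LinearMap.toMatrix'_mulVec, ← he]; simp
  have h1 : (P * A * Q).mulVec (Pi.single 0 1) = t • Pi.single 0 1 := by
    rw [← Matrix.mulVec_mulVec, hQ, ← Matrix.mulVec_mulVec, hAv, Matrix.mulVec_smul, hP]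
  have h2 := congrFun h1 i.succ
  simpa [Matrix.mulVec_single_one] using h2

theorem exists_isConj_upperTriangular {n : ℕ} (A : Matrix (Fin n) (Fin n) ℂ) :
    ∃ T : Matrix (Fin n) (Fin n) ℂ, IsConj A T ∧ ∀ i j, j < i → T i j = 0 := by
  induction n with
  | zero => exact ⟨A, IsConj.refl _, fun i => i.elim0⟩
  | succ n ih =>
    obtain ⟨B, hAB, hB⟩ := exists_isConj_first_column A
    obtain ⟨T, ⟨c, hc⟩, hT⟩ := ih (B.submatrix Fin.succ Fin.succ)
    -- The block sum of the 1 × 1 identity and Q.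
    let lift : Matrix (Fin n) (Fin n) ℂ → Matrix (Fin (n + 1)) (Fin (n + 1)) ℂ := fun Q =>
      Matrix.of (Fin.cons (Fin.cons 1 0) fun i => Fin.cons 0 (Q i))
    have hl : ∀ Q R, lift Q * lift R = lift (Q * R) := by
      intro Q R
      ext i j
      refine Fin.cases ?_ (fun i => ?_) i <;> refine Fin.cases ?_ (fun j => ?_) j <;>
        simp [lift, Matrix.mul_apply, Fin.sum_univ_succ]
    have hl1 : lift 1 = 1 := by
      ext i j
      refine Fin.cases ?_ (fun i => ?_) i <;> refine Fin.cases ?_ (fun j => ?_) j <;>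
        simp [lift, Matrix.one_apply, Fin.succ_ne_zero, (Fin.succ_ne_zero _).symm]
    let P := lift (c : Matrix (Fin n) (Fin n) ℂ)
    let Q := lift ((c⁻¹ : (Matrix (Fin n) (Fin n) ℂ)ˣ) : Matrix (Fin n) (Fin n) ℂ)
    have hPQ : P * Q = 1 := by rw [hl]; simp [hl1]
    have hQP : Q * P = 1 := by rw [hl]; simp [hl1]
    have hc' : (c : Matrix (Fin n) (Fin n) ℂ) * B.submatrix Fin.succ Fin.succ *
        ((c⁻¹ : (Matrix (Fin n) (Fin n) ℂ)ˣ) : Matrix (Fin n) (Fin n) ℂ) = T := by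
      rw [hc.eq]; simp
    have hentry : ∀ i j : Fin n, (P * B * Q) i.succ j.succ = T i j := by
      intro i j
      rw [← hc']
      simp [P, Q, lift, Matrix.mul_apply, Fin.sum_univ_succ]
    have hcol : ∀ i : Fin n, (P * B * Q) i.succ 0 = 0 := by
      intro i
      simp [P, Q, lift, Matrix.mul_apply, Fin.sum_univ_succ, hB]
    refine ⟨P * B * Q, hAB.trans (isConj_of_mul_eq hPQ (by rw [mul_assoc, hQP, mul_one])), ?_⟩
    intro i j
    refine Fin.cases ?_ (fun i => ?_) i <;> refine Fin.cases ?_ (fun j => ?_) j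
    · simp
    · simp
    · exact fun _ => hcol i
    · intro h
      rw [hentry]
      exact hT i j (by simpa using h)

variable {n : ℕ}

theorem charpoly_eq_of_upperTriangular {T : Matrix (Fin n) (Fin n) ℂ}
    (hT : ∀ i j, j < i → T i j = 0) :
    T.charpoly = ∏ i, (Polynomial.X - Polynomial.C (T i i)) :=
  Matrix.charpoly_of_isUpperTriangular T fun i j h => hT i j h

/-- Scaling by diagonal matrices: if the entry `(i, j)` of `A` vanishes unless `w i ≤ w j`,
the orbit of `A` accumulates at its part of weight zero. -/
theorem mem_closure_orbit_of_weights {A : Matrix (Fin n) (Fin n) ℂ} (w : Fin n → ℕ)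
    (hw : ∀ i j, w j < w i → A i j = 0) :
    (Matrix.of fun i j => if w i = w j then A i j else 0) ∈ closure {B | IsConj A B} := by
  -- Conjugation by the diagonal matrix with entries s ^ (-w i) multiplies the entry (i, j) by s ^
  -- (w j - w i). No negative power meets a nonzero entry, so s can tend to 0, which kills the
  -- entries of positive weight.
  let f : ℂ → Matrix (Fin n) (Fin n) ℂ := fun s =>
    Matrix.of fun i j => if w j < w i then 0 else s ^ (w j - w i) * A i j
  have hf : Continuous f := by
    refine continuous_matrix fun i j => ?_
    simp only [f, Matrix.of_apply]
    split_ifs <;> fun_prop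
  have hf0 : f 0 = Matrix.of fun i j => if w i = w j then A i j else 0 := by
    ext i j
    simp only [f, Matrix.of_apply]
    rcases lt_trichotomy (w i) (w j) with h | h | h
    · rw [if_neg (by omega), if_neg (by omega), zero_pow (by omega), zero_mul]
    · simp [h]
    · rw [if_pos h, if_neg (by omega)]
  rw [← hf0]
  refine mem_closure_of_tendsto (f := f) (b := 𝓝[≠] 0)
    (hf.continuousAt.mono_left nhdsWithin_le_nhds) ?_
  filter_upwards [self_mem_nhdsWithin] with s hs
  have hs : s ≠ 0 := hs
  have h := isConj_diagonal (fun i => (s ^ w i)⁻¹) (fun i => inv_ne_zero (pow_ne_zero _ hs)) A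
  convert h using 1
  ext i j
  simp only [f, Matrix.of_apply]
  split_ifs with h1
  · simp [hw i j h1]
  · rw [pow_sub₀ s hs (by omega), inv_inv]; ring

/-- The orbit of a matrix under conjugation accumulates at a diagonal matrix. -/
theorem exists_diagonal_mem_closure (A : Matrix (Fin n) (Fin n) ℂ) :
    ∃ d : Fin n → ℂ, A.charpoly = ∏ i, (Polynomial.X - Polynomial.C (d i)) ∧
      Matrix.diagonal d ∈ closure {B | IsConj A B} := by
  obtain ⟨T, hAT, hT⟩ := exists_isConj_upperTriangular A
  refine ⟨fun i => T i i, by rw [hAT.charpoly_eq, charpoly_eq_of_upperTriangular hT], ?_⟩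
  have h := mem_closure_orbit_of_weights (A := T) (fun i => (i : ℕ)) fun i j h => hT i j h
  have h2 : {B | IsConj T B} = {B | IsConj A B} := by
    ext B
    exact ⟨hAT.trans, hAT.symm.trans⟩
  rw [h2] at h
  convert h
  ext i j
  by_cases hij : i = j
  · simp [hij]
  · simp [hij, Fin.val_inj]

theorem charpoly_diagonal' (d : Fin n → ℂ) :
    (Matrix.diagonal d).charpoly = ∏ i, (Polynomial.X - Polynomial.C (d i)) := by
  rw [charpoly_eq_of_upperTriangular]
  · simp
  · intro i j h
    exact Matrix.diagonal_apply_ne _ h.ne'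

theorem isRoot_prod_X_sub_C {d : Fin n → ℂ} {t : ℂ} :
    (∏ i, (Polynomial.X - Polynomial.C (d i))).IsRoot t ↔ ∃ i, d i = t := by
  simp only [Polynomial.IsRoot, Polynomial.eval_prod, Finset.prod_eq_zero_iff, Polynomial.eval_sub,
    Polynomial.eval_X, Polynomial.eval_C, Finset.mem_univ, true_and, sub_eq_zero]
  exact exists_congr fun i => eq_comm

/-- Some conjugate of A is so close to its diagonal limit that all absolute row sums are below 1.
That condition is open, and undoing the conjugation gives a neighbourhood of A. -/
theorem isOpen_spectralBall : IsOpen (spectralBall n) := by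
  rw [isOpen_iff_mem_nhds]
  intro A hA
  obtain ⟨d, hd, hcl⟩ := exists_diagonal_mem_closure A
  have hU : IsOpen {B : Matrix (Fin n) (Fin n) ℂ | ∀ i, ∑ j, ‖B i j‖ < 1} := by
    simp only [Set.ofPred_forall]
    refine isOpen_iInter_of_finite fun i => isOpen_lt ?_ continuous_const
    refine continuous_finsetSum _ fun j _ => (Continuous.matrix_elem continuous_id i j).norm
  obtain ⟨B, hBU, ⟨c, hc⟩⟩ := mem_closure_iff.1 hcl _ hU (by
    intro i
    have : ∑ j, ‖Matrix.diagonal d i j‖ = ‖d i‖ := by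
      rw [Finset.sum_eq_single i]
      · simp
      · intro j _ hj
        simp [Matrix.diagonal_apply_ne _ hj.symm]
      · simp
    rw [this]
    exact mem_spectralBall_iff.1 hA _ (by rw [hd, isRoot_prod_X_sub_C]; exact ⟨i, rfl⟩))
  let g : Matrix (Fin n) (Fin n) ℂ → Matrix (Fin n) (Fin n) ℂ := fun X =>
    c * X * ((c⁻¹ : (Matrix (Fin n) (Fin n) ℂ)ˣ) : Matrix (Fin n) (Fin n) ℂ)
  have hg : Continuous g := by fun_prop
  have hgA : g A = B := by simp [g, hc.eq]
  filter_upwards [hg.continuousAt.preimage_mem_nhds (hU.mem_nhds (hgA ▸ hBU))] with X hX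
  have hconj : IsConj X (g X) := ⟨c, by simp [SemiconjBy, g, mul_assoc]⟩
  exact mem_spectralBall_of_charpoly_eq hconj.charpoly_eq.symm (mem_spectralBall_of_row_sum hX)

end Triangular

/-! ### Holomorphic dependence of determinants and characteristic polynomials. -/

section Holomorphic

open scoped Matrix.Norms.Elementwise

variable {n : ℕ} {E : Type*} [NormedAddCommGroup E] [NormedSpace ℂ E] {s : Set E}

theorem differentiableOn_matrix_iff {φ : E → Matrix (Fin n) (Fin n) ℂ} :
    DifferentiableOn ℂ φ s ↔ ∀ i j, DifferentiableOn ℂ (fun x => φ x i j) s := by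
  constructor
  · intro h i j
    exact differentiableOn_pi.1 (differentiableOn_pi.1 h i) j
  · intro h
    exact differentiableOn_pi.2 fun i => differentiableOn_pi.2 fun j => h i j

theorem DifferentiableOn.matrix_mul {φ ψ : E → Matrix (Fin n) (Fin n) ℂ}
    (hφ : DifferentiableOn ℂ φ s) (hψ : DifferentiableOn ℂ ψ s) :
    DifferentiableOn ℂ (fun x => φ x * ψ x) s := by
  rw [differentiableOn_matrix_iff] at *
  intro i j
  simp only [Matrix.mul_apply]
  exact DifferentiableOn.fun_sum fun k _ => (hφ i k).mul (hψ k j)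

theorem DifferentiableOn.matrix_pow {φ : E → Matrix (Fin n) (Fin n) ℂ}
    (hφ : DifferentiableOn ℂ φ s) (k : ℕ) : DifferentiableOn ℂ (fun x => φ x ^ k) s := by
  induction k with
  | zero => simp only [pow_zero]; exact differentiableOn_const _
  | succ k ih => simp only [pow_succ]; exact ih.matrix_mul hφ

theorem differentiableOn_coeff_mul {p q : E → Polynomial ℂ}
    (hp : ∀ k, DifferentiableOn ℂ (fun x => (p x).coeff k) s)
    (hq : ∀ k, DifferentiableOn ℂ (fun x => (q x).coeff k) s) (k : ℕ) :
    DifferentiableOn ℂ (fun x => (p x * q x).coeff k) s := by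
  simp only [Polynomial.coeff_mul]
  exact DifferentiableOn.fun_sum fun i _ => (hp _).mul (hq _)

/-- The coefficients of the determinant of a matrix of polynomials depend holomorphically on a
parameter if those of the entries do. -/
theorem differentiableOn_coeff_det {p : E → Matrix (Fin n) (Fin n) (Polynomial ℂ)}
    (hp : ∀ i j k, DifferentiableOn ℂ (fun x => (p x i j).coeff k) s) (k : ℕ) :
    DifferentiableOn ℂ (fun x => (p x).det.coeff k) s := by
  have hprod : ∀ (τ : Equiv.Perm (Fin n)) (t : Finset (Fin n)) (k : ℕ),
      DifferentiableOn ℂ (fun x => (∏ i ∈ t, p x (τ i) i).coeff k) s := by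
    intro τ t
    classical
    induction t using Finset.induction_on with
    | empty => intro k; simp only [Finset.prod_empty]; exact differentiableOn_const _
    | insert a t ha ih =>
      intro k
      simp only [Finset.prod_insert ha]
      exact differentiableOn_coeff_mul (hp _ _) ih k
  simp only [Matrix.det_apply, Polynomial.finsetSum_coeff]
  refine DifferentiableOn.fun_sum fun τ _ => ?_
  simp only [Units.smul_def, Polynomial.coeff_smul]
  exact (hprod τ Finset.univ k).const_smul ((Equiv.Perm.sign τ : ℤ))

theorem DifferentiableOn.charpoly_coeff {φ : E → Matrix (Fin n) (Fin n) ℂ}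
    (hφ : DifferentiableOn ℂ φ s) (k : ℕ) :
    DifferentiableOn ℂ (fun x => (φ x).charpoly.coeff k) s := by
  refine differentiableOn_coeff_det (fun i j k => ?_) k
  have h := differentiableOn_matrix_iff.1 hφ i j
  simp only [Matrix.charmatrix, Matrix.sub_apply, Polynomial.coeff_sub]
  refine (differentiableOn_const _).sub ?_
  simp only [RingHom.mapMatrix_apply, Matrix.map_apply, Polynomial.coeff_C]
  split_ifs
  · exact h
  · exact differentiableOn_const _

theorem DifferentiableOn.matrix_det {φ : E → Matrix (Fin n) (Fin n) ℂ}
    (hφ : DifferentiableOn ℂ φ s) : DifferentiableOn ℂ (fun x => (φ x).det) s := by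
  have h (x : E) : (φ x).det = (-1) ^ n * (φ x).charpoly.coeff 0 := by
    rw [Matrix.det_eq_sign_charpoly_coeff, Fintype.card_fin]
  simp only [h]
  exact (hφ.charpoly_coeff 0).const_mul _

theorem DifferentiableOn.sigma {φ : E → Matrix (Fin n) (Fin n) ℂ}
    (hφ : DifferentiableOn ℂ φ s) : DifferentiableOn ℂ (fun x => sigma (φ x)) s :=
  differentiableOn_pi.2 fun _ => (hφ.charpoly_coeff _).const_mul _

theorem continuous_matrix_sigma : Continuous (sigma : Matrix (Fin n) (Fin n) ℂ → Fin n → ℂ) := by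
  have : DifferentiableOn ℂ (fun A : Matrix (Fin n) (Fin n) ℂ => sigma A) Set.univ :=
    differentiableOn_id.sigma
  exact (differentiableOn_univ.1 this).continuous

theorem lempert_symPolydisk_le (A B : Matrix (Fin n) (Fin n) ℂ) :
    lempert (symPolydisk n) (sigma A) (sigma B) ≤ lempert (spectralBall n) A B :=
  lempert_comp_le (f := sigma) differentiableOn_id.sigma fun X hX => ⟨X, hX, rfl⟩

end Holomorphic

/-! ### Invariance of the Lempert function under conjugation. -/

section Conjugation

open scoped Matrix.Norms.Elementwise

variable {n : ℕ} {A B C : Matrix (Fin n) (Fin n) ℂ}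

/-- Conjugating the disc pointwise by P (x / α) fixes the value at 0 and conjugates the value at α
by P 1. The new disc stays in the spectral ball because membership depends only on eigenvalues. -/
theorem lempert_conj_le_of_path {P Q : ℂ → Matrix (Fin n) (Fin n) ℂ} (hP : Differentiable ℂ P)
    (hQ : Differentiable ℂ Q) (hPQ : ∀ x, P x * Q x = 1) (hP0 : P 0 = 1) :
    lempert (spectralBall n) A (P 1 * B * Q 1) ≤ lempert (spectralBall n) A B := by
  refine le_of_forall_gt fun c hc => ?_
  obtain ⟨α, hα, hα0, hαc, φ, hφ, hm, h0, h1⟩ := exists_disc_of_lempert_lt hc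
  have hQP : ∀ x, Q x * P x = 1 := fun x => mul_eq_one_comm.1 (hPQ x)
  have hQ0 : Q 0 = 1 := by simpa [hP0] using hPQ 0
  have hdiv : Differentiable ℂ fun x : ℂ => x / α := by fun_prop
  refine lempert_lt_iff.2 ⟨α, hα, hαc, fun x => P (x / α) * φ x * Q (x / α), ?_, ?_, ?_, ?_⟩
  · exact ((hP.comp hdiv).differentiableOn.matrix_mul hφ).matrix_mul
      (hQ.comp hdiv).differentiableOn
  · intro x hx
    have : IsConj (φ x) (P (x / α) * φ x * Q (x / α)) :=
      isConj_of_mul_eq (hPQ _) (by rw [mul_assoc, hQP, mul_one])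
    exact mem_spectralBall_of_charpoly_eq this.charpoly_eq (hm hx)
  · simp [hP0, hQ0, h0]
  · simp [hα0, h1]

/-- Invertible matrices are products of diagonal matrices and transvections, and each of these is
joined to 1 by an entire path of invertible matrices, exponential or linear. -/
theorem lempert_conj_le (P : Matrix (Fin n) (Fin n) ℂ) (hP : P.det ≠ 0) :
    ∀ A B, lempert (spectralBall n) A (P * B * P⁻¹) ≤ lempert (spectralBall n) A B := by
  refine Matrix.diagonal_transvection_induction_of_det_ne_zero
    (fun P => ∀ A B, lempert (spectralBall n) A (P * B * P⁻¹) ≤ lempert (spectralBall n) A B)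
    P hP ?_ ?_ ?_
  · intro d hd A B
    have hd' : ∀ i, d i ≠ 0 := fun i hi => hd (by
      rw [Matrix.det_diagonal]; exact Finset.prod_eq_zero (Finset.mem_univ i) hi)
    have hinv : (Matrix.diagonal d)⁻¹ = Matrix.diagonal fun i => (d i)⁻¹ := by
      apply Matrix.inv_eq_right_inv
      rw [Matrix.diagonal_mul_diagonal, ← Matrix.diagonal_one]
      congr 1; ext i; simp [hd' i]
    have hdiff : ∀ c : ℂ, Differentiable ℂ fun x : ℂ =>
        Matrix.diagonal fun i => Complex.exp (c * x * Complex.log (d i)) := by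
      intro c
      rw [← differentiableOn_univ, differentiableOn_matrix_iff]
      intro i j
      by_cases hij : i = j
      · subst hij
        simp only [Matrix.diagonal_apply_eq]
        fun_prop
      · simp only [Matrix.diagonal_apply_ne _ hij]
        exact differentiableOn_const _
    have := lempert_conj_le_of_path (A := A) (B := B) (hdiff 1) (hdiff (-1)) ?_ ?_
    · have h1 : (fun i => Complex.exp (1 * 1 * Complex.log (d i))) = d := by
        ext i; simp [Complex.exp_log (hd' i)]
      have h2 : (fun i => Complex.exp (-1 * 1 * Complex.log (d i))) = fun i => (d i)⁻¹ := by
        ext i; simp [Complex.exp_neg, Complex.exp_log (hd' i)]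
      rwa [h1, h2, ← hinv] at this
    · intro x
      rw [Matrix.diagonal_mul_diagonal, ← Matrix.diagonal_one]
      congr 1; ext i
      rw [← Complex.exp_add]
      simp
    · simp [← Matrix.diagonal_one]
  · intro t A B
    have hmul : ∀ a b : ℂ, a + b = 0 →
        Matrix.transvection t.i t.j a * Matrix.transvection t.i t.j b = 1 := by
      intro a b hab
      rw [Matrix.transvection_mul_transvection_same _ _ t.hij, hab, Matrix.transvection_zero]
    have hinv : t.toMatrix⁻¹ = Matrix.transvection t.i t.j (-t.c) := by
      apply Matrix.inv_eq_right_inv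
      exact hmul _ _ (by ring)
    have hdiff : ∀ c : ℂ, Differentiable ℂ fun x : ℂ => Matrix.transvection t.i t.j (c * x) := by
      intro c
      rw [← differentiableOn_univ, differentiableOn_matrix_iff]
      intro i j
      simp only [Matrix.transvection, Matrix.add_apply, Matrix.single_apply]
      split_ifs <;> fun_prop
    rw [hinv]
    have := lempert_conj_le_of_path (A := A) (B := B) (hdiff t.c) (hdiff (-t.c)) ?_ ?_
    · simpa [Matrix.TransvectionStruct.toMatrix] using this
    · intro x
      exact hmul _ _ (by ring)
    · simp
  · intro P Q hP hQ h1 h2 A B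
    rw [Matrix.mul_inv_rev]
    calc _ = lempert (spectralBall n) A (P * (Q * B * Q⁻¹) * P⁻¹) := by simp only [mul_assoc]
      _ ≤ _ := (h1 _ _).trans (h2 _ _)

theorem lempert_eq_of_isConj_right (h : IsConj B C) :
    lempert (spectralBall n) A B = lempert (spectralBall n) A C := by
  have key : ∀ {B C : Matrix (Fin n) (Fin n) ℂ}, IsConj B C →
      lempert (spectralBall n) A C ≤ lempert (spectralBall n) A B := by
    rintro B C ⟨c, hc⟩
    have hdet : (c : Matrix (Fin n) (Fin n) ℂ).det ≠ 0 :=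
      ((Matrix.isUnit_iff_isUnit_det _).1 c.isUnit).ne_zero
    have h := lempert_conj_le _ hdet A B
    rwa [hc.eq, Matrix.mul_nonsing_inv_cancel_right _ _ (isUnit_iff_ne_zero.2 hdet)] at h
  exact le_antisymm (key h.symm) (key h)

theorem lempert_spectralBall_comm (A B : Matrix (Fin n) (Fin n) ℂ) :
    lempert (spectralBall n) A B = lempert (spectralBall n) B A :=
  lempert_comm

theorem lempert_eq_of_isConj_left (h : IsConj A C) :
    lempert (spectralBall n) A B = lempert (spectralBall n) C B := by
  rw [lempert_spectralBall_comm, lempert_eq_of_isConj_right h, lempert_spectralBall_comm]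

/-- The Lempert function can only increase under degeneration. -/
theorem lempert_le_of_mem_closure (h : C ∈ closure {X | IsConj B X}) :
    lempert (spectralBall n) A B ≤ lempert (spectralBall n) A C := by
  refine le_of_forall_gt fun c hc => ?_
  have hev := eventually_lempert_lt isOpen_spectralBall hc
  have hcont : Filter.Tendsto (fun X => (A, X)) (𝓝 C) (𝓝 (A, C)) :=
    (Continuous.prodMk_right A).continuousAt
  -- Upper semicontinuity at (A, C) bounds the value at some conjugate of B, hence at B itself.
  obtain ⟨X, hX, hconj⟩ := mem_closure_iff_nhds.1 h _ (hcont.eventually hev)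
  rw [lempert_eq_of_isConj_right hconj]
  exact hX

end Conjugation

/-! ### A Schwarz lemma for eigenvalues, and the Lempert function with pole 0. -/

section Schwarz

open scoped Matrix.Norms.Elementwise

variable {n : ℕ}

theorem norm_coeff_charpoly_le {M : Matrix (Fin n) (Fin n) ℂ} {R : ℝ}
    (h : ∀ t, M.charpoly.IsRoot t → ‖t‖ ≤ R) (i : ℕ) :
    ‖M.charpoly.coeff i‖ ≤ R ^ (n - i) * n.choose i := by
  have := Polynomial.coeff_le_of_roots_le (f := RingHom.id ℂ) (p := M.charpoly) (B := R) i
    M.charpoly_monic (IsAlgClosed.splits _) (fun z hz => h z (by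
      rw [Polynomial.map_id] at hz
      exact Polynomial.isRoot_of_mem_roots hz))
  simpa using this

/-- A converse to `norm_coeff_charpoly_le` with the loss 2 ^ n, which is removed later by passing to
powers of the matrix. -/
theorem norm_root_le_of_norm_coeff_le {M : Matrix (Fin n) (Fin n) ℂ} {R : ℝ} (hR : 0 ≤ R)
    (h : ∀ i, ‖M.charpoly.coeff i‖ ≤ R ^ (n - i) * n.choose i) {t : ℂ}
    (ht : M.charpoly.IsRoot t) : ‖t‖ ≤ 2 ^ n * R := by
  by_contra! hlt
  have hRt : R ≤ ‖t‖ := by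
    refine le_trans ?_ hlt.le
    have : (1 : ℝ) ≤ 2 ^ n := one_le_pow₀ (by norm_num)
    nlinarith
  have ht0 : 0 < ‖t‖ := lt_of_le_of_lt (by positivity) hlt
  have hdeg : M.charpoly.natDegree = n := by simp [Matrix.charpoly_natDegree_eq_dim]
  have hn : 0 < n := by
    rcases Nat.eq_zero_or_pos n with rfl | h
    · have : M.charpoly = 1 := M.charpoly_monic.natDegree_eq_zero.1 hdeg
      rw [this] at ht
      simp at ht
    · exact h
  have heval : t ^ n = -∑ i ∈ Finset.range n, M.charpoly.coeff i * t ^ i := by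
    have h1 := ht
    rw [Polynomial.IsRoot, Polynomial.eval_eq_sum_range, hdeg, Finset.sum_range_succ] at h1
    have h2 : M.charpoly.coeff n = 1 := by
      have := M.charpoly_monic.coeff_natDegree
      rwa [hdeg] at this
    rw [h2, one_mul] at h1
    exact eq_neg_of_add_eq_zero_right h1
  have h1 : ‖t‖ ^ n ≤ 2 ^ n * R * ‖t‖ ^ (n - 1) := by
    rw [← norm_pow, heval, norm_neg]
    calc ‖∑ i ∈ Finset.range n, M.charpoly.coeff i * t ^ i‖
        ≤ ∑ i ∈ Finset.range n, (n.choose i : ℝ) * (R * ‖t‖ ^ (n - 1)) := by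
          refine (norm_sum_le _ _).trans (Finset.sum_le_sum fun i hi => ?_)
          rw [Finset.mem_range] at hi
          rw [norm_mul, norm_pow]
          calc ‖M.charpoly.coeff i‖ * ‖t‖ ^ i
              ≤ (R ^ (n - i) * n.choose i) * ‖t‖ ^ i := by gcongr; exact h i
            _ = (n.choose i : ℝ) * (R * (R ^ (n - 1 - i) * ‖t‖ ^ i)) := by
              rw [show n - i = (n - 1 - i) + 1 by omega, pow_succ]; ring
            _ ≤ (n.choose i : ℝ) * (R * (‖t‖ ^ (n - 1 - i) * ‖t‖ ^ i)) := by gcongr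
            _ = _ := by rw [← pow_add, show n - 1 - i + i = n - 1 by omega]
      _ = (∑ i ∈ Finset.range n, (n.choose i : ℝ)) * (R * ‖t‖ ^ (n - 1)) := by
          rw [Finset.sum_mul]
      _ ≤ 2 ^ n * (R * ‖t‖ ^ (n - 1)) := by
          gcongr
          have := Nat.sum_range_choose n
          rw [Finset.sum_range_succ] at this
          have h3 : (∑ i ∈ Finset.range n, n.choose i) ≤ 2 ^ n := by omega
          exact_mod_cast h3
      _ = _ := by ring
  have h2 : ‖t‖ ^ n = ‖t‖ * ‖t‖ ^ (n - 1) := by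
    rw [← pow_succ', Nat.sub_add_cancel hn]
  rw [h2] at h1
  exact absurd (le_of_mul_le_mul_right h1 (by positivity)) (not_le.2 hlt)

theorem le_of_forall_pow_le_const_mul_pow {a b C : ℝ} (hb : 0 ≤ b)
    (h : ∀ k : ℕ, 0 < k → a ^ k ≤ C * b ^ k) : a ≤ b := by
  by_contra! hlt
  rcases hb.eq_or_lt with rfl | hb
  · have := h 1 one_pos
    simp at this
    linarith
  have hq : 1 < a / b := by rwa [one_lt_div hb]
  obtain ⟨k, hk⟩ := ((tendsto_pow_atTop_atTop_of_one_lt hq).eventually_gt_atTop C).and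
    (Filter.eventually_gt_atTop 0) |>.exists
  have := h k hk.2
  rw [div_pow, lt_div_iff₀ (by positivity)] at hk
  linarith [hk.1]

/-- A Schwarz lemma for eigenvalues. -/
theorem norm_root_le_of_smul {ψ : ℂ → Matrix (Fin n) (Fin n) ℂ}
    (hψ : DifferentiableOn ℂ ψ (ball 0 1)) {K : ℝ} (hK : 0 ≤ K)
    (h : ∀ x ∈ ball (0 : ℂ) 1, ∀ t, (x • ψ x).charpoly.IsRoot t → ‖t‖ ≤ K) :
    ∀ x ∈ ball (0 : ℂ) 1, ∀ t, (ψ x).charpoly.IsRoot t → ‖t‖ ≤ K := by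
  intro x hx t ht
  rw [mem_ball_zero_iff] at hx
  have hr : ∀ r : ℝ, ‖x‖ < r → r < 1 → ‖t‖ ≤ K / r := by
    intro r hxr hr1
    have hr0 : 0 < r := (norm_nonneg _).trans_lt hxr
    have hKr : 0 ≤ K / r := by positivity
    -- On the circle of radius r the eigenvalues of ψ are at most K / r, so the maximum principle
    -- bounds the coefficients for ψ ^ k inside. The constant 2 ^ n does not depend on k and
    -- disappears as k grows.
    refine le_of_forall_pow_le_const_mul_pow (C := 2 ^ n) hKr fun k hk => ?_
    rw [← norm_pow]
    refine norm_root_le_of_norm_coeff_le (M := ψ x ^ k) (by positivity) (fun i => ?_)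
      ((isRoot_charpoly_pow hk).2 ⟨t, ht, rfl⟩)
    have hd : DifferentiableOn ℂ (fun y => (ψ y ^ k).charpoly.coeff i) (ball 0 1) :=
      (hψ.matrix_pow k).charpoly_coeff i
    have hcl : DiffContOnCl ℂ (fun y => (ψ y ^ k).charpoly.coeff i) (ball 0 r) := by
      apply DifferentiableOn.diffContOnCl
      rw [closure_ball _ hr0.ne']
      exact hd.mono (closedBall_subset_ball hr1)
    refine Complex.norm_le_of_forall_mem_frontier_norm_le isBounded_ball hcl (fun y hy => ?_)
      (subset_closure (by simpa using hxr))
    rw [frontier_ball _ hr0.ne', mem_sphere_zero_iff_norm] at hy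
    refine norm_coeff_charpoly_le (fun s hs => ?_) i
    obtain ⟨u, hu, rfl⟩ := (isRoot_charpoly_pow hk).1 hs
    rw [norm_pow]
    gcongr
    have hy0 : y ≠ 0 := by
      rintro rfl
      simp at hy; linarith
    have h1 := h y (by simp [hy, hr1]) (y * u) ((isRoot_charpoly_smul hy0).2 hu)
    rw [norm_mul, hy] at h1
    rw [le_div_iff₀ hr0]
    linarith
  have htend : Filter.Tendsto (fun r : ℝ => K / r) (𝓝[<] 1) (𝓝 (K / 1)) :=
    (continuousAt_const.div continuousAt_id one_ne_zero).mono_left nhdsWithin_le_nhds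
  rw [div_one] at htend
  refine ge_of_tendsto htend ?_
  filter_upwards [self_mem_nhdsWithin, (lt_mem_nhds hx).filter_mono nhdsWithin_le_nhds]
    with r h1 h2 using hr r h2 h1

theorem exists_eq_smul_of_apply_eq_zero {E : Type*} [NormedAddCommGroup E] [NormedSpace ℂ E]
    [CompleteSpace E] {f : ℂ → E} {a : ℂ} (hf : DifferentiableOn ℂ f (ball 0 1))
    (ha : a ∈ ball (0 : ℂ) 1) (h : f a = 0) :
    ∃ g : ℂ → E, DifferentiableOn ℂ g (ball 0 1) ∧ ∀ x, f x = (x - a) • g x := by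
  refine ⟨dslope f a, (Complex.differentiableOn_dslope (isOpen_ball.mem_nhds ha)).2 hf, ?_⟩
  intro x
  rw [sub_smul_dslope, h, sub_zero]

theorem norm_root_le_mul_norm {φ : ℂ → Matrix (Fin n) (Fin n) ℂ}
    (hφ : DifferentiableOn ℂ φ (ball 0 1)) {K : ℝ} (hK : 0 ≤ K) (h0 : φ 0 = 0)
    (h : ∀ x ∈ ball (0 : ℂ) 1, ∀ t, (φ x).charpoly.IsRoot t → ‖t‖ ≤ K) :
    ∀ x ∈ ball (0 : ℂ) 1, ∀ t, (φ x).charpoly.IsRoot t → ‖t‖ ≤ K * ‖x‖ := by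
  obtain ⟨ψ, hψ, hφψ⟩ := exists_eq_smul_of_apply_eq_zero hφ (by simp) h0
  simp only [sub_zero] at hφψ
  have key := norm_root_le_of_smul hψ hK (fun x hx t ht => h x hx t (by rwa [hφψ]))
  intro x hx t ht
  by_cases hx0 : x = 0
  · subst hx0
    rw [h0, isRoot_charpoly_iff_det, sub_zero, Matrix.det_smul, Matrix.det_one, mul_one,
      Fintype.card_fin] at ht
    have : t = 0 := by
      by_contra hne
      exact pow_ne_zero _ hne ht
    simp [this]
  · have ht' : (x • ψ x).charpoly.IsRoot (x * (t / x)) := by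
      rw [mul_div_cancel₀ _ hx0, ← hφψ]; exact ht
    have := key x hx _ ((isRoot_charpoly_smul hx0).1 ht')
    rwa [norm_div, div_le_iff₀ (norm_pos_iff.2 hx0)] at this

theorem zero_mem_spectralBall : (0 : Matrix (Fin n) (Fin n) ℂ) ∈ spectralBall n :=
  mem_spectralBall_of_row_sum (by simp)

theorem smul_mem_spectralBall {B : Matrix (Fin n) (Fin n) ℂ} {c : ℂ}
    (h : ∀ t, B.charpoly.IsRoot t → ‖c‖ * ‖t‖ < 1) : c • B ∈ spectralBall n := by
  by_cases hc : c = 0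
  · rw [hc, zero_smul]; exact zero_mem_spectralBall
  · rw [mem_spectralBall_iff]
    intro t ht
    rw [← mul_div_cancel₀ t hc, isRoot_charpoly_smul hc] at ht
    have := h _ ht
    rwa [← norm_mul, mul_div_cancel₀ _ hc] at this

/-- The discs x ↦ (x / r) • B with r above the spectral radius give one inequality, the Schwarz
lemma for eigenvalues the other. -/
theorem lempert_zero_left {B : Matrix (Fin n) (Fin n) ℂ} (hB : B ∈ spectralBall n) :
    lempert (spectralBall n) 0 B = spectralRadius ℂ B := by
  refine le_antisymm (le_of_forall_gt fun c hc => ?_) (le_of_forall_gt fun c hc => ?_)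
  · obtain ⟨r, hr0, hr1⟩ := exists_between (lt_min hc hB : spectralRadius ℂ B < min c 1)
    have hr2 : r < 1 := hr1.trans_le (min_le_right _ _)
    lift r to NNReal using hr2.ne_top
    have hrpos : 0 < r := by exact_mod_cast (zero_le (a := spectralRadius ℂ B)).trans_lt hr0
    have hrne : ((r : ℝ) : ℂ) ≠ 0 := by exact_mod_cast hrpos.ne'
    have hnorm : ‖((r : ℝ) : ℂ)‖ = r := by simp
    refine lempert_lt_iff.2 ⟨(r : ℝ), ?_, ?_, fun x => (x / (r : ℝ)) • B, ?_, ?_, ?_, ?_⟩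
    · rw [mem_ball_zero_iff, hnorm]; exact_mod_cast hr2
    · have h3 : ‖((r : ℝ) : ℂ)‖ₑ = r := by
        rw [enorm_eq_nnnorm]; congr 1; ext; simp
      rw [h3]; exact hr1.trans_le (min_le_left _ _)
    · fun_prop
    · intro x hx
      rw [mem_ball_zero_iff] at hx
      refine smul_mem_spectralBall fun t ht => ?_
      have h1 : ‖t‖ < r := by
        have := (enorm_le_spectralRadius ht).trans_lt hr0
        rw [enorm_eq_nnnorm] at this
        exact_mod_cast this
      rw [norm_div, hnorm, div_mul_eq_mul_div, div_lt_one (by exact_mod_cast hrpos)]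
      nlinarith [norm_nonneg x, norm_nonneg t]
    · simp
    · simp only
      rw [div_self hrne, one_smul]
  · obtain ⟨α, hα, hαc, φ, hφ, hm, h0, h1⟩ := lempert_lt_iff.1 hc
    refine lt_of_le_of_lt ?_ hαc
    rw [spectralRadius_le_iff]
    intro t ht
    have := norm_root_le_mul_norm hφ zero_le_one h0
      (fun x hx t ht => (mem_spectralBall_iff.1 (hm hx) t ht).le) α hα t (by rwa [h1])
    rw [one_mul] at this
    rw [enorm_eq_nnnorm, enorm_eq_nnnorm, ENNReal.coe_le_coe]
    exact this

/-- If b is an eigenvalue of B beyond c and all eigenvalues of X have modulus at most c, then the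
characteristic polynomial of X has modulus at least (‖b‖ - c) ^ n at b. Near B this contradicts
continuity of the determinant. -/
theorem eventually_lt_spectralRadius {B : Matrix (Fin n) (Fin n) ℂ} {c : ℝ≥0∞}
    (hc : c < spectralRadius ℂ B) : ∀ᶠ X in 𝓝 B, c < spectralRadius ℂ X := by
  obtain ⟨b, hb, hcb⟩ := lt_spectralRadius_iff.1 hc
  lift c to NNReal using hcb.ne_top
  have hcb' : (c : ℝ) < ‖b‖ := by
    rw [enorm_eq_nnnorm] at hcb
    exact_mod_cast hcb
  have hpos : 0 < (‖b‖ - c) ^ n := pow_pos (by linarith) _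
  have hcont : ContinuousAt (fun X : Matrix (Fin n) (Fin n) ℂ => ‖X.charpoly.eval b‖) B := by
    simp only [eval_charpoly_eq_det]
    exact (Continuous.norm (Continuous.matrix_det (by fun_prop))).continuousAt
  have hev : ∀ᶠ X : Matrix (Fin n) (Fin n) ℂ in 𝓝 B, ‖X.charpoly.eval b‖ < (‖b‖ - c) ^ n :=
    hcont.eventually_lt continuousAt_const (by
      rw [show B.charpoly.eval b = 0 from hb, norm_zero]; exact hpos)
  filter_upwards [hev] with X hX
  by_contra! hle
  rw [spectralRadius_le_iff] at hle
  refine absurd hX (not_lt.2 ?_)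
  obtain ⟨d, hd, -⟩ := exists_diagonal_mem_closure X
  have hd' : ∀ i, ‖d i‖ ≤ c := by
    intro i
    have := hle (d i) (by rw [hd, isRoot_prod_X_sub_C]; exact ⟨i, rfl⟩)
    rw [enorm_eq_nnnorm] at this
    exact_mod_cast this
  rw [hd, Polynomial.eval_prod, norm_prod]
  calc (‖b‖ - c) ^ n = ∏ i : Fin n, (‖b‖ - c) := by simp
    _ ≤ _ := by
      refine Finset.prod_le_prod (fun i _ => by linarith) fun i _ => ?_
      simp only [Polynomial.eval_sub, Polynomial.eval_X, Polynomial.eval_C]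
      linarith [norm_sub_norm_le b (d i), hd' i]

end Schwarz

/-! ### Möbius automorphisms of the spectral ball, and continuity at scalar matrices. -/

section Moebius

open scoped Matrix.Norms.Elementwise ComplexConjugate

variable {n : ℕ} {μ : ℂ} {A B M : Matrix (Fin n) (Fin n) ℂ}

/-- The Möbius map `z ↦ (z - μ) / (1 - conj μ * z)` applied to a matrix. -/
noncomputable def matrixMoebius (μ : ℂ) (M : Matrix (Fin n) (Fin n) ℂ) :
    Matrix (Fin n) (Fin n) ℂ :=
  (M - μ • 1) * (1 - conj μ • M)⁻¹

theorem det_smul_one_sub_smul {a b : ℂ} (hb : b ≠ 0) :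
    (a • (1 : Matrix (Fin n) (Fin n) ℂ) - b • M).det = b ^ n * M.charpoly.eval (a / b) := by
  rw [eval_charpoly_eq_det]
  have : a • (1 : Matrix (Fin n) (Fin n) ℂ) - b • M = b • ((a / b) • 1 - M) := by
    rw [smul_sub, smul_smul, mul_div_cancel₀ _ hb]
  rw [this, Matrix.det_smul, Fintype.card_fin]

theorem det_one_sub_conj_smul_ne_zero (hμ : ‖μ‖ < 1) (hM : M ∈ spectralBall n) :
    (1 - conj μ • M).det ≠ 0 := by
  by_cases h0 : μ = 0
  · simp [h0]
  have hc : conj μ ≠ 0 := by simpa using h0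
  have := det_smul_one_sub_smul (M := M) (a := 1) hc
  rw [one_smul] at this
  rw [this]
  refine mul_ne_zero (pow_ne_zero _ hc) fun h => ?_
  have h1 := mem_spectralBall_iff.1 hM _ h
  rw [norm_div, norm_one, RCLike.norm_conj, div_lt_one (norm_pos_iff.2 h0)] at h1
  linarith

/-- Clearing the inverse leaves a linear pencil in M, whose determinant is read off from the
characteristic polynomial of M. The eigenvalues of the Möbius image and its characteristic
polynomial both follow from this. -/
theorem det_smul_one_sub_matrixMoebius (hμ : ‖μ‖ < 1) (hM : M ∈ spectralBall n) (x : ℂ) :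
    (x • 1 - matrixMoebius μ M).det * (1 - conj μ • M).det =
      ((x + μ) • (1 : Matrix (Fin n) (Fin n) ℂ) - (1 + x * conj μ) • M).det := by
  have hu : IsUnit (1 - conj μ • M).det :=
    isUnit_iff_ne_zero.2 (det_one_sub_conj_smul_ne_zero hμ hM)
  rw [← Matrix.det_mul, sub_mul, matrixMoebius, mul_assoc, Matrix.nonsing_inv_mul _ hu, mul_one]
  congr 1
  simp only [mul_sub, mul_one, smul_mul_assoc, one_mul, add_smul, one_smul, smul_smul]
  abel

theorem isRoot_charpoly_matrixMoebius_iff (hμ : ‖μ‖ < 1) (hM : M ∈ spectralBall n) {x : ℂ} :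
    (matrixMoebius μ M).charpoly.IsRoot x ↔
      ∃ y, M.charpoly.IsRoot y ∧ x = (y - μ) / (1 - conj μ * y) := by
  have hdet := det_one_sub_conj_smul_ne_zero hμ hM
  have key := det_smul_one_sub_matrixMoebius hμ hM x
  have hroot : (matrixMoebius μ M).charpoly.IsRoot x ↔
      ((x + μ) • (1 : Matrix (Fin n) (Fin n) ℂ) - (1 + x * conj μ) • M).det = 0 := by
    rw [isRoot_charpoly_iff_det, ← key, mul_eq_zero, or_iff_left hdet]
  have hμ2 : 1 - conj μ * μ ≠ 0 := one_sub_conj_mul_ne_zero hμ hμ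
  rw [hroot]
  constructor
  · intro h
    by_cases hb : 1 + x * conj μ = 0
    · exfalso
      rw [hb, zero_smul, sub_zero, Matrix.det_smul, Matrix.det_one, mul_one] at h
      have hx : x = -μ := by
        by_contra hne
        exact pow_ne_zero _ (fun h => hne (eq_neg_of_add_eq_zero_left h)) h
      apply hμ2
      rw [hx] at hb
      linear_combination hb
    · rw [det_smul_one_sub_smul hb, mul_eq_zero, or_iff_right (pow_ne_zero _ hb)] at h
      refine ⟨_, h, ?_⟩
      have h1 := mem_spectralBall_iff.1 hM _ h
      have h2 := one_sub_conj_mul_ne_zero hμ h1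
      rw [eq_div_iff h2]
      field_simp
      ring
  · rintro ⟨y, hy, rfl⟩
    have h1 := mem_spectralBall_iff.1 hM _ hy
    have h2 := one_sub_conj_mul_ne_zero hμ h1
    have hb : 1 + (y - μ) / (1 - conj μ * y) * conj μ = (1 - conj μ * μ) / (1 - conj μ * y) := by
      rw [eq_div_iff h2]
      linear_combination conj μ * div_mul_cancel₀ (y - μ) h2
    have ha : (y - μ) / (1 - conj μ * y) + μ = (1 - conj μ * μ) / (1 - conj μ * y) * y := by
      rw [div_mul_eq_mul_div, eq_div_iff h2]
      linear_combination div_mul_cancel₀ (y - μ) h2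
    have hb0 : (1 - conj μ * μ) / (1 - conj μ * y) ≠ 0 := div_ne_zero hμ2 h2
    rw [hb, ha, det_smul_one_sub_smul hb0, mul_div_cancel_left₀ _ hb0,
      show M.charpoly.eval y = 0 from hy, mul_zero]

theorem norm_moebius_lt_one {y : ℂ} (hμ : ‖μ‖ < 1) (hy : ‖y‖ < 1) :
    ‖(y - μ) / (1 - conj μ * y)‖ < 1 := by
  rw [norm_div, div_lt_one (norm_pos_iff.2 (one_sub_conj_mul_ne_zero hμ hy)), norm_sub_rev]
  exact norm_sub_lt_norm_one_sub hμ hy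

theorem matrixMoebius_mem (hμ : ‖μ‖ < 1) (hM : M ∈ spectralBall n) :
    matrixMoebius μ M ∈ spectralBall n := by
  rw [mem_spectralBall_iff]
  intro t ht
  obtain ⟨y, hy, rfl⟩ := (isRoot_charpoly_matrixMoebius_iff hμ hM).1 ht
  exact norm_moebius_lt_one hμ (mem_spectralBall_iff.1 hM y hy)

theorem charpoly_matrixMoebius_eq (hμ : ‖μ‖ < 1) (hA : A ∈ spectralBall n)
    (h : A.charpoly = B.charpoly) :
    (matrixMoebius μ A).charpoly = (matrixMoebius μ B).charpoly := by
  have hB := mem_spectralBall_of_charpoly_eq h hA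
  have hdet : ∀ a b : ℂ, (a • (1 : Matrix (Fin n) (Fin n) ℂ) - b • A).det =
      (a • (1 : Matrix (Fin n) (Fin n) ℂ) - b • B).det := by
    intro a b
    by_cases hb : b = 0
    · simp [hb]
    · rw [det_smul_one_sub_smul hb, det_smul_one_sub_smul hb, h]
  apply Polynomial.funext
  intro x
  rw [eval_charpoly_eq_det, eval_charpoly_eq_det]
  have h1 := det_smul_one_sub_matrixMoebius hμ hA x
  have h2 := det_smul_one_sub_matrixMoebius hμ hB x
  have h3 := hdet 1 (conj μ)
  rw [one_smul] at h3
  rw [hdet, ← h2, h3] at h1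
  exact mul_right_cancel₀ (det_one_sub_conj_smul_ne_zero hμ hB) h1

theorem matrixMoebius_neg_matrixMoebius (hμ : ‖μ‖ < 1) (hM : M ∈ spectralBall n) :
    matrixMoebius (-μ) (matrixMoebius μ M) = M := by
  have hu : IsUnit (1 - conj μ • M).det :=
    isUnit_iff_ne_zero.2 (det_one_sub_conj_smul_ne_zero hμ hM)
  have hμ2 : 1 - conj μ * μ ≠ 0 := one_sub_conj_mul_ne_zero hμ hμ
  have h1 : matrixMoebius μ M * (1 - conj μ • M) = M - μ • 1 := by
    rw [matrixMoebius, mul_assoc, Matrix.nonsing_inv_mul _ hu, mul_one]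
  have h2 : (matrixMoebius μ M - (-μ) • 1) * (1 - conj μ • M) = (1 - conj μ * μ) • M := by
    rw [sub_mul, h1, smul_mul_assoc, one_mul]
    module
  have h3 : (1 - conj (-μ) • matrixMoebius μ M) * (1 - conj μ • M) =
      (1 - conj μ * μ) • 1 := by
    rw [sub_mul, smul_mul_assoc, h1]
    rw [map_neg, one_mul]
    module
  have hM' := matrixMoebius_mem hμ hM
  have hu' : IsUnit (1 - conj (-μ) • matrixMoebius μ M).det :=
    isUnit_iff_ne_zero.2 (det_one_sub_conj_smul_ne_zero (by simpa using hμ) hM')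
  have h4 : matrixMoebius (-μ) (matrixMoebius μ M) * ((1 - conj μ * μ) • 1) =
      (1 - conj μ * μ) • M := by
    rw [← h3, ← h2, matrixMoebius, mul_assoc, ← mul_assoc _ _ (1 - conj μ • M),
      Matrix.nonsing_inv_mul _ hu', one_mul]
  rw [mul_smul_comm, mul_one] at h4
  exact smul_right_injective _ hμ2 h4

theorem matrixMoebius_matrixMoebius_neg (hμ : ‖μ‖ < 1) (hM : M ∈ spectralBall n) :
    matrixMoebius μ (matrixMoebius (-μ) M) = M := by
  simpa using matrixMoebius_neg_matrixMoebius (μ := -μ) (by simpa using hμ) hM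

theorem matrixMoebius_self (μ : ℂ) : matrixMoebius μ (μ • (1 : Matrix (Fin n) (Fin n) ℂ)) = 0 := by
  simp [matrixMoebius]

theorem matrixMoebius_neg_zero (μ : ℂ) :
    matrixMoebius (-μ) (0 : Matrix (Fin n) (Fin n) ℂ) = μ • 1 := by
  simp [matrixMoebius]

theorem matrixMoebius_diagonal (hμ : ‖μ‖ < 1) {d : Fin n → ℂ} (hd : ∀ i, ‖d i‖ < 1) :
    matrixMoebius μ (Matrix.diagonal d) =
      Matrix.diagonal fun i => (d i - μ) / (1 - conj μ * d i) := by
  have h : (1 - conj μ • Matrix.diagonal d)⁻¹ =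
      Matrix.diagonal fun i => (1 - conj μ * d i)⁻¹ := by
    apply Matrix.inv_eq_right_inv
    ext i j
    simp only [Matrix.mul_diagonal]
    by_cases hij : i = j
    · subst hij
      simp [mul_inv_cancel₀ (one_sub_conj_mul_ne_zero hμ (hd i))]
    · simp [hij]
  rw [matrixMoebius, h]
  ext i j
  simp only [Matrix.mul_diagonal]
  by_cases hij : i = j
  · subst hij
    simp [div_eq_mul_inv]
  · simp [hij]

theorem differentiableOn_matrixMoebius (hμ : ‖μ‖ < 1) :
    DifferentiableOn ℂ (matrixMoebius μ) (spectralBall n) := by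
  have hlin : DifferentiableOn ℂ (fun M : Matrix (Fin n) (Fin n) ℂ => 1 - conj μ • M)
      (spectralBall n) := by fun_prop
  have hinv : DifferentiableOn ℂ (fun M : Matrix (Fin n) (Fin n) ℂ => (1 - conj μ • M)⁻¹)
      (spectralBall n) := by
    refine differentiableOn_matrix_iff.2 fun i j => ?_
    simp only [Matrix.inv_def, Matrix.smul_apply, smul_eq_mul, Ring.inverse_eq_inv',
      Matrix.adjugate_apply]
    refine DifferentiableOn.mul (hlin.matrix_det.inv fun M hM =>
      det_one_sub_conj_smul_ne_zero hμ hM) (DifferentiableOn.matrix_det ?_)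
    refine differentiableOn_matrix_iff.2 fun k l => ?_
    by_cases hk : k = j
    · subst hk
      simp only [Matrix.updateRow_self]
      exact differentiableOn_const _
    · simp only [Matrix.updateRow_ne hk]
      exact differentiableOn_matrix_iff.1 hlin k l
  exact DifferentiableOn.matrix_mul (by fun_prop) hinv

theorem lempert_matrixMoebius (hμ : ‖μ‖ < 1) (hA : A ∈ spectralBall n) (hB : B ∈ spectralBall n) :
    lempert (spectralBall n) (matrixMoebius μ A) (matrixMoebius μ B) =
      lempert (spectralBall n) A B := by
  have hμ' : ‖-μ‖ < 1 := by simpa using hμ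
  refine le_antisymm (lempert_comp_le (differentiableOn_matrixMoebius hμ)
    fun M hM => matrixMoebius_mem hμ hM) ?_
  have := lempert_comp_le (z := matrixMoebius μ A) (w := matrixMoebius μ B)
    (differentiableOn_matrixMoebius (n := n) hμ') fun M hM => matrixMoebius_mem hμ' hM
  rwa [matrixMoebius_neg_matrixMoebius hμ hA, matrixMoebius_neg_matrixMoebius hμ hB] at this

theorem smul_one_mem_spectralBall (hμ : ‖μ‖ < 1) :
    μ • (1 : Matrix (Fin n) (Fin n) ℂ) ∈ spectralBall n := by
  rw [← matrixMoebius_neg_zero]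
  exact matrixMoebius_mem (by simpa using hμ) zero_mem_spectralBall

theorem lempert_smul_one_left (hμ : ‖μ‖ < 1) (hB : B ∈ spectralBall n) :
    lempert (spectralBall n) (μ • 1) B = spectralRadius ℂ (matrixMoebius μ B) := by
  rw [← lempert_matrixMoebius hμ (smul_one_mem_spectralBall hμ) hB, matrixMoebius_self,
    lempert_zero_left (matrixMoebius_mem hμ hB)]

theorem norm_lt_one_of_smul_one_mem (hn : 1 ≤ n)
    (h : μ • (1 : Matrix (Fin n) (Fin n) ℂ) ∈ spectralBall n) : ‖μ‖ < 1 := by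
  refine mem_spectralBall_iff.1 h μ ?_
  have : Nonempty (Fin n) := ⟨⟨0, hn⟩⟩
  rw [isRoot_charpoly_iff_det, sub_self, Matrix.det_zero]

theorem continuousOn_of_usc_lsc {X : Type*} [TopologicalSpace X] {f : X → ℝ≥0∞} {s : Set X} {x : X}
    (h1 : ∀ c, f x < c → ∀ᶠ y in 𝓝[s] x, f y < c) (h2 : ∀ c, c < f x → ∀ᶠ y in 𝓝[s] x, c < f y) :
    ContinuousWithinAt f s x :=
  tendsto_order.2 ⟨h2, h1⟩

theorem eventually_lempert_lt_right {c : ℝ≥0∞} (h : lempert (spectralBall n) A B < c) :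
    ∀ᶠ X in 𝓝 B, lempert (spectralBall n) A X < c :=
  (Continuous.prodMk_right A).continuousAt.eventually (eventually_lempert_lt isOpen_spectralBall h)

/-- A Möbius map moves the pole to 0, where the function becomes the spectral radius. Lower
semicontinuity of the latter complements the general upper semicontinuity. -/
theorem continuousOn_lempert_of_isScalarMatrix (hn : 1 ≤ n) (hA : A ∈ spectralBall n)
    (h : IsScalarMatrix A) :
    ContinuousOn (fun B => lempert (spectralBall n) A B) (spectralBall n) := by
  obtain ⟨μ, rfl⟩ := h
  have hμ := norm_lt_one_of_smul_one_mem hn hA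
  intro B hB
  refine continuousOn_of_usc_lsc
    (fun c hc => (eventually_lempert_lt_right hc).filter_mono nhdsWithin_le_nhds) fun c hc => ?_
  rw [lempert_smul_one_left hμ hB] at hc
  have hcont : ContinuousWithinAt (matrixMoebius μ) (spectralBall n) B :=
    (differentiableOn_matrixMoebius hμ).continuousOn B hB
  filter_upwards [hcont.eventually (eventually_lt_spectralRadius hc), self_mem_nhdsWithin]
    with X hX hXm
  rwa [lempert_smul_one_left hμ hXm]

end Moebius

/-! ### Companion matrices as a holomorphic section of `sigma`, and cyclic matrices. -/

section Companion

open scoped Matrix.Norms.Elementwise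
open Polynomial (X C)

variable {n : ℕ} {A B : Matrix (Fin n) (Fin n) ℂ}

/-- The companion matrix with ones above the diagonal and prescribed first column. -/
def firstColumnCompanion (c : Fin n → ℂ) : Matrix (Fin n) (Fin n) ℂ :=
  Matrix.of fun i j => (if (j : ℕ) = 0 then c i else 0) + if (i : ℕ) + 1 = j then 1 else 0

theorem sum_fin_rev {M : Type*} [AddCommMonoid M] (f : ℕ → M) :
    ∑ j : Fin n, f (n - ((j : ℕ) + 1)) = ∑ k ∈ Finset.range n, f k := by
  rw [← Fin.sum_univ_eq_sum_range, ← Equiv.sum_comp Fin.revPerm (fun i : Fin n => f i)]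
  simp [Fin.val_rev]

theorem charpoly_eq_sub_sum (A : Matrix (Fin n) (Fin n) ℂ) :
    A.charpoly = X ^ n - ∑ j : Fin n, C ((-1) ^ (j : ℕ) * sigma A j) * X ^ (n - ((j : ℕ) + 1)) := by
  have hdeg : A.charpoly.natDegree = n := by simp [Matrix.charpoly_natDegree_eq_dim]
  have h2 : A.charpoly.coeff n = 1 := by
    have := A.charpoly_monic.coeff_natDegree
    rwa [hdeg] at this
  conv_lhs => rw [A.charpoly.as_sum_range_C_mul_X_pow, hdeg, Finset.sum_range_succ, h2,
    ← sum_fin_rev fun k => C (A.charpoly.coeff k) * X ^ k]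
  rw [map_one, one_mul, add_comm, sub_eq_add_neg, ← Finset.sum_neg_distrib]
  congr 1
  refine Finset.sum_congr rfl fun j _ => ?_
  rw [← neg_mul, ← map_neg, sigma]
  congr 2
  rw [← mul_assoc, ← pow_add, show (j : ℕ) + (j + 1) = 2 * j + 1 by ring, pow_succ, pow_mul]
  simp

theorem charpoly_eq_iff_sigma_eq : A.charpoly = B.charpoly ↔ sigma A = sigma B := by
  constructor
  · intro h
    unfold sigma
    rw [h]
  · intro h
    rw [charpoly_eq_sub_sum, charpoly_eq_sub_sum, h]

theorem firstColumnCompanion_mulVec_single (c : Fin n → ℂ) {k : ℕ} (hk : k + 1 < n) :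
    (firstColumnCompanion c).mulVec (Pi.single ⟨k + 1, hk⟩ 1) =
      Pi.single ⟨k, by omega⟩ 1 := by
  ext i
  rw [Matrix.mulVec_single_one]
  simp [firstColumnCompanion, Pi.single_apply, Fin.ext_iff]

theorem firstColumnCompanion_pow_mulVec (c : Fin n → ℂ) {k : ℕ} (hk : k < n) :
    (firstColumnCompanion c ^ k).mulVec (Pi.single ⟨n - 1, by omega⟩ 1) =
      Pi.single ⟨n - (k + 1), by omega⟩ 1 := by
  induction k with
  | zero => rw [pow_zero, Matrix.one_mulVec]
  | succ k ih =>
    rw [pow_succ', ← Matrix.mulVec_mulVec, ih (by omega)]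
    have : n - (k + 1) = n - (k + 2) + 1 := by omega
    simp only [this]
    exact firstColumnCompanion_mulVec_single c (by omega)

theorem aeval_mulVec_eq_sum (A : Matrix (Fin n) (Fin n) ℂ) (v : Fin n → ℂ) (q : Polynomial ℂ)
    {m : ℕ} (hq : q.natDegree < m) :
    (Polynomial.aeval A q).mulVec v = ∑ k ∈ Finset.range m, q.coeff k • (A ^ k).mulVec v := by
  rw [Polynomial.aeval_eq_sum_range' hq, Matrix.sum_mulVec]
  simp [Matrix.smul_mulVec]

/-- The vectors K ^ k e with k < n are basis vectors, so no nonzero polynomial in K of degree below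
n annihilates e. The two sides are monic of degree n and both annihilate e, so their difference
vanishes. -/
theorem charpoly_firstColumnCompanion (c : Fin n → ℂ) :
    (firstColumnCompanion c).charpoly = X ^ n - ∑ j : Fin n, C (c j) * X ^ (n - ((j : ℕ) + 1)) := by
  rcases Nat.eq_zero_or_pos n with rfl | hn
  · simp [Matrix.charpoly]
  set K := firstColumnCompanion c
  set e : Fin n → ℂ := Pi.single ⟨n - 1, by omega⟩ 1
  set p : Polynomial ℂ := X ^ n - ∑ j : Fin n, C (c j) * X ^ (n - ((j : ℕ) + 1)) with hp
  have hsumdeg : (∑ j : Fin n, C (c j) * X ^ (n - ((j : ℕ) + 1))).degree < (n : WithBot ℕ) := by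
    refine (Polynomial.degree_sum_le _ _).trans_lt ?_
    rw [Finset.sup_lt_iff (WithBot.bot_lt_coe _)]
    intro j _
    refine (Polynomial.degree_C_mul_X_pow_le _ _).trans_lt ?_
    exact_mod_cast (by omega : n - ((j : ℕ) + 1) < n)
  have hpK : (Polynomial.aeval K p).mulVec e = 0 := by
    have h1 : (K ^ n).mulVec e = ∑ j : Fin n, c j • (K ^ (n - ((j : ℕ) + 1))).mulVec e := by
      have h2 : (K ^ n).mulVec e = c := by
        obtain ⟨m, rfl⟩ : ∃ m, n = m + 1 := ⟨n - 1, by omega⟩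
        rw [pow_succ', ← Matrix.mulVec_mulVec, firstColumnCompanion_pow_mulVec c (by omega)]
        ext i
        simp [K, firstColumnCompanion]
      rw [h2]
      have h3 : ∀ j : Fin n, (K ^ (n - ((j : ℕ) + 1))).mulVec e = Pi.single j 1 := by
        intro j
        rw [firstColumnCompanion_pow_mulVec c (by omega)]
        congr 1
        ext
        simp
        omega
      ext i
      simp [h3, Finset.sum_apply, Pi.single_apply]
    rw [hp]
    simp only [map_sub, map_pow, Polynomial.aeval_X, map_sum, map_mul, Polynomial.aeval_C,
      Matrix.sub_mulVec, Matrix.sum_mulVec, h1]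
    simp [Algebra.algebraMap_eq_smul_one, Matrix.smul_mulVec]
  have hcK : (Polynomial.aeval K K.charpoly).mulVec e = 0 := by
    rw [Matrix.aeval_self_charpoly, Matrix.zero_mulVec]
  set q := K.charpoly - p with hq
  have hqdeg : q.degree < n := by
    have h1 : K.charpoly.degree = n := by simp [Matrix.charpoly_degree_eq_dim]
    have h2 : p.degree = n := by
      rw [hp, Polynomial.degree_sub_eq_left_of_degree_lt] <;> simp [hsumdeg]
    have h3 : p.leadingCoeff = 1 := by
      rw [hp, Polynomial.leadingCoeff_sub_of_degree_lt] <;> simp [hsumdeg]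
    rw [← h1]
    exact Polynomial.degree_sub_lt_left (h1.trans h2.symm) K.charpoly_monic.ne_zero
      (by rw [h3]; exact K.charpoly_monic)
  suffices hq0 : q = 0 by
    exact sub_eq_zero.1 hq0
  have hqn : q.natDegree < n := by
    by_cases h : q = 0
    · simp [h, hn]
    · exact (Polynomial.natDegree_lt_iff_degree_lt h).2 hqdeg
  have hqK : (Polynomial.aeval K q).mulVec e = 0 := by
    rw [hq, map_sub, Matrix.sub_mulVec, hpK, hcK, sub_zero]
  rw [aeval_mulVec_eq_sum _ _ _ hqn] at hqK
  ext k
  rw [Polynomial.coeff_zero]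
  by_cases hk : k < n
  · have h1 := congrFun hqK ⟨n - (k + 1), by omega⟩
    rw [Finset.sum_apply, Finset.sum_eq_single k] at h1
    · rw [Pi.smul_apply, firstColumnCompanion_pow_mulVec c hk] at h1
      simpa using h1
    · intro l hl hlk
      rw [Finset.mem_range] at hl
      rw [Pi.smul_apply, firstColumnCompanion_pow_mulVec c hl, Pi.single_eq_of_ne, smul_zero]
      intro h
      rw [Fin.ext_iff] at h
      simp only at h
      omega
    · intro h
      simp [hk] at h
  · exact Polynomial.coeff_eq_zero_of_natDegree_lt (by omega)

theorem sigma_firstColumnCompanion (c : Fin n → ℂ) (j : Fin n) :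
    sigma (firstColumnCompanion c) j = (-1) ^ (j : ℕ) * c j := by
  have hne : n - ((j : ℕ) + 1) ≠ n := by omega
  rw [sigma, charpoly_firstColumnCompanion, Polynomial.coeff_sub, Polynomial.coeff_X_pow,
    if_neg hne, Polynomial.finsetSum_coeff, Finset.sum_eq_single j]
  · rw [Polynomial.coeff_C_mul_X_pow, if_pos rfl, pow_succ]
    ring
  · intro i _ hij
    rw [Polynomial.coeff_C_mul_X_pow, if_neg]
    intro h
    apply hij
    ext
    omega
  · simp

/-- The companion matrix with given `sigma`. -/
def companionOfSigma (s : Fin n → ℂ) : Matrix (Fin n) (Fin n) ℂ :=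
  firstColumnCompanion fun j => (-1) ^ (j : ℕ) * s j

theorem sigma_companionOfSigma (s : Fin n → ℂ) : sigma (companionOfSigma s) = s := by
  ext j
  rw [companionOfSigma, sigma_firstColumnCompanion, ← mul_assoc, ← mul_pow]
  simp

theorem mem_symPolydisk_iff {s : Fin n → ℂ} :
    s ∈ symPolydisk n ↔ companionOfSigma s ∈ spectralBall n := by
  constructor
  · rintro ⟨A, hA, rfl⟩
    exact mem_spectralBall_of_charpoly_eq
      (charpoly_eq_iff_sigma_eq.2 (sigma_companionOfSigma _).symm) hA
  · exact fun h => ⟨_, h, sigma_companionOfSigma s⟩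

theorem differentiable_companionOfSigma :
    Differentiable ℂ (companionOfSigma : (Fin n → ℂ) → Matrix (Fin n) (Fin n) ℂ) := by
  rw [← differentiableOn_univ, differentiableOn_matrix_iff]
  intro i j
  simp only [companionOfSigma, firstColumnCompanion, Matrix.of_apply]
  split_ifs <;> fun_prop

theorem DifferentiableOn.companionOfSigma {E : Type*} [NormedAddCommGroup E] [NormedSpace ℂ E]
    {s : Set E} {f : E → Fin n → ℂ} (hf : DifferentiableOn ℂ f s) :
    DifferentiableOn ℂ (fun x => companionOfSigma (f x)) s :=
  differentiable_companionOfSigma.comp_differentiableOn hf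

/-- The matrix with columns `A ^ (n - 1) v, …, A v, v`. -/
def krylovMatrix (A : Matrix (Fin n) (Fin n) ℂ) (v : Fin n → ℂ) : Matrix (Fin n) (Fin n) ℂ :=
  Matrix.of fun i j => (A ^ (n - ((j : ℕ) + 1))).mulVec v i

theorem krylovMatrix_mulVec_single (A : Matrix (Fin n) (Fin n) ℂ) (v : Fin n → ℂ) (j : Fin n) :
    (krylovMatrix A v).mulVec (Pi.single j 1) = (A ^ (n - ((j : ℕ) + 1))).mulVec v := by
  ext i
  simp [krylovMatrix]

theorem krylovMatrix_mulVec (A : Matrix (Fin n) (Fin n) ℂ) (v x : Fin n → ℂ) :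
    (krylovMatrix A v).mulVec x = ∑ j, x j • (A ^ (n - ((j : ℕ) + 1))).mulVec v := by
  ext i
  simp [krylovMatrix, Matrix.mulVec, dotProduct, mul_comm]

theorem pow_mulVec_eq_sum_sigma (A : Matrix (Fin n) (Fin n) ℂ) (v : Fin n → ℂ) :
    (A ^ n).mulVec v =
      ∑ j : Fin n, ((-1) ^ (j : ℕ) * sigma A j) • (A ^ (n - ((j : ℕ) + 1))).mulVec v := by
  have h := congrArg (fun M => M.mulVec v) A.aeval_self_charpoly
  rw [charpoly_eq_sub_sum] at h
  simp only [map_sub, map_pow, Polynomial.aeval_X, map_sum, map_mul, Polynomial.aeval_C,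
    Matrix.sub_mulVec, Matrix.sum_mulVec, Matrix.zero_mulVec, sub_eq_zero] at h
  rw [h]
  refine Finset.sum_congr rfl fun j _ => ?_
  rw [← map_pow, ← map_mul, Algebra.algebraMap_eq_smul_one, smul_mul_assoc, one_mul,
    Matrix.smul_mulVec]

/-- In the Krylov vectors A acts as a shift, except on A ^ (n - 1) v, where Cayley–Hamilton supplies
the first column of the companion matrix. -/
theorem mul_krylovMatrix (A : Matrix (Fin n) (Fin n) ℂ) (v : Fin n → ℂ) :
    A * krylovMatrix A v = krylovMatrix A v * companionOfSigma (sigma A) := by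
  rw [← Matrix.toLin'.injective.eq_iff]
  apply LinearMap.pi_ext'
  intro j
  ext1
  simp only [LinearMap.comp_apply, LinearMap.coe_single, Matrix.toLin'_apply,
    ← Matrix.mulVec_mulVec, krylovMatrix_mulVec_single]
  rw [Matrix.mulVec_mulVec, ← pow_succ']
  obtain ⟨j, hj⟩ := j
  rcases j with _ | j
  · rw [show n - ((⟨0, hj⟩ : Fin n).1 + 1) + 1 = n by simp; omega, pow_mulVec_eq_sum_sigma,
      krylovMatrix_mulVec]
    refine Finset.sum_congr rfl fun i _ => ?_
    congr 1
    simp [companionOfSigma, firstColumnCompanion]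
  · rw [companionOfSigma, firstColumnCompanion_mulVec_single, krylovMatrix_mulVec_single]
    congr 2
    simp only
    omega

theorem isConj_companionOfSigma {v : Fin n → ℂ} (h : (krylovMatrix A v).det ≠ 0) :
    IsConj (companionOfSigma (sigma A)) A :=
  isConj_of_det_ne_zero h (mul_krylovMatrix A v).symm

theorem IsCyclicMatrix.isConj_companionOfSigma (h : IsCyclicMatrix A) :
    IsConj (companionOfSigma (sigma A)) A := by
  obtain ⟨v, hv⟩ := h
  refine _root_.isConj_companionOfSigma (v := v) ?_
  rcases Nat.eq_zero_or_pos n with rfl | hn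
  · simp
  have hsurj : Function.Surjective (krylovMatrix A v).mulVec := by
    have hrange : LinearMap.range (krylovMatrix A v).mulVecLin = ⊤ := by
      rw [eq_top_iff, ← hv, Submodule.span_le]
      rintro _ ⟨k, rfl⟩
      induction k with
      | zero =>
        refine ⟨Pi.single ⟨n - 1, by omega⟩ 1, ?_⟩
        rw [Matrix.mulVecLin_apply, krylovMatrix_mulVec_single]
        congr 2
        simp only
        omega
      | succ k ih =>
        obtain ⟨x, hx⟩ := ih
        refine ⟨(companionOfSigma (sigma A)).mulVec x, ?_⟩
        rw [Matrix.mulVecLin_apply] at hx ⊢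
        rw [Matrix.mulVec_mulVec, ← mul_krylovMatrix, ← Matrix.mulVec_mulVec, hx,
          Matrix.mulVec_mulVec, ← pow_succ']
    intro y
    obtain ⟨x, hx⟩ := LinearMap.range_eq_top.1 hrange y
    exact ⟨x, hx⟩
  exact ((Matrix.isUnit_iff_isUnit_det _).1 (Matrix.mulVec_surjective_iff_isUnit.1 hsurj)).ne_zero

theorem isCyclicMatrix_of_det_krylovMatrix_ne_zero {v : Fin n → ℂ}
    (h : (krylovMatrix A v).det ≠ 0) : IsCyclicMatrix A := by
  refine ⟨v, ?_⟩
  rw [eq_top_iff]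
  intro y _
  obtain ⟨x, rfl⟩ := Matrix.mulVec_surjective_iff_isUnit.2
    ((Matrix.isUnit_iff_isUnit_det _).2 (isUnit_iff_ne_zero.2 h)) y
  rw [krylovMatrix_mulVec]
  exact Submodule.sum_mem _ fun j _ =>
    Submodule.smul_mem _ _ (Submodule.subset_span ⟨_, rfl⟩)

/-- Any v with A ^ (n - 1) v ≠ 0 is cyclic. In a linear relation between the Krylov vectors let j be
the largest index with a nonzero coefficient, that is, the lowest power of A; applying A ^ j leaves
only the term A ^ (n - 1) v. -/
theorem isConj_companionOfSigma_of_pow_ne_zero (h1 : A ^ (n - 1) ≠ 0) (h2 : A ^ n = 0) :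
    IsConj (companionOfSigma (sigma A)) A := by
  have hn : 0 < n := by
    rcases Nat.eq_zero_or_pos n with rfl | h
    · exact absurd (Subsingleton.elim _ _) h1
    · exact h
  obtain ⟨v, hv⟩ : ∃ v, (A ^ (n - 1)).mulVec v ≠ 0 := by
    by_contra! h
    apply h1
    ext i j
    have := congrFun (h (Pi.single j 1)) i
    simpa [Matrix.mulVec_single_one] using this
  refine isConj_companionOfSigma (v := v) ?_
  intro hdet
  obtain ⟨x, hx, hQx⟩ := Matrix.exists_mulVec_eq_zero_iff.2 hdet
  obtain ⟨i0, hi0⟩ := Function.ne_iff.1 hx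
  obtain ⟨j, hj, hmax⟩ := Finset.exists_max_image (Finset.univ.filter fun i => x i ≠ 0) id
    ⟨i0, by simpa using hi0⟩
  simp only [Finset.mem_filter, Finset.mem_univ, true_and, id] at hj hmax
  rw [krylovMatrix_mulVec] at hQx
  have h3 := congrArg (fun y => (A ^ (j : ℕ)).mulVec y) hQx
  simp only [Matrix.mulVec_zero, Matrix.mulVec_sum, Matrix.mulVec_smul, Matrix.mulVec_mulVec,
    ← pow_add] at h3
  rw [Finset.sum_eq_single j] at h3
  · rw [show (j : ℕ) + (n - (j + 1)) = n - 1 by omega] at h3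
    exact (smul_ne_zero hj hv) h3
  · intro i _ hij
    by_cases hxi : x i = 0
    · simp [hxi]
    · have hlt : (i : ℕ) < j := by
        have h4 := hmax i hxi
        rw [Fin.le_def] at h4
        exact lt_of_le_of_ne h4 fun h => hij (Fin.ext h)
      rw [show (j : ℕ) + (n - (i + 1)) = n + (j - (i + 1)) by omega, pow_add, h2, zero_mul,
        Matrix.zero_mulVec, smul_zero]
  · simp

theorem lempert_symPolydisk_ge_companion (s t : Fin n → ℂ) :
    lempert (spectralBall n) (companionOfSigma s) (companionOfSigma t) ≤
      lempert (symPolydisk n) s t :=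
  lempert_comp_le differentiable_companionOfSigma.differentiableOn
    fun _ hs => mem_symPolydisk_iff.1 hs

/-- Both matrices are conjugate to companion matrices, so discs in the symmetrized polydisk lift
through `companionOfSigma`. -/
theorem lempert_le_symPolydisk_of_isCyclicMatrix (hA : IsCyclicMatrix A) (hB : IsCyclicMatrix B) :
    lempert (spectralBall n) A B ≤ lempert (symPolydisk n) (sigma A) (sigma B) := by
  rw [← lempert_eq_of_isConj_left hA.isConj_companionOfSigma,
    ← lempert_eq_of_isConj_right hB.isConj_companionOfSigma]
  exact lempert_symPolydisk_ge_companion _ _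

end Companion

/-! ### Normal families along an ultrafilter. -/

section NormalFamilies

/-- Montel's theorem along an ultrafilter. -/
theorem exists_tendstoLocallyUniformlyOn_ultrafilter {ι E : Type*} [NormedAddCommGroup E]
    [NormedSpace ℂ E] [FiniteDimensional ℂ E] (U : Ultrafilter ι) {f : ι → ℂ → E} {C : ℝ}
    (hf : ∀ p, DifferentiableOn ℂ (f p) (ball 0 1)) (hC : ∀ p, ∀ x ∈ ball (0 : ℂ) 1, ‖f p x‖ ≤ C) :
    ∃ g : ℂ → E, DifferentiableOn ℂ g (ball 0 1) ∧
      TendstoLocallyUniformlyOn f g U (ball 0 1) := by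
  have : ProperSpace E := FiniteDimensional.proper ℂ E
  have hlim : ∀ x : ℂ, ∃ y : E, x ∈ ball (0 : ℂ) 1 → Filter.Tendsto (fun p => f p x) U (𝓝 y) := by
    intro x
    by_cases hx : x ∈ ball (0 : ℂ) 1
    · have hK : IsCompact (closedBall (0 : E) C) := isCompact_closedBall _ _
      obtain ⟨y, -, hy⟩ := hK.ultrafilter_le_nhds (U.map fun p => f p x) (by
        rw [Filter.le_principal_iff]
        exact Filter.mem_map.2 (Filter.univ_mem' fun p => by simpa using hC p x hx))
      exact ⟨y, fun _ => hy⟩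
    · exact ⟨0, fun h => absurd h hx⟩
  choose g hg using hlim
  -- Boundedness makes the family uniformly Lipschitz near each point, which upgrades pointwise to
  -- locally uniform convergence.
  have hloc : TendstoLocallyUniformlyOn f g U (ball 0 1) := by
    rw [Metric.tendstoLocallyUniformlyOn_iff]
    intro ε hε x hx
    have hx1 : 0 < 1 - ‖x‖ := by rw [mem_ball_zero_iff] at hx; linarith
    have hsub : ball x (1 - ‖x‖) ⊆ ball 0 1 := by
      apply ball_subset_ball'
      simp
    have hC0 : 0 ≤ C := (norm_nonneg _).trans (hC (Classical.choice U.nonempty_of_neBot) x hx)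
    set L := (2 * C + 1) / (1 - ‖x‖) with hL
    have hL0 : 0 < L := by positivity
    have hlip : ∀ p, ∀ y ∈ ball x (1 - ‖x‖), dist (f p y) (f p x) ≤ L * dist y x := by
      intro p y hy
      refine Complex.dist_le_div_mul_dist_of_mapsTo_ball ((hf p).mono hsub) ?_ hy
      intro z hz
      rw [mem_closedBall, dist_eq_norm]
      have h1 := hC p z (hsub hz)
      have h2 := hC p x hx
      linarith [norm_sub_le (f p z) (f p x)]
    set δ := min (1 - ‖x‖) (ε / (4 * L)) with hδ
    have hδ0 : 0 < δ := lt_min hx1 (by positivity)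
    refine ⟨ball x δ, mem_nhdsWithin_of_mem_nhds (ball_mem_nhds x hδ0), ?_⟩
    have hsmall : ∀ p, ∀ y ∈ ball x δ, dist (f p y) (f p x) ≤ ε / 4 := by
      intro p y hy
      have hy1 : y ∈ ball x (1 - ‖x‖) := ball_subset_ball (min_le_left _ _) hy
      have hy2 : dist y x ≤ ε / (4 * L) := (mem_ball.1 hy).le.trans (min_le_right _ _)
      calc dist (f p y) (f p x) ≤ L * dist y x := hlip p y hy1
        _ ≤ L * (ε / (4 * L)) := by gcongr
        _ = ε / 4 := by field_simp
    have hsmallg : ∀ y ∈ ball x δ, dist (g y) (g x) ≤ ε / 4 := by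
      intro y hy
      have hy1 : y ∈ ball (0 : ℂ) 1 := hsub (ball_subset_ball (min_le_left _ _) hy)
      exact le_of_tendsto ((hg y hy1).dist (hg x hx)) (Filter.Eventually.of_forall fun p =>
        hsmall p y hy)
    have hev : ∀ᶠ p in (U : Filter ι), dist (f p x) (g x) < ε / 4 :=
      (hg x hx).eventually (ball_mem_nhds _ (by positivity))
    filter_upwards [hev] with p hp y hy
    have h1 := hsmall p y hy
    have h2 := hsmallg y hy
    calc dist (g y) (f p y) ≤ dist (g y) (g x) + dist (g x) (f p x) + dist (f p x) (f p y) :=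
          dist_triangle4 _ _ _ _
      _ < ε := by
        rw [dist_comm (g x), dist_comm (f p x) (f p y)]
        linarith
  exact ⟨g, hloc.differentiableOn (Filter.Eventually.of_forall hf) isOpen_ball, hloc⟩

end NormalFamilies

/-! ### Joint continuity at nilpotent matrices. -/

section Nilpotent

open scoped Matrix.Norms.Elementwise
open Polynomial (X C)

variable {n : ℕ} {A B : Matrix (Fin n) (Fin n) ℂ}

theorem norm_sigma_le (hA : A ∈ spectralBall n) : ‖sigma A‖ ≤ 2 ^ n := by
  rw [pi_norm_le_iff_of_nonneg (by positivity)]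
  intro j
  rw [sigma, norm_mul, norm_pow, norm_neg, norm_one, one_pow, one_mul]
  refine (norm_coeff_charpoly_le (fun t ht => (mem_spectralBall_iff.1 hA t ht).le) _).trans ?_
  rw [one_pow, one_mul]
  exact_mod_cast Nat.choose_le_two_pow _ _

theorem pow_eq_zero_of_charpoly_eq (h : A.charpoly = X ^ n) : A ^ n = 0 := by
  have := A.aeval_self_charpoly
  rwa [h, map_pow, Polynomial.aeval_X] at this

theorem isRoot_X_pow {t : ℂ} (h : (X ^ n : Polynomial ℂ).IsRoot t) : t = 0 := by
  rw [Polynomial.IsRoot, Polynomial.eval_pow, Polynomial.eval_X] at h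
  by_contra hne
  exact pow_ne_zero _ hne h

theorem mem_spectralBall_of_charpoly_eq_X_pow (h : A.charpoly = X ^ n) : A ∈ spectralBall n := by
  rw [mem_spectralBall_iff, h]
  intro t ht
  rw [isRoot_X_pow ht]
  simp

theorem charpoly_zero_eq : (0 : Matrix (Fin n) (Fin n) ℂ).charpoly = X ^ n := by
  simp

theorem zero_mem_closure_orbit (h : A.charpoly = X ^ n) : 0 ∈ closure {Y | IsConj A Y} := by
  obtain ⟨d, hd, hcl⟩ := exists_diagonal_mem_closure A
  have : d = 0 := by
    ext i
    apply isRoot_X_pow (n := n)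
    rw [← h, hd, isRoot_prod_X_sub_C]
    exact ⟨i, rfl⟩
  rwa [this, show Matrix.diagonal (0 : Fin n → ℂ) = 0 from Matrix.diagonal_zero] at hcl

theorem lempert_lt_one_of_charpoly_eq_X_pow (h : A.charpoly = X ^ n) (hB : B ∈ spectralBall n) :
    lempert (spectralBall n) A B < 1 := by
  rw [lempert_spectralBall_comm]
  refine (lempert_le_of_mem_closure (zero_mem_closure_orbit h)).trans_lt ?_
  rw [lempert_spectralBall_comm, lempert_zero_left hB]
  exact hB

/-- At a nilpotent matrix `A`, the Lempert function of the spectral ball is continuous wherever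
it agrees with that of the symmetrized polydisk. -/
theorem continuousWithinAt_lempert_of_eq (hA : A.charpoly = X ^ n) (hB : B ∈ spectralBall n)
    (h : lempert (spectralBall n) A B = lempert (symPolydisk n) (sigma A) (sigma B)) :
    ContinuousWithinAt (fun p : Matrix (Fin n) (Fin n) ℂ × Matrix (Fin n) (Fin n) ℂ =>
      lempert (spectralBall n) p.1 p.2) (spectralBall n ×ˢ spectralBall n) (A, B) := by
  refine continuousOn_of_usc_lsc
    (fun c hc => (eventually_lempert_lt isOpen_spectralBall hc).filter_mono nhdsWithin_le_nhds)
    fun c hc => ?_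
  -- Otherwise an ultrafilter converging to (A, B) carries discs with parameters bounded by some c'
  -- below the value at (A, B). The discs themselves may be unbounded, so the limit is taken of
  -- their images under `sigma`.
  by_contra hnot
  rw [Filter.not_eventually] at hnot
  obtain ⟨c', hcc', hc'⟩ := exists_between hc
  have hc'1 : c' < 1 := hc'.trans (lempert_lt_one_of_charpoly_eq_X_pow hA hB)
  lift c' to NNReal using hc'1.ne_top
  have hfreq := hnot.mono (q := fun p => lempert (spectralBall n) p.1 p.2 < c')
    fun p hp => (not_lt.1 hp).trans_lt hcc'
  rw [Filter.frequently_iff_neBot] at hfreq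
  let U := @Ultrafilter.of _ _ hfreq
  have hU := @Ultrafilter.of_le _ _ hfreq
  have hUn : (U : Filter (Matrix (Fin n) (Fin n) ℂ × Matrix (Fin n) (Fin n) ℂ)) ≤ 𝓝 (A, B) :=
    hU.trans (inf_le_left.trans nhdsWithin_le_nhds)
  have hUlt : ∀ᶠ p in (U : Filter (Matrix (Fin n) (Fin n) ℂ × Matrix (Fin n) (Fin n) ℂ)),
      lempert (spectralBall n) p.1 p.2 < c' :=
    (hU.trans inf_le_right) (Filter.mem_principal_self _)
  have hdisc : ∀ p : Matrix (Fin n) (Fin n) ℂ × Matrix (Fin n) (Fin n) ℂ,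
      ∃ (α : ℂ) (φ : ℂ → Matrix (Fin n) (Fin n) ℂ), ‖α‖ ≤ c' ∧
        DifferentiableOn ℂ φ (ball 0 1) ∧ Set.MapsTo φ (ball 0 1) (spectralBall n) ∧
        (lempert (spectralBall n) p.1 p.2 < c' → φ 0 = p.1 ∧ φ α = p.2) := by
    intro p
    by_cases hp : lempert (spectralBall n) p.1 p.2 < c'
    · obtain ⟨α, -, hαc, φ, hφ, hm, h0, h1⟩ := lempert_lt_iff.1 hp
      refine ⟨α, φ, ?_, hφ, hm, fun _ => ⟨h0, h1⟩⟩
      rw [enorm_eq_nnnorm, ENNReal.coe_lt_coe] at hαc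
      exact hαc.le
    · exact ⟨0, fun _ => 0, by simp, differentiableOn_const _,
        fun _ _ => zero_mem_spectralBall, fun h => absurd h hp⟩
  choose α φ hα hφ hm hend using hdisc
  obtain ⟨a, ha, hUa⟩ := (isCompact_closedBall (0 : ℂ) c').ultrafilter_le_nhds (U.map α) (by
    rw [Filter.le_principal_iff]
    exact Filter.mem_map.2 (Filter.univ_mem' fun p => by simpa using hα p))
  have hUa : Filter.Tendsto α U (𝓝 a) := hUa
  rw [mem_closedBall_zero_iff] at ha
  have hc'1' : (c' : ℝ) < 1 := by exact_mod_cast hc'1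
  have ha1 : a ∈ ball (0 : ℂ) 1 := by
    rw [mem_ball_zero_iff]
    exact ha.trans_lt hc'1'
  have hball0 : (0 : ℂ) ∈ ball (0 : ℂ) 1 := by simp
  obtain ⟨g, hg, hlim⟩ := exists_tendstoLocallyUniformlyOn_ultrafilter U
    (f := fun p x => sigma (φ p x)) (C := 2 ^ n) (fun p => (hφ p).sigma)
    fun p x hx => norm_sigma_le (hm p hx)
  have hpt : ∀ x ∈ ball (0 : ℂ) 1, Filter.Tendsto (fun p => sigma (φ p x)) U (𝓝 (g x)) :=
    fun x hx => hlim.tendsto_at hx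
  have hg0 : g 0 = sigma A := by
    refine tendsto_nhds_unique (hpt 0 hball0) ?_
    have h1 : Filter.Tendsto (fun p : Matrix (Fin n) (Fin n) ℂ × Matrix (Fin n) (Fin n) ℂ =>
        sigma p.1) U (𝓝 (sigma A)) :=
      ((continuous_matrix_sigma.comp continuous_fst).tendsto (A, B)).mono_left hUn
    refine h1.congr' ?_
    filter_upwards [hUlt] with p hp
    rw [(hend p hp).1]
  have hga : g a = sigma B := by
    have h2 : Filter.Tendsto (fun p => sigma (φ p (α p))) U (𝓝 (g a)) :=
      hlim.tendsto_comp (hg.continuousOn a ha1) ha1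
        (tendsto_nhdsWithin_iff.2 ⟨hUa, hUa.eventually (isOpen_ball.mem_nhds ha1)⟩)
    refine tendsto_nhds_unique h2 ?_
    have h1 : Filter.Tendsto (fun p : Matrix (Fin n) (Fin n) ℂ × Matrix (Fin n) (Fin n) ℂ =>
        sigma p.2) U (𝓝 (sigma B)) :=
      ((continuous_matrix_sigma.comp continuous_snd).tendsto (A, B)).mono_left hUn
    refine h1.congr' ?_
    filter_upwards [hUlt] with p hp
    rw [(hend p hp).2]
  have hroot : ∀ x ∈ ball (0 : ℂ) 1, ∀ t, (companionOfSigma (g x)).charpoly.IsRoot t →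
      ‖t‖ ≤ 1 := by
    intro x hx t ht
    by_contra! hlt
    have h1 : (1 : ℝ≥0∞) < spectralRadius ℂ (companionOfSigma (g x)) := by
      refine lt_of_lt_of_le ?_ (enorm_le_spectralRadius ht)
      rw [enorm_eq_nnnorm]
      exact_mod_cast hlt
    have h2 : Filter.Tendsto (fun p => companionOfSigma (sigma (φ p x))) U
        (𝓝 (companionOfSigma (g x))) :=
      (differentiable_companionOfSigma.continuous.tendsto _).comp (hpt x hx)
    obtain ⟨p, hp⟩ := (h2.eventually (eventually_lt_spectralRadius h1)).exists
    have h3 : companionOfSigma (sigma (φ p x)) ∈ spectralBall n :=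
      mem_symPolydisk_iff.1 ⟨_, hm p hx, rfl⟩
    exact absurd h3 (not_lt.2 hp.le)
  -- So far the limit is only known to have eigenvalues of modulus at most 1. The n-th power of its
  -- companion matrix vanishes at 0, because A is nilpotent, so the Schwarz lemma gives ‖t‖ ^ n ≤
  -- ‖x‖ < 1.
  have hmaps : Set.MapsTo g (ball 0 1) (symPolydisk n) := by
    intro x hx
    rw [mem_symPolydisk_iff, mem_spectralBall_iff]
    intro t ht
    rcases Nat.eq_zero_or_pos n with rfl | hn
    · obtain ⟨i, -⟩ := exists_norm_le_row_sum ht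
      exact i.elim0
    have h0 : companionOfSigma (g 0) ^ n = 0 := by
      apply pow_eq_zero_of_charpoly_eq
      rw [hg0, ← hA, charpoly_eq_iff_sigma_eq, sigma_companionOfSigma]
    have h1 := norm_root_le_mul_norm (hg.companionOfSigma.matrix_pow n) zero_le_one h0
      (fun y hy s hs => by
        obtain ⟨u, hu, rfl⟩ := (isRoot_charpoly_pow hn).1 hs
        rw [norm_pow]
        exact pow_le_one₀ (norm_nonneg _) (hroot y hy u hu))
      x hx (t ^ n) ((isRoot_charpoly_pow hn).2 ⟨t, ht, rfl⟩)
    rw [one_mul, norm_pow] at h1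
    rw [mem_ball_zero_iff] at hx
    by_contra! hge
    linarith [one_le_pow₀ hge (n := n)]
  have hle := lempert_le ha1 hg hmaps hg0 hga
  rw [← h] at hle
  refine absurd (hle.trans ?_) (not_le.2 hc')
  rw [enorm_eq_nnnorm, ENNReal.coe_le_coe]
  exact ha

end Nilpotent

/-! ### The exceptional 2 × 2 matrices. -/

section TwoByTwo

open scoped Matrix.Norms.Elementwise
open Polynomial (X C)

/-- In dimension two v is cyclic once v and A v are independent. If this fails for both basis
vectors and for their sum, then A is scalar. -/
theorem isCyclicMatrix_two_iff {A : Matrix (Fin 2) (Fin 2) ℂ} :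
    IsCyclicMatrix A ↔ ¬ IsScalarMatrix A := by
  constructor
  · rintro ⟨v, hv⟩ ⟨c, rfl⟩
    have hle : Submodule.span ℂ (Set.range fun k : ℕ =>
        Matrix.mulVec ((c • (1 : Matrix (Fin 2) (Fin 2) ℂ)) ^ k) v) ≤ Submodule.span ℂ {v} := by
      rw [Submodule.span_le]
      rintro _ ⟨k, rfl⟩
      simp only [smul_pow, one_pow, Matrix.smul_mulVec, Matrix.one_mulVec]
      exact Submodule.smul_mem _ _ (Submodule.mem_span_singleton_self v)
    rw [hv, top_le_iff] at hle
    have h1 := finrank_span_le_card (R := ℂ) ({v} : Set (Fin 2 → ℂ))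
    rw [hle, finrank_top] at h1
    simp at h1
  · intro h
    have key : ∀ v : Fin 2 → ℂ, A.mulVec v 0 * v 1 - A.mulVec v 1 * v 0 ≠ 0 →
        IsCyclicMatrix A := by
      intro v hv
      refine isCyclicMatrix_of_det_krylovMatrix_ne_zero (v := v) ?_
      rw [Matrix.det_fin_two]
      simp only [krylovMatrix, Matrix.of_apply]
      simpa [mul_comm] using hv
    by_cases h01 : A 0 1 = 0
    · by_cases h10 : A 1 0 = 0
      · refine key ![1, 1] fun h0 => h ⟨A 0 0, ?_⟩
        have : A 0 0 = A 1 1 := by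
          simpa [Matrix.mulVec, dotProduct, h01, h10, sub_eq_zero] using h0
        ext i j
        fin_cases i <;> fin_cases j <;> simp [h01, h10, this]
      · refine key ![1, 0] ?_
        simpa [Matrix.mulVec, dotProduct] using h10
    · refine key ![0, 1] ?_
      simpa [Matrix.mulVec, dotProduct] using h01

theorem sigma_zero_eq_trace {n : ℕ} (A : Matrix (Fin (n + 1)) (Fin (n + 1)) ℂ) :
    sigma A 0 = A.trace := by
  rw [Matrix.trace_eq_neg_charpoly_coeff, sigma]
  simp

theorem charpoly_smul_one {n : ℕ} (μ : ℂ) :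
    (μ • (1 : Matrix (Fin n) (Fin n) ℂ)).charpoly = (X - C μ) ^ n := by
  rw [Matrix.smul_one_eq_diagonal, charpoly_diagonal']
  simp

/-- Half the trace times the identity maps the symmetrized bidisk into the spectral ball and inverts
`sigma` on scalar matrices. -/
theorem lempert_smul_one_le_symPolydisk {μ β : ℂ} :
    lempert (spectralBall 2) (μ • 1) (β • 1) ≤
      lempert (symPolydisk 2) (sigma (μ • (1 : Matrix (Fin 2) (Fin 2) ℂ)))
        (sigma (β • (1 : Matrix (Fin 2) (Fin 2) ℂ))) := by
  have h := lempert_comp_le (D := symPolydisk 2) (D' := spectralBall 2)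
    (f := fun s : Fin 2 → ℂ => (s 0 / 2) • (1 : Matrix (Fin 2) (Fin 2) ℂ))
    (z := sigma (μ • (1 : Matrix (Fin 2) (Fin 2) ℂ)))
    (w := sigma (β • (1 : Matrix (Fin 2) (Fin 2) ℂ))) (by fun_prop) ?_
  · have hc : ∀ c : ℂ, sigma (c • (1 : Matrix (Fin 2) (Fin 2) ℂ)) 0 / 2 = c := by
      intro c
      simp [sigma_zero_eq_trace]
    rw [hc, hc] at h
    exact h
  · rintro _ ⟨M, hM, rfl⟩
    apply smul_one_mem_spectralBall
    obtain ⟨d, hd, -⟩ := exists_diagonal_mem_closure M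
    have hlt : ∀ i, ‖d i‖ < 1 := fun i =>
      mem_spectralBall_iff.1 hM _ (by rw [hd, isRoot_prod_X_sub_C]; exact ⟨i, rfl⟩)
    have hs : sigma M = sigma (Matrix.diagonal d) :=
      charpoly_eq_iff_sigma_eq.1 (by rw [hd, charpoly_diagonal'])
    rw [hs, sigma_zero_eq_trace, Matrix.trace_diagonal, Fin.sum_univ_two, norm_div,
      Complex.norm_ofNat, div_lt_one two_pos]
    linarith [norm_add_le (d 0) (d 1), hlt 0, hlt 1]

theorem spectralRadius_eq_of_charpoly_eq {n : ℕ} {A B : Matrix (Fin n) (Fin n) ℂ}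
    (h : A.charpoly = B.charpoly) : spectralRadius ℂ A = spectralRadius ℂ B := by
  refine le_antisymm ?_ ?_ <;> rw [spectralRadius_le_iff] <;> intro t ht <;>
    apply enorm_le_spectralRadius
  · rwa [← h]
  · rwa [h]

/-- For nonscalar B both matrices are cyclic. For B = β • 1 the value is the spectral radius of a
Möbius image of A, which cannot tell A from μ • 1, so the comparison reduces to two scalar matrices.
-/
theorem lempert_eq_symPolydisk_two {A B : Matrix (Fin 2) (Fin 2) ℂ} {μ : ℂ}
    (hA : A ∈ spectralBall 2) (hns : ¬ IsScalarMatrix A) (hμ : A.charpoly = (X - C μ) ^ 2)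
    (hB : B ∈ spectralBall 2) :
    lempert (spectralBall 2) A B = lempert (symPolydisk 2) (sigma A) (sigma B) := by
  refine le_antisymm ?_ (lempert_symPolydisk_le A B)
  by_cases hBs : IsScalarMatrix B
  · obtain ⟨β, rfl⟩ := hBs
    have hβ := norm_lt_one_of_smul_one_mem (by norm_num) hB
    have hcp : A.charpoly = (μ • (1 : Matrix (Fin 2) (Fin 2) ℂ)).charpoly := by
      rw [hμ, charpoly_smul_one]
    have hμm := mem_spectralBall_of_charpoly_eq hcp hA
    rw [charpoly_eq_iff_sigma_eq.1 hcp]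
    refine le_trans (le_of_eq ?_) lempert_smul_one_le_symPolydisk
    rw [lempert_spectralBall_comm, lempert_smul_one_left hβ hA, lempert_spectralBall_comm,
      lempert_smul_one_left hβ hμm]
    exact spectralRadius_eq_of_charpoly_eq (charpoly_matrixMoebius_eq hβ hA hcp)
  · exact lempert_le_symPolydisk_of_isCyclicMatrix (isCyclicMatrix_two_iff.2 hns)
      (isCyclicMatrix_two_iff.2 hBs)

/-- Joint continuity is invariant under Möbius maps. -/
theorem continuousWithinAt_lempert_of_matrixMoebius {n : ℕ} {A B : Matrix (Fin n) (Fin n) ℂ}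
    {μ : ℂ} (hμ : ‖μ‖ < 1) (hA : A ∈ spectralBall n) (hB : B ∈ spectralBall n)
    (h : ContinuousWithinAt (fun p : Matrix (Fin n) (Fin n) ℂ × Matrix (Fin n) (Fin n) ℂ =>
      lempert (spectralBall n) p.1 p.2) (spectralBall n ×ˢ spectralBall n)
      (matrixMoebius μ A, matrixMoebius μ B)) :
    ContinuousWithinAt (fun p : Matrix (Fin n) (Fin n) ℂ × Matrix (Fin n) (Fin n) ℂ =>
      lempert (spectralBall n) p.1 p.2) (spectralBall n ×ˢ spectralBall n) (A, B) := by
  have hcont := (differentiableOn_matrixMoebius (n := n) hμ).continuousOn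
  have h1 : ContinuousWithinAt (fun p : Matrix (Fin n) (Fin n) ℂ × Matrix (Fin n) (Fin n) ℂ =>
      (matrixMoebius μ p.1, matrixMoebius μ p.2)) (spectralBall n ×ˢ spectralBall n) (A, B) :=
    (hcont.prodMap hcont) (A, B) ⟨hA, hB⟩
  have h2 := h.comp (f := fun p : Matrix (Fin n) (Fin n) ℂ × Matrix (Fin n) (Fin n) ℂ =>
      (matrixMoebius μ p.1, matrixMoebius μ p.2)) (x := (A, B)) h1
    fun p hp => ⟨matrixMoebius_mem hμ hp.1, matrixMoebius_mem hμ hp.2⟩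
  refine h2.congr (fun p hp => ?_) ?_
  · exact (lempert_matrixMoebius hμ hp.1 hp.2).symm
  · exact (lempert_matrixMoebius hμ hA hB).symm

theorem charpoly_matrixMoebius_of_eq_pow {n : ℕ} {A : Matrix (Fin n) (Fin n) ℂ} {μ : ℂ}
    (hμ : ‖μ‖ < 1) (hA : A ∈ spectralBall n) (h : A.charpoly = (X - C μ) ^ n) :
    (matrixMoebius μ A).charpoly = X ^ n := by
  rw [charpoly_matrixMoebius_eq hμ hA (h.trans (charpoly_smul_one μ).symm), matrixMoebius_self,
    charpoly_zero_eq]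

theorem matrixMoebius_ne_zero_of_not_isScalarMatrix {n : ℕ} {A : Matrix (Fin n) (Fin n) ℂ} {μ : ℂ}
    (hμ : ‖μ‖ < 1) (hA : A ∈ spectralBall n) (hns : ¬ IsScalarMatrix A) : matrixMoebius μ A ≠ 0 := by
  intro h0
  apply hns
  refine ⟨μ, ?_⟩
  rw [← matrixMoebius_neg_matrixMoebius hμ hA, h0, matrixMoebius_neg_zero]

theorem eq_zero_of_isScalarMatrix {n : ℕ} {A : Matrix (Fin n) (Fin n) ℂ}
    (h : A.charpoly = X ^ n) (hs : IsScalarMatrix A) : A = 0 := by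
  obtain ⟨c, rfl⟩ := hs
  rcases Nat.eq_zero_or_pos n with rfl | hn
  · exact Subsingleton.elim _ _
  have : (c • (1 : Matrix (Fin n) (Fin n) ℂ)).charpoly.IsRoot c := by
    rw [charpoly_smul_one]
    simp [hn.ne']
  rw [h] at this
  rw [isRoot_X_pow this, zero_smul]

theorem continuousWithinAt_lempert_two {A B : Matrix (Fin 2) (Fin 2) ℂ} {μ : ℂ}
    (hA : A ∈ spectralBall 2) (hns : ¬ IsScalarMatrix A) (hμ : A.charpoly = (X - C μ) ^ 2)
    (hB : B ∈ spectralBall 2) :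
    ContinuousWithinAt (fun p : Matrix (Fin 2) (Fin 2) ℂ × Matrix (Fin 2) (Fin 2) ℂ =>
      lempert (spectralBall 2) p.1 p.2) (spectralBall 2 ×ˢ spectralBall 2) (A, B) := by
  have hμ1 : ‖μ‖ < 1 := mem_spectralBall_iff.1 hA μ (by rw [hμ]; simp)
  have hcp := charpoly_matrixMoebius_of_eq_pow hμ1 hA hμ
  have hne := matrixMoebius_ne_zero_of_not_isScalarMatrix hμ1 hA hns
  refine continuousWithinAt_lempert_of_matrixMoebius hμ1 hA hB
    (continuousWithinAt_lempert_of_eq hcp (matrixMoebius_mem hμ1 hB) ?_)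
  exact lempert_eq_symPolydisk_two (μ := 0) (matrixMoebius_mem hμ1 hA)
    (fun hs => hne (eq_zero_of_isScalarMatrix hcp hs)) (by rw [hcp]; simp)
    (matrixMoebius_mem hμ1 hB)

end TwoByTwo

/-! ### From continuity to dependence on the characteristic polynomial alone. -/

section Invariance

open scoped Matrix.Norms.Elementwise ComplexConjugate
open Polynomial (X C)

variable {n : ℕ} {A B : Matrix (Fin n) (Fin n) ℂ}

/-- The Lempert function with pole `A` depends only on the characteristic polynomial of the
second argument. -/
def LempertInvariant (A : Matrix (Fin n) (Fin n) ℂ) : Prop :=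
  ∀ B B', B ∈ spectralBall n → B.charpoly = B'.charpoly →
    lempert (spectralBall n) A B = lempert (spectralBall n) A B'

theorem isConj_diagonal_comp_perm (d : Fin n → ℂ) (τ : Equiv.Perm (Fin n)) :
    IsConj (Matrix.diagonal d) (Matrix.diagonal (d ∘ τ)) := by
  refine isConj_of_det_ne_zero (P := (1 : Matrix (Fin n) (Fin n) ℂ).submatrix τ id) ?_ ?_
  · rw [Matrix.det_permute]
    simp
  · ext i j
    rw [Matrix.mul_diagonal, Matrix.diagonal_mul]
    by_cases h : τ i = j
    · simp [h, mul_comm]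
    · simp [h]

theorem isConj_diagonal_of_charpoly_eq {d d' : Fin n → ℂ}
    (h : ∏ i, (X - C (d i)) = ∏ i, (X - C (d' i))) :
    IsConj (Matrix.diagonal d) (Matrix.diagonal d') := by
  have h1 := congrArg Polynomial.roots h
  have hr : ∀ d : Fin n → ℂ, (∏ i, (X - C (d i))).roots = Finset.univ.val.map d := by
    intro d
    have := Polynomial.roots_multiset_prod_X_sub_C (Finset.univ.val.map d)
    rwa [Multiset.map_map] at this
  rw [hr, hr] at h1
  have hcard : ∀ z : ℂ, Fintype.card {i // d i = z} = Fintype.card {i // d' i = z} := by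
    intro z
    have h2 := congrArg (Multiset.count z) h1
    rw [Multiset.count_map, Multiset.count_map] at h2
    simp only [Fintype.card_subtype, Finset.card_def, Finset.filter_val]
    simpa only [eq_comm] using h2
  let τ : Equiv.Perm (Fin n) := Equiv.ofFiberEquiv fun z => Fintype.equivOfCardEq (hcard z)
  have hτ : d' ∘ τ = d := funext fun i => Equiv.ofFiberEquiv_map _ i
  rw [← hτ]
  exact (isConj_diagonal_comp_perm d' τ).symm

/-- The value is constant on the orbit of B, and the orbit accumulates at a diagonal matrix.
Continuity there identifies the value at B with the value at a matrix determined, up to conjugation,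
by the eigenvalues. -/
theorem lempertInvariant_of_continuousOn
    (h : ContinuousOn (fun B => lempert (spectralBall n) A B) (spectralBall n)) :
    LempertInvariant A := by
  have key : ∀ B ∈ spectralBall n, ∀ d : Fin n → ℂ, B.charpoly = ∏ i, (X - C (d i)) →
      lempert (spectralBall n) A B = lempert (spectralBall n) A (Matrix.diagonal d) := by
    intro B hB d hd
    obtain ⟨d', hd', hcl⟩ := exists_diagonal_mem_closure B
    rw [lempert_eq_of_isConj_right (isConj_diagonal_of_charpoly_eq (hd.symm.trans hd'))]
    refine le_antisymm (lempert_le_of_mem_closure hcl) (le_of_forall_lt fun c hc => ?_)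
    have hmem : Matrix.diagonal d' ∈ spectralBall n :=
      mem_spectralBall_of_charpoly_eq (by rw [hd', charpoly_diagonal']) hB
    have hev := (h _ hmem).eventually (lt_mem_nhds hc)
    rw [isOpen_spectralBall.nhdsWithin_eq hmem] at hev
    obtain ⟨Y, hY, hconj⟩ := mem_closure_iff_nhds.1 hcl _ hev
    rw [lempert_eq_of_isConj_right hconj]
    exact hY
  intro B B' hB hBB'
  obtain ⟨d, hd, -⟩ := exists_diagonal_mem_closure B
  rw [key B hB d hd, key B' (mem_spectralBall_of_charpoly_eq hBB' hB) d (hBB'.symm.trans hd)]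

theorem LempertInvariant.matrixMoebius (h : LempertInvariant A) {μ : ℂ} (hμ : ‖μ‖ < 1)
    (hA : A ∈ spectralBall n) : LempertInvariant (matrixMoebius μ A) := by
  have hμ' : ‖-μ‖ < 1 := by simpa using hμ
  intro B B' hB hBB'
  have hB' := mem_spectralBall_of_charpoly_eq hBB' hB
  have e : ∀ Y ∈ spectralBall n, lempert (spectralBall n) (_root_.matrixMoebius μ A) Y =
      lempert (spectralBall n) A (_root_.matrixMoebius (-μ) Y) := by
    intro Y hY
    rw [← lempert_matrixMoebius hμ hA (matrixMoebius_mem hμ' hY),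
      matrixMoebius_matrixMoebius_neg hμ hY]
  rw [e B hB, e B' hB']
  exact h _ _ (matrixMoebius_mem hμ' hB) (charpoly_matrixMoebius_eq hμ' hB hBB')

theorem charpoly_eq_X_pow_of_forall_root (h : ∀ t, A.charpoly.IsRoot t → t = 0) :
    A.charpoly = X ^ n := by
  obtain ⟨d, hd, -⟩ := exists_diagonal_mem_closure A
  have : ∀ i, d i = 0 := fun i => h _ (by rw [hd, isRoot_prod_X_sub_C]; exact ⟨i, rfl⟩)
  rw [hd]
  simp [this]

theorem charpoly_eq_X_pow_of_pow_eq_zero {k : ℕ} (hk : 0 < k) (h : A ^ k = 0) :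
    A.charpoly = X ^ n := by
  refine charpoly_eq_X_pow_of_forall_root fun t ht => ?_
  have h1 : (A ^ k).charpoly.IsRoot (t ^ k) := (isRoot_charpoly_pow hk).2 ⟨t, ht, rfl⟩
  rw [h, charpoly_zero_eq] at h1
  exact eq_zero_of_pow_eq_zero (isRoot_X_pow h1)

end Invariance

/-! ### Invariance excludes distinct eigenvalues. -/

section DistinctEigenvalues

open scoped Matrix.Norms.Elementwise ComplexConjugate
open Polynomial (X C)

variable {n : ℕ}

/-- `diagonal c + diagonal e * P`, where `P` is the matrix of the map `p`. -/
def pairingMatrix (p : Fin n → Fin n) (c e : Fin n → ℂ) : Matrix (Fin n) (Fin n) ℂ :=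
  Matrix.of fun k l => (if l = k then c k else 0) + if l = p k then e k else 0

/-- On a pair {k, p k} the matrix is a 2 × 2 block of trace 0 and determinant 0; at a fixed point of
p the hypotheses force c k = e k = 0. -/
theorem pairingMatrix_sq_eq_zero {p : Fin n → Fin n} {c e : Fin n → ℂ} (hp : ∀ k, p (p k) = k)
    (hc : ∀ k, c (p k) = -c k) (he : ∀ k, e k * e (p k) = -c k ^ 2) :
    pairingMatrix p c e ^ 2 = 0 := by
  ext k m
  rw [pow_two, Matrix.mul_apply, Matrix.zero_apply]
  simp only [pairingMatrix, Matrix.of_apply, add_mul, ite_mul, zero_mul, Finset.sum_add_distrib,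
    Finset.sum_ite_eq', Finset.mem_univ, if_true, hp, hc]
  have h := he k
  split_ifs <;> first | linear_combination h | ring

theorem sum_norm_pairingMatrix_le (p : Fin n → Fin n) (c e : Fin n → ℂ) (k : Fin n) :
    ∑ l, ‖pairingMatrix p c e k l‖ ≤ ‖c k‖ + ‖e k‖ := by
  calc ∑ l, ‖pairingMatrix p c e k l‖
      ≤ ∑ l, ((if l = k then ‖c k‖ else 0) + if l = p k then ‖e k‖ else 0) := by
        refine Finset.sum_le_sum fun l _ => ?_
        refine (norm_add_le _ _).trans (add_le_add ?_ ?_) <;> split_ifs <;> simp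
    _ = ‖c k‖ + ‖e k‖ := by simp [Finset.sum_add_distrib]

/-- Each index of I is matched with its own partner outside I, which needs the cardinality bound.
The off-diagonal entries η and -η⁻¹ keep the rows of I small at the expense of their partners. -/
theorem exists_pairing (I : Finset (Fin n)) (hI : I.card ≤ Iᶜ.card) {η : ℂ} (hη : η ≠ 0) :
    ∃ (p : Fin n → Fin n) (c e : Fin n → ℂ), (∀ k, p (p k) = k) ∧ (∀ k, c (p k) = -c k) ∧
      (∀ k, e k * e (p k) = -c k ^ 2) ∧ (∀ k ∈ I, c k = -1 ∧ e k = η) ∧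
      ∀ k, ‖c k‖ ≤ 1 ∧ (k ∉ I → ‖e k‖ ≤ ‖η‖⁻¹) := by
  classical
  obtain ⟨f⟩ : Nonempty (I ↪ (Iᶜ : Finset (Fin n))) :=
    Function.Embedding.nonempty_of_card_le (by
      rw [Fintype.card_coe, Fintype.card_coe]; exact hI)
  by_cases hne : I.Nonempty
  swap
  · rw [Finset.not_nonempty_iff_eq_empty] at hne
    subst hne
    exact ⟨id, 0, 0, by simp, by simp, by simp, by simp, by simp⟩
  have : Nonempty I := hne.to_subtype
  have hfI : ∀ i : I, (f i : Fin n) ∉ I := fun i => Finset.mem_compl.1 (f i).2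
  let g : I → Fin n := fun i => f i
  have hg : Function.Injective g := Subtype.val_injective.comp f.injective
  have hgI : ∀ i, g i ∉ I := hfI
  let inv : Fin n → I := Function.invFun g
  have hinv : ∀ i, inv (g i) = i := Function.leftInverse_invFun hg
  let p : Fin n → Fin n := fun k =>
    if h : k ∈ I then g ⟨k, h⟩ else if k ∈ Set.range g then inv k else k
  let c : Fin n → ℂ := fun k => if k ∈ I then -1 else if k ∈ Set.range g then 1 else 0
  let e : Fin n → ℂ := fun k => if k ∈ I then η else if k ∈ Set.range g then -η⁻¹ else 0
  have hpI : ∀ i : I, p i = g i := fun i => by simp [p]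
  have hpg : ∀ i : I, p (g i) = i := fun i => by
    simp only [p, dif_neg (hgI i), if_pos (Set.mem_range_self i), hinv]
  have hcI : ∀ i : I, c i = -1 := fun i => by simp [c]
  have hcg : ∀ i : I, c (g i) = 1 := fun i => by
    simp only [c, if_neg (hgI i), if_pos (Set.mem_range_self i)]
  have heI : ∀ i : I, e i = η := fun i => by simp [e]
  have heg : ∀ i : I, e (g i) = -η⁻¹ := fun i => by
    simp only [e, if_neg (hgI i), if_pos (Set.mem_range_self i)]
  have hcases : ∀ k : Fin n, (∃ i : I, k = i) ∨ (∃ i : I, k = g i) ∨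
      (p k = k ∧ c k = 0 ∧ e k = 0) := by
    intro k
    by_cases hk : k ∈ I
    · exact Or.inl ⟨⟨k, hk⟩, rfl⟩
    · by_cases hk' : k ∈ Set.range g
      · obtain ⟨i, hi⟩ := hk'
        exact Or.inr (Or.inl ⟨i, hi.symm⟩)
      · exact Or.inr (Or.inr ⟨by simp only [p, dif_neg hk, if_neg hk'],
          by simp only [c, if_neg hk, if_neg hk'], by simp only [e, if_neg hk, if_neg hk']⟩)
  refine ⟨p, c, e, fun k => ?_, fun k => ?_, fun k => ?_, fun k hk => ?_, fun k => ⟨?_, ?_⟩⟩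
  · rcases hcases k with ⟨i, rfl⟩ | ⟨i, rfl⟩ | ⟨h1, h2, h3⟩
    · rw [hpI, hpg]
    · rw [hpg, hpI]
    · rw [h1, h1]
  · rcases hcases k with ⟨i, rfl⟩ | ⟨i, rfl⟩ | ⟨h1, h2, h3⟩
    · rw [hpI, hcI, hcg, neg_neg]
    · rw [hpg, hcI, hcg]
    · rw [h1, h2, neg_zero]
  · rcases hcases k with ⟨i, rfl⟩ | ⟨i, rfl⟩ | ⟨h1, h2, h3⟩
    · rw [hpI, heI, heg, hcI]; field_simp
    · rw [hpg, heI, heg, hcg]; field_simp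
    · rw [h2, h3]; simp
  · exact ⟨hcI ⟨k, hk⟩, heI ⟨k, hk⟩⟩
  · rcases hcases k with ⟨i, rfl⟩ | ⟨i, rfl⟩ | ⟨h1, h2, h3⟩
    · rw [hcI]; simp
    · rw [hcg]; simp
    · rw [h2]; simp
  · intro hk
    rcases hcases k with ⟨i, rfl⟩ | ⟨i, rfl⟩ | ⟨h1, h2, h3⟩
    · exact absurd i.2 hk
    · rw [heg]; simp
    · rw [h3]; simp

/-- A disc from a nilpotent matrix to `diagonal d` which beats the one through the origin. -/
theorem exists_nilpotent_lempert_lt {d : Fin n → ℂ} {i₀ : Fin n} (hd1 : ‖d i₀‖ < 1)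
    (hd : ∀ i, d i = d i₀ ∨ ‖d i‖ < ‖d i₀‖)
    (hcard : (Finset.univ.filter fun i => d i = d i₀).card ≤
      (Finset.univ.filter fun i => d i = d i₀)ᶜ.card) :
    ∃ N : Matrix (Fin n) (Fin n) ℂ, N.charpoly = X ^ n ∧
      lempert (spectralBall n) N (Matrix.diagonal d) < ‖d i₀‖ₑ := by
  set I := Finset.univ.filter fun i => d i = d i₀ with hI
  set a := d i₀ with ha
  have hmemI : ∀ i, i ∈ I ↔ d i = a := by simp [hI]
  have ha0 : a ≠ 0 := by
    intro h0
    have hall : I = Finset.univ := by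
      ext i
      rw [hmemI]
      rcases hd i with h | h
      · simp [h]
      · rw [h0, norm_zero] at h
        exact absurd h (not_lt.2 (norm_nonneg _))
    rw [hall] at hcard
    simp at hcard
    exact (hcard ▸ i₀).elim0
  have hr0 : 0 < ‖a‖ := norm_pos_iff.2 ha0
  obtain ⟨q, hq0, hq1, hq⟩ : ∃ q : ℝ, 0 ≤ q ∧ q < 1 ∧ ∀ i, i ∉ I → ‖d i‖ ≤ q * ‖a‖ := by
    obtain ⟨j, hj⟩ := @Finite.exists_max _ _ _ ⟨i₀⟩ _ fun i => if i ∈ I then 0 else ‖d i‖ / ‖a‖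
    refine ⟨if j ∈ I then 0 else ‖d j‖ / ‖a‖, ?_, ?_, ?_⟩
    · split_ifs <;> positivity
    · split_ifs with h
      · exact one_pos
      · rw [hmemI] at h
        rw [div_lt_one hr0]
        exact (hd j).resolve_left h
    · intro i hi
      have := hj i
      rw [if_neg hi, div_le_iff₀ hr0] at this
      exact this
  -- On the rows of I the perturbation gains ε (1 - ‖a‖) on the diagonal and costs at most 2εη off
  -- it; this η costs only half the gain. The other rows have slack 1 - q, which absorbs η⁻¹ once ε
  -- is small.
  set η : ℝ := (1 - ‖a‖) / 4 with hη
  have hη0 : 0 < η := by rw [hη]; linarith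
  have hηC : (η : ℂ) ≠ 0 := by exact_mod_cast hη0.ne'
  have hηn : ‖(η : ℂ)‖ = η := by simp [abs_of_pos hη0]
  obtain ⟨p, c, e, hp, hc, he, hIce, hce⟩ := exists_pairing I hcard hηC
  set ε : ℝ := (1 - q) / (4 * (1 + η⁻¹)) with hε
  have hε0 : 0 < ε := div_pos (by linarith) (by positivity)
  have hε1 : ε < 1 := by
    rw [hε, div_lt_one (by positivity)]
    have : 0 < η⁻¹ := inv_pos.2 hη0
    linarith
  have hε2 : 2 * ε * (1 + η⁻¹) < 1 - q := by
    have h1 : ε * (1 + η⁻¹) = (1 - q) / 4 := by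
      rw [hε]; field_simp
    have : 2 * ε * (1 + η⁻¹) = (1 - q) / 2 := by rw [mul_assoc, h1]; ring
    linarith
  -- The radial disc x ↦ (x / a) • diagonal d plus ε (x - a) times a pairing matrix. The added term
  -- vanishes at a, makes φ 0 square to zero, and brings all row sums below 1 on the closed disc,
  -- whence the strict inequality.
  let φ : ℂ → Matrix (Fin n) (Fin n) ℂ := fun x =>
    pairingMatrix p (fun k => x * d k / a + ε * (x - a) * c k) fun k => ε * (x - a) * e k
  have hφd : Differentiable ℂ φ := by
    rw [← differentiableOn_univ, differentiableOn_matrix_iff]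
    intro i j
    simp only [φ, pairingMatrix, Matrix.of_apply]
    split_ifs <;> fun_prop
  have hφm : Set.MapsTo φ (closedBall 0 1) (spectralBall n) := by
    intro x hx
    rw [mem_closedBall_zero_iff] at hx
    have hεn : ‖(ε : ℂ)‖ = ε := by simp [abs_of_pos hε0]
    have hxa : ‖x - a‖ ≤ 2 := (norm_sub_le _ _).trans (by linarith)
    refine mem_spectralBall_of_row_sum fun k => (sum_norm_pairingMatrix_le _ _ _ k).trans_lt ?_
    by_cases hk : k ∈ I
    · rw [(hIce k hk).1, (hIce k hk).2, (hmemI k).1 hk, mul_div_assoc, div_self ha0]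
      have h1 : x * 1 + ε * (x - a) * -1 = (1 - ε : ℝ) * x + ε * a := by push_cast; ring
      rw [h1]
      have h2 : ‖((1 - ε : ℝ) : ℂ) * x + ε * a‖ ≤ (1 - ε) + ε * ‖a‖ := by
        refine (norm_add_le _ _).trans ?_
        rw [norm_mul, norm_mul, hεn, Complex.norm_real, Real.norm_of_nonneg (by linarith)]
        nlinarith
      have h3 : ‖(ε : ℂ) * (x - a) * η‖ ≤ ε * 2 * η := by
        rw [norm_mul, norm_mul, hεn, hηn]
        gcongr
      rw [hη] at h3
      nlinarith [mul_pos hε0 (show 0 < 1 - ‖a‖ by linarith)]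
    · have h1 : ‖x * d k / a + ε * (x - a) * c k‖ ≤ q + ε * 2 * 1 := by
        refine (norm_add_le _ _).trans (add_le_add ?_ ?_)
        · rw [norm_div, norm_mul, div_le_iff₀ hr0]
          have := hq k hk
          nlinarith [norm_nonneg x, norm_nonneg (d k)]
        · rw [norm_mul, norm_mul, hεn]
          gcongr
          exact (hce k).1
      have h2 : ‖(ε : ℂ) * (x - a) * e k‖ ≤ ε * 2 * η⁻¹ := by
        rw [norm_mul, norm_mul, hεn]
        gcongr
        have := (hce k).2 hk
        rwa [hηn] at this
      linarith
  have hφa : φ a = Matrix.diagonal d := by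
    ext k l
    simp only [φ, pairingMatrix, Matrix.of_apply, Matrix.diagonal_apply, sub_self, mul_zero,
      zero_mul, add_zero, ite_self, mul_div_cancel_left₀ _ ha0, eq_comm]
  have hφ0 : φ 0 ^ 2 = 0 := by
    simp only [φ, zero_mul, zero_div, zero_add, zero_sub]
    refine pairingMatrix_sq_eq_zero hp (fun k => ?_) fun k => ?_
    · rw [hc]; ring
    · linear_combination (ε * -a) ^ 2 * he k
  refine ⟨φ 0, charpoly_eq_X_pow_of_pow_eq_zero two_pos hφ0, ?_⟩
  rw [← hφa]
  exact lempert_lt_norm isOpen_spectralBall hφd hφm hd1 ha0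

/-- The Möbius map with parameter -b turns a point b of maximal modulus into a strict maximum,
separating it from other points on the same circle. -/
theorem norm_moebius_lt_of_norm_le {b x : ℂ} (hb : ‖b‖ < 1) (hxb : ‖x‖ ≤ ‖b‖) (hne : x ≠ b) :
    ‖(x - -b) / (1 - conj (-b) * x)‖ < ‖(b - -b) / (1 - conj (-b) * b)‖ := by
  have hx : ‖x‖ < 1 := hxb.trans_lt hb
  have hb' : ‖-b‖ < 1 := by simpa using hb
  have h1 : 0 < ‖1 - conj (-b) * x‖ := norm_pos_iff.2 (one_sub_conj_mul_ne_zero hb' hx)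
  have h2 : 0 < ‖1 - conj (-b) * b‖ := norm_pos_iff.2 (one_sub_conj_mul_ne_zero hb' hb)
  rw [norm_div, norm_div, div_lt_div_iff₀ h1 h2]
  refine lt_of_pow_lt_pow_left₀ 2 (by positivity) ?_
  rw [mul_pow, mul_pow]
  have hne' : 0 < ‖x - b‖ ^ 2 := by
    have := norm_pos_iff.2 (sub_ne_zero.2 hne)
    positivity
  have hu : 0 ≤ ‖b‖ ^ 2 - ‖x‖ ^ 2 := by nlinarith [norm_nonneg x]
  have hr : 0 < 1 - ‖b‖ ^ 2 := by nlinarith [norm_nonneg b]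
  have key : ‖b - -b‖ ^ 2 * ‖1 - conj (-b) * x‖ ^ 2 - ‖x - -b‖ ^ 2 * ‖1 - conj (-b) * b‖ ^ 2 =
      (1 - ‖b‖ ^ 2) ^ 2 * ‖x - b‖ ^ 2 +
        (‖b‖ ^ 2 - ‖x‖ ^ 2) * (1 - ‖b‖ ^ 2) * (2 + 2 * ‖b‖ ^ 2) := by
    simp only [← Complex.normSq_eq_norm_sq, Complex.normSq_apply, Complex.sub_re, Complex.sub_im,
      Complex.mul_re, Complex.mul_im, Complex.conj_re, Complex.conj_im, Complex.one_re,
      Complex.one_im, Complex.neg_re, Complex.neg_im]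
    ring
  have h3 : 0 < (1 - ‖b‖ ^ 2) ^ 2 * ‖x - b‖ ^ 2 := by positivity
  have h4 : 0 ≤ (‖b‖ ^ 2 - ‖x‖ ^ 2) * (1 - ‖b‖ ^ 2) * (2 + 2 * ‖b‖ ^ 2) := by positivity
  linarith

theorem moebius_injective {μ x y : ℂ} (hμ : ‖μ‖ < 1) (hx : ‖x‖ < 1) (hy : ‖y‖ < 1)
    (h : (x - μ) / (1 - conj μ * x) = (y - μ) / (1 - conj μ * y)) : x = y := by
  have h1 := one_sub_conj_mul_ne_zero hμ hx
  have h2 := one_sub_conj_mul_ne_zero hμ hy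
  have h3 := one_sub_conj_mul_ne_zero hμ hμ
  rw [div_eq_div_iff h1 h2] at h
  have : (1 - conj μ * μ) * (x - y) = 0 := by linear_combination h
  exact sub_eq_zero.1 ((mul_eq_zero.1 this).resolve_left h3)

/-- `A` degenerates to `diagonal d` as far as the Lempert function is concerned. -/
structure DegeneratesToDiagonal (A : Matrix (Fin n) (Fin n) ℂ) (d : Fin n → ℂ) : Prop where
  mem : A ∈ spectralBall n
  charpoly_eq : A.charpoly = (Matrix.diagonal d).charpoly
  lempert_le : ∀ N ∈ spectralBall n,
    lempert (spectralBall n) A N ≤ lempert (spectralBall n) (Matrix.diagonal d) N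
  invariant : LempertInvariant A

namespace DegeneratesToDiagonal

variable {A : Matrix (Fin n) (Fin n) ℂ} {d : Fin n → ℂ}

theorem isRoot (h : DegeneratesToDiagonal A d) (i : Fin n) : A.charpoly.IsRoot (d i) := by
  rw [h.charpoly_eq, charpoly_diagonal', isRoot_prod_X_sub_C]
  exact ⟨i, rfl⟩

theorem norm_lt_one (h : DegeneratesToDiagonal A d) (i : Fin n) : ‖d i‖ < 1 :=
  mem_spectralBall_iff.1 h.mem _ (h.isRoot i)

theorem moebius (h : DegeneratesToDiagonal A d) {μ : ℂ} (hμ : ‖μ‖ < 1) :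
    DegeneratesToDiagonal (matrixMoebius μ A) fun i => (d i - μ) / (1 - conj μ * d i) := by
  have hμ' : ‖-μ‖ < 1 := by simpa using hμ
  have hdm := mem_spectralBall_of_charpoly_eq h.charpoly_eq h.mem
  refine ⟨matrixMoebius_mem hμ h.mem, ?_, fun N hN => ?_, h.invariant.matrixMoebius hμ h.mem⟩
  · rw [charpoly_matrixMoebius_eq hμ h.mem h.charpoly_eq, matrixMoebius_diagonal hμ h.norm_lt_one]
  · have hN' := matrixMoebius_mem hμ' hN
    rw [← matrixMoebius_diagonal hμ h.norm_lt_one, ← matrixMoebius_matrixMoebius_neg hμ hN,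
      lempert_matrixMoebius hμ h.mem hN', lempert_matrixMoebius hμ hdm hN']
    exact h.lempert_le _ hN'

/-- The disc from N to diagonal d bounds the value at N strictly below ‖d i₀‖. By invariance the
value at N is the value at 0, namely the spectral radius, which is at least ‖d i₀‖. -/
theorem not_dominant (h : DegeneratesToDiagonal A d) {i₀ : Fin n}
    (hd : ∀ i, d i = d i₀ ∨ ‖d i‖ < ‖d i₀‖)
    (hcard : (Finset.univ.filter fun i => d i = d i₀).card ≤
      (Finset.univ.filter fun i => d i = d i₀)ᶜ.card) : False := by
  obtain ⟨N, hN, hlt⟩ := exists_nilpotent_lempert_lt (h.norm_lt_one i₀) hd hcard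
  have hNm := mem_spectralBall_of_charpoly_eq_X_pow hN
  have h1 : lempert (spectralBall n) A N < ‖d i₀‖ₑ := by
    refine (h.lempert_le N hNm).trans_lt ?_
    rwa [lempert_spectralBall_comm]
  rw [h.invariant N 0 hNm (hN.trans charpoly_zero_eq.symm), lempert_spectralBall_comm,
    lempert_zero_left h.mem] at h1
  exact absurd (enorm_le_spectralRadius (h.isRoot i₀)) (not_le.2 h1)

theorem not_maximal (h : DegeneratesToDiagonal A d) {i₀ : Fin n}
    (hd : ∀ i, ‖d i‖ ≤ ‖d i₀‖)
    (hcard : (Finset.univ.filter fun i => d i = d i₀).card ≤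
      (Finset.univ.filter fun i => d i = d i₀)ᶜ.card) : False := by
  have hb := h.norm_lt_one i₀
  have hb' : ‖-d i₀‖ < 1 := by simpa using hb
  have hiff : ∀ i, (d i - -d i₀) / (1 - conj (-d i₀) * d i) =
      (d i₀ - -d i₀) / (1 - conj (-d i₀) * d i₀) ↔ d i = d i₀ := fun i =>
    ⟨fun he => moebius_injective hb' (h.norm_lt_one i) hb he, fun he => by rw [he]⟩
  refine (h.moebius hb').not_dominant (i₀ := i₀) (fun i => ?_) ?_
  · rw [hiff]
    by_cases hi : d i = d i₀
    · exact Or.inl hi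
    · exact Or.inr (norm_moebius_lt_of_norm_le hb (hd i) hi)
  · simpa only [hiff] using hcard

/-- By `not_maximal` an eigenvalue of maximal modulus, after any recentring, occupies more than half
of the indices. Recentring at such a value d j₁ makes another value d j₂ maximal, and the two cannot
both have a majority. -/
theorem eq_of_all (h : DegeneratesToDiagonal A d) (i j : Fin n) : d i = d j := by
  by_contra hij
  have : Nonempty (Fin n) := ⟨i⟩
  have h1 := h.moebius (h.norm_lt_one i)
  obtain ⟨j₁, hj₁⟩ := Finite.exists_max fun k => ‖(d k - d i) / (1 - conj (d i) * d k)‖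
  have hiff : ∀ j k, (d k - d j) / (1 - conj (d j) * d k) = 0 ↔ d k = d j := by
    intro j k
    have := one_sub_conj_mul_ne_zero (h.norm_lt_one j) (h.norm_lt_one k)
    rw [div_eq_zero_iff, or_iff_left this, sub_eq_zero]
  have hinj : ∀ j k l, (d k - d j) / (1 - conj (d j) * d k) = (d l - d j) / (1 - conj (d j) * d l) ↔
      d k = d l := fun j k l =>
    ⟨fun he => moebius_injective (h.norm_lt_one j) (h.norm_lt_one k) (h.norm_lt_one l) he,
      fun he => by rw [he]⟩
  have hlt : (Finset.univ.filter fun k => d k = d j₁)ᶜ.card <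
      (Finset.univ.filter fun k => d k = d j₁).card := by
    by_contra! hle
    exact h1.not_maximal hj₁ (by simpa only [hinj] using hle)
  have h2 := h.moebius (h.norm_lt_one j₁)
  obtain ⟨j₂, hj₂⟩ := Finite.exists_max fun k => ‖(d k - d j₁) / (1 - conj (d j₁) * d k)‖
  refine h2.not_maximal hj₂ ?_
  simp only [hinj]
  have hne : d j₂ ≠ d j₁ := by
    intro he
    have h0 : ∀ k, d k = d j₁ := by
      intro k
      have hk := hj₂ k
      rw [(hiff j₁ j₂).2 he, norm_zero] at hk
      exact (hiff j₁ k).1 (norm_le_zero_iff.1 hk)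
    exact hij ((h0 i).trans (h0 j).symm)
  have hsub : (Finset.univ.filter fun k => d k = d j₂) ⊆
      (Finset.univ.filter fun k => d k = d j₁)ᶜ := by
    intro k
    simp only [Finset.mem_filter, Finset.mem_univ, true_and, Finset.mem_compl]
    intro hk hk'
    exact hne (hk.symm.trans hk')
  have hsub' : (Finset.univ.filter fun k => d k = d j₁) ⊆
      (Finset.univ.filter fun k => d k = d j₂)ᶜ := by
    rw [← compl_compl (Finset.univ.filter fun k => d k = d j₁)]
    exact Finset.compl_subset_compl.2 hsub
  exact (Finset.card_le_card hsub).trans (hlt.le.trans (Finset.card_le_card hsub'))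

end DegeneratesToDiagonal

theorem LempertInvariant.exists_charpoly_eq_pow {A : Matrix (Fin n) (Fin n) ℂ} (hn : 1 ≤ n)
    (hA : A ∈ spectralBall n) (h : LempertInvariant A) :
    ∃ μ : ℂ, ‖μ‖ < 1 ∧ A.charpoly = (X - C μ) ^ n := by
  obtain ⟨d, hd, hcl⟩ := exists_diagonal_mem_closure A
  have hdeg : DegeneratesToDiagonal A d := by
    refine ⟨hA, by rw [hd, charpoly_diagonal'], fun N _ => ?_, h⟩
    rw [lempert_spectralBall_comm, lempert_spectralBall_comm _ N]
    exact lempert_le_of_mem_closure hcl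
  refine ⟨d ⟨0, hn⟩, hdeg.norm_lt_one _, ?_⟩
  rw [hd, Finset.prod_congr rfl fun i _ => by rw [hdeg.eq_of_all i ⟨0, hn⟩]]
  simp

end DistinctEigenvalues

/-! ### Divisibility by x - α forced by vanishing rows. -/

section RowFactor

open scoped Matrix.Norms.Elementwise
open Polynomial (X C)

variable {n : ℕ}

/-- Each of the n - 1 rows vanishing at α yields a factor x - α, so determinants acquire the factor
(x - α) ^ (n - 1). -/
theorem exists_row_factor {F : ℂ → Matrix (Fin n) (Fin n) ℂ} {α : ℂ} {i₀ : Fin n}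
    (hF : DifferentiableOn ℂ F (ball 0 1)) (hα : α ∈ ball (0 : ℂ) 1)
    (h : ∀ k, k ≠ i₀ → ∀ l, F α k l = 0) :
    ∃ G : ℂ → Matrix (Fin n) (Fin n) ℂ, DifferentiableOn ℂ G (ball 0 1) ∧
      ∀ x, F x = Matrix.diagonal (fun k => if k = i₀ then 1 else x - α) * G x := by
  have hkl : ∀ k l, ∃ g : ℂ → ℂ, DifferentiableOn ℂ g (ball 0 1) ∧
      ∀ x, F x k l = (if k = i₀ then 1 else x - α) * g x := by
    intro k l
    have hd := differentiableOn_matrix_iff.1 hF k l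
    by_cases hk : k = i₀
    · exact ⟨fun x => F x k l, hd, fun x => by simp [hk]⟩
    · obtain ⟨g, hg, hfg⟩ := exists_eq_smul_of_apply_eq_zero hd hα (h k hk l)
      exact ⟨g, hg, fun x => by rw [hfg, if_neg hk, smul_eq_mul]⟩
  choose g hg hfg using hkl
  refine ⟨fun x => Matrix.of fun k l => g k l x, differentiableOn_matrix_iff.2 hg, fun x => ?_⟩
  ext k l
  rw [Matrix.diagonal_mul, hfg]
  rfl

theorem prod_ite_eq_pow (i₀ : Fin n) (z : ℂ) :
    ∏ k, (if k = i₀ then 1 else z) = z ^ (n - 1) := by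
  rw [Finset.prod_ite, Finset.prod_const_one, one_mul, Finset.prod_const, Finset.filter_ne',
    Finset.card_erase_of_mem (Finset.mem_univ _), Finset.card_univ, Fintype.card_fin]

theorem sum_ite_eq_add (i₀ : Fin n) (y z : ℂ) :
    ∑ k, (if k = i₀ then y else z) = y + (n - 1 : ℕ) * z := by
  rw [Finset.sum_ite, Finset.filter_eq', if_pos (Finset.mem_univ _), Finset.sum_singleton,
    Finset.sum_const, Finset.filter_ne', Finset.card_erase_of_mem (Finset.mem_univ _),
    Finset.card_univ, Fintype.card_fin, nsmul_eq_mul]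

theorem sigma_mk_zero_eq_trace (hn : 0 < n) (A : Matrix (Fin n) (Fin n) ℂ) :
    sigma A ⟨0, hn⟩ = A.trace := by
  obtain ⟨m, rfl⟩ : ∃ m, n = m + 1 := ⟨n - 1, by omega⟩
  exact sigma_zero_eq_trace A

theorem norm_det_smul_one_sub_le {A : Matrix (Fin n) (Fin n) ℂ} (hA : A ∈ spectralBall n) (t : ℂ) :
    ‖(t • (1 : Matrix (Fin n) (Fin n) ℂ) - A).det‖ ≤ (‖t‖ + 1) ^ n := by
  obtain ⟨d, hd, -⟩ := exists_diagonal_mem_closure A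
  rw [← eval_charpoly_eq_det, hd, Polynomial.eval_prod, norm_prod]
  calc ∏ i, ‖(X - C (d i)).eval t‖ ≤ ∏ _i : Fin n, (‖t‖ + 1) := by
        refine Finset.prod_le_prod (fun _ _ => norm_nonneg _) fun i _ => ?_
        simp only [Polynomial.eval_sub, Polynomial.eval_X, Polynomial.eval_C]
        have : ‖d i‖ < 1 := mem_spectralBall_iff.1 hA _ (by
          rw [hd, isRoot_prod_X_sub_C]; exact ⟨i, rfl⟩)
        linarith [norm_sub_le t (d i)]
    _ = _ := by simp

/-- A bound for the cofactor of a power in a bounded holomorphic function. -/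
theorem norm_le_of_eq_pow_mul {f h : ℂ → ℂ} {α : ℂ} {k : ℕ} {K : ℝ} (hα : ‖α‖ ≤ 1 / 2)
    (hh : DifferentiableOn ℂ h (ball 0 1)) (hK : ∀ x ∈ ball (0 : ℂ) 1, ‖f x‖ ≤ K)
    (hf : ∀ x ∈ ball (0 : ℂ) 1, f x = (x - α) ^ k * h x) {x : ℂ} (hx : x ∈ ball (0 : ℂ) 1) :
    ‖h x‖ ≤ 4 ^ k * K := by
  have hK0 : 0 ≤ K := (norm_nonneg _).trans (hK x hx)
  -- Here ‖y - α‖ ≥ 1 / 4, so division is harmless; the maximum principle carries the bound inside.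
  have hout : ∀ y ∈ ball (0 : ℂ) 1, 3 / 4 ≤ ‖y‖ → ‖h y‖ ≤ 4 ^ k * K := by
    intro y hy hy1
    have h1 : 1 / 4 ≤ ‖y - α‖ := by linarith [norm_sub_norm_le y α]
    have h2 : (1 / 4 : ℝ) ^ k * ‖h y‖ ≤ K := by
      calc (1 / 4 : ℝ) ^ k * ‖h y‖ ≤ ‖y - α‖ ^ k * ‖h y‖ := by gcongr
        _ = ‖f y‖ := by rw [hf y hy, norm_mul, norm_pow]
        _ ≤ K := hK y hy
    rw [one_div, inv_pow, inv_mul_le_iff₀ (by positivity)] at h2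
    exact h2
  by_cases hx1 : 3 / 4 ≤ ‖x‖
  · exact hout x hx hx1
  have hcl : DiffContOnCl ℂ h (ball 0 (3 / 4)) := by
    apply DifferentiableOn.diffContOnCl
    rw [closure_ball _ (by norm_num)]
    exact hh.mono (closedBall_subset_ball (by norm_num))
  refine Complex.norm_le_of_forall_mem_frontier_norm_le isBounded_ball hcl (fun y hy => ?_)
    (subset_closure (by simpa using hx1))
  rw [frontier_ball _ (by norm_num), mem_sphere_zero_iff_norm] at hy
  exact hout y (by rw [mem_ball_zero_iff, hy]; norm_num) hy.ge

end RowFactor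

/-! ### Nilpotent matrices of index n. -/

section RegularNilpotent

open scoped Matrix.Norms.Elementwise
open Polynomial (X C)

variable {n : ℕ}

/-- Lower bound for discs from a nilpotent matrix to a diagonalizable matrix with an eigenvalue of
multiplicity `n - 1`. -/
theorem pow_le_of_disc {φ : ℂ → Matrix (Fin n) (Fin n) ℂ} {α t u : ℂ} {i₀ : Fin n}
    (hφ : DifferentiableOn ℂ φ (ball 0 1)) (hm : Set.MapsTo φ (ball 0 1) (spectralBall n))
    (h0 : (φ 0).charpoly = X ^ n)
    (h1 : φ α = Matrix.diagonal fun k => if k = i₀ then u else t) (hα : ‖α‖ ≤ 1 / 2)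
    (ht : ‖t‖ ≤ 1) : ‖t‖ ^ n ≤ ‖α‖ ^ (n - 1) * 8 ^ n := by
  have hα1 : α ∈ ball (0 : ℂ) 1 := by rw [mem_ball_zero_iff]; linarith
  have h0m : (0 : ℂ) ∈ ball (0 : ℂ) 1 := by simp
  -- At α only the row i₀ of t • 1 - φ survives, so its determinant is divisible by (x - α) ^ (n -
  -- 1); at 0 that determinant equals t ^ n.
  obtain ⟨G, hG, hFG⟩ := exists_row_factor (i₀ := i₀) (α := α)
    (F := fun x => t • (1 : Matrix (Fin n) (Fin n) ℂ) - φ x) (by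
      exact (differentiableOn_const _).sub hφ) hα1 (by
      intro k hk l
      simp only [h1, Matrix.sub_apply, Matrix.smul_apply, Matrix.one_apply, Matrix.diagonal_apply]
      split_ifs <;> simp_all)
  have hdet : ∀ x, (t • (1 : Matrix (Fin n) (Fin n) ℂ) - φ x).det =
      (x - α) ^ (n - 1) * (G x).det := by
    intro x
    rw [hFG x, Matrix.det_mul, Matrix.det_diagonal, prod_ite_eq_pow]
  have hb := norm_le_of_eq_pow_mul (K := 2 ^ n) hα hG.matrix_det (fun x hx =>
    (norm_det_smul_one_sub_le (hm hx) t).trans (by gcongr; linarith)) (fun x _ => hdet x) h0m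
  have h2 := hdet 0
  rw [← eval_charpoly_eq_det, h0, Polynomial.eval_pow, Polynomial.eval_X, zero_sub] at h2
  rw [← norm_pow, h2, norm_mul, norm_pow, norm_neg]
  gcongr
  refine hb.trans ?_
  calc (4 : ℝ) ^ (n - 1) * 2 ^ n ≤ 4 ^ n * 2 ^ n := by
        gcongr
        · norm_num
        · omega
    _ = 8 ^ n := by rw [← mul_pow]; norm_num

/-- Conjugation by the diagonal matrix of powers of 2 turns the superdiagonal ones into 1 / 2, after
which row sums suffice. -/
theorem companionOfSigma_mem_of_small {s : Fin n → ℂ} (hs : ∀ i : Fin n, 2 ^ (i : ℕ) * ‖s i‖ < 1 / 2) :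
    companionOfSigma s ∈ spectralBall n := by
  have hconj := isConj_diagonal (fun i : Fin n => (2 : ℂ) ^ (i : ℕ)) (fun i => pow_ne_zero _ two_ne_zero)
    (companionOfSigma s)
  refine mem_spectralBall_of_charpoly_eq hconj.charpoly_eq.symm
    (mem_spectralBall_of_row_sum fun i => ?_)
  calc ∑ j, ‖Matrix.of (fun i j : Fin n => (2 : ℂ) ^ (i : ℕ) * companionOfSigma s i j *
          ((2 : ℂ) ^ (j : ℕ))⁻¹) i j‖
      ≤ ∑ j : Fin n, ((if (j : ℕ) = 0 then 2 ^ (i : ℕ) * ‖s i‖ else 0) +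
          if (i : ℕ) + 1 = j then 1 / 2 else 0) := by
        refine Finset.sum_le_sum fun j _ => ?_
        simp only [companionOfSigma, firstColumnCompanion, Matrix.of_apply]
        split_ifs with h1 h2 h2
        · omega
        · simp [h1]
        · rw [zero_add, mul_one, ← h2, pow_succ, zero_add]
          field_simp
          simp
        · simp
    _ ≤ 2 ^ (i : ℕ) * ‖s i‖ + 1 / 2 := by
        rw [Finset.sum_add_distrib]
        refine add_le_add ?_ ?_
        · have hi : 0 < n := i.pos
          rw [Finset.sum_eq_single ⟨0, hi⟩]
          · simp
          · intro j _ hj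
            rw [if_neg]
            intro h
            exact hj (Fin.ext h)
          · simp
        · by_cases hi : (i : ℕ) + 1 < n
          · rw [Finset.sum_eq_single ⟨(i : ℕ) + 1, hi⟩]
            · simp
            · intro j _ hj
              rw [if_neg]
              intro h
              exact hj (Fin.ext h.symm)
            · simp
          · rw [Finset.sum_eq_zero]
            · norm_num
            · intro j _
              rw [if_neg]
              omega
    _ < 1 := by linarith [hs i]

/-- For the eigenvalues t (n - 1 times) and -(n - 1)t the trace vanishes, so `sigma` is O(t²) and a
linear disc of companion matrices costs K t². By invariance the diagonal matrix costs no more, and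
`pow_le_of_disc` yields t ^ n ≤ C t ^ (2n - 2), absurd for small t because n > 2. -/
theorem LempertInvariant.false_of_pow_ne_zero {M : Matrix (Fin n) (Fin n) ℂ} (hn : 3 ≤ n)
    (h : LempertInvariant M) (hM : M.charpoly = X ^ n) (hM1 : M ^ (n - 1) ≠ 0) : False := by
  obtain ⟨m, hnm⟩ : ∃ m, n = m + 1 := ⟨n - 1, by omega⟩
  have hm0 : 0 < n := by omega
  have hconj : IsConj (companionOfSigma (0 : Fin n → ℂ)) M := by
    have h1 := isConj_companionOfSigma_of_pow_ne_zero hM1 (pow_eq_zero_of_charpoly_eq hM)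
    have h2 : sigma M = 0 := by
      ext j
      rw [sigma, hM, Polynomial.coeff_X_pow, if_neg (by omega), mul_zero, Pi.zero_apply]
    rwa [h2] at h1
  -- the constant in the quadratic upper bound
  set K : ℝ := 2 ^ (2 * n + 2) * n ^ 2 with hK
  have hn0 : (0 : ℝ) < n := by exact_mod_cast (by omega : 0 < n)
  have hn1 : (1 : ℝ) ≤ n := by exact_mod_cast (by omega : 1 ≤ n)
  have hK1 : 1 ≤ K := by
    rw [hK]
    have : (1 : ℝ) ≤ 2 ^ (2 * n + 2) := one_le_pow₀ (by norm_num)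
    nlinarith
  have hbound : ∀ t : ℝ, 0 < t → t * n < 1 → 2 * K * t ^ 2 ≤ 1 / 2 →
      t ^ n ≤ (2 * K * t ^ 2) ^ (n - 1) * 8 ^ n := by
    intro t ht htn htK
    set B : Matrix (Fin n) (Fin n) ℂ :=
      Matrix.diagonal fun k => if k = ⟨0, hm0⟩ then -((m : ℂ) * t) else (t : ℂ) with hB
    have hroot : ∀ x, B.charpoly.IsRoot x → ‖x‖ ≤ n * t := by
      intro x hx
      rw [hB, charpoly_diagonal', isRoot_prod_X_sub_C] at hx
      obtain ⟨i, rfl⟩ := hx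
      split_ifs
      · rw [norm_neg, norm_mul, Complex.norm_natCast, Complex.norm_real, Real.norm_of_nonneg ht.le,
          hnm]
        push_cast
        nlinarith
      · rw [Complex.norm_real, Real.norm_of_nonneg ht.le]
        nlinarith
    have hBm : B ∈ spectralBall n := mem_spectralBall_iff.2 fun x hx => by
      have := hroot x hx
      linarith
    have hs0 : sigma B ⟨0, hm0⟩ = 0 := by
      rw [sigma_mk_zero_eq_trace, hB, Matrix.trace_diagonal, sum_ite_eq_add, hnm]
      simp
    have hsj : ∀ j, ‖sigma B j‖ ≤ (n * t) ^ 2 * 2 ^ n := by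
      intro j
      by_cases hj : j = ⟨0, hm0⟩
      · rw [hj, hs0, norm_zero]; positivity
      have hj' : 1 ≤ (j : ℕ) := by
        rw [Nat.one_le_iff_ne_zero]
        intro h0
        exact hj (Fin.ext h0)
      rw [sigma, norm_mul, norm_pow, norm_neg, norm_one, one_pow, one_mul]
      refine (norm_coeff_charpoly_le hroot _).trans ?_
      gcongr ?_ * ?_
      · exact pow_le_pow_of_le_one (by positivity) (by linarith) (by omega)
      · exact_mod_cast Nat.choose_le_two_pow _ _
    set a : ℂ := ((K * t ^ 2 : ℝ) : ℂ) with ha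
    have haK : 0 < K * t ^ 2 := by positivity
    have ha0 : a ≠ 0 := by rw [ha]; exact_mod_cast haK.ne'
    have han : ‖a‖ = K * t ^ 2 := by rw [ha, Complex.norm_real, Real.norm_of_nonneg haK.le]
    have hle : lempert (spectralBall n) M B ≤ ‖a‖ₑ := by
      rw [h B (companionOfSigma (sigma B)) hBm
        (charpoly_eq_iff_sigma_eq.2 (sigma_companionOfSigma _).symm),
        ← lempert_eq_of_isConj_left hconj]
      refine lempert_le (φ := fun x => companionOfSigma ((x / a) • sigma B)) ?_ ?_ ?_ ?_ ?_
      · rw [mem_ball_zero_iff, han]; linarith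
      · exact DifferentiableOn.companionOfSigma (by fun_prop)
      · intro x hx
        rw [mem_ball_zero_iff] at hx
        apply companionOfSigma_mem_of_small
        intro i
        rw [Pi.smul_apply, norm_smul, norm_div, han]
        have h1 : (2 : ℝ) ^ (i : ℕ) ≤ 2 ^ n := pow_le_pow_right₀ (by norm_num) i.2.le
        calc 2 ^ (i : ℕ) * (‖x‖ / (K * t ^ 2) * ‖sigma B i‖)
            ≤ 2 ^ n * (1 / (K * t ^ 2) * ((n * t) ^ 2 * 2 ^ n)) := by
              gcongr
              exact hsj i
          _ = 1 / 4 := by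
              rw [hK]
              have : (2 : ℝ) ^ (2 * n + 2) = 2 ^ n * 2 ^ n * 4 := by ring
              rw [this]
              field_simp
          _ < 1 / 2 := by norm_num
      · simp
      · simp [ha0]
    have hlt : lempert (spectralBall n) M B < ((2 * K * t ^ 2).toNNReal : ℝ≥0∞) := by
      refine hle.trans_lt ?_
      rw [enorm_eq_nnnorm, ENNReal.coe_lt_coe, ← NNReal.coe_lt_coe, coe_nnnorm, han,
        Real.coe_toNNReal _ (by positivity)]
      linarith
    obtain ⟨α, hα, hαc, φ, hφ, hm, h0, h1⟩ := lempert_lt_iff.1 hlt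
    rw [enorm_eq_nnnorm, ENNReal.coe_lt_coe, ← NNReal.coe_lt_coe, coe_nnnorm,
      Real.coe_toNNReal _ (by positivity)] at hαc
    have := pow_le_of_disc hφ hm (by rw [h0, hM]) (h1.trans hB) (by linarith)
      (by rw [Complex.norm_real, Real.norm_of_nonneg ht.le]; nlinarith)
    rw [Complex.norm_real, Real.norm_of_nonneg ht.le] at this
    refine this.trans ?_
    gcongr
  -- the two bounds are incompatible for small `t`
  set R : ℝ := (2 * K) ^ (n - 1) * 8 ^ n with hR
  have hR1 : 2 * K ≤ R := by
    rw [hR]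
    have h1 : 2 * K ≤ (2 * K) ^ (n - 1) := le_self_pow₀ (by linarith) (by omega)
    have h2 : (1 : ℝ) ≤ 8 ^ n := one_le_pow₀ (by norm_num)
    nlinarith
  have hR0 : 0 < R := by linarith
  set t : ℝ := 1 / (2 * n * R) with ht
  have ht0 : 0 < t := by positivity
  have htR : t * R = 1 / (2 * n) := by rw [ht]; field_simp
  have htR1 : t * R < 1 := by
    rw [htR, div_lt_one (by positivity)]; linarith
  have hR2 : 2 ≤ R := by linarith
  have htn : t * n ≤ 1 / 4 := by
    have : t * n = 1 / (2 * R) := by rw [ht]; field_simp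
    rw [this]
    exact one_div_le_one_div_of_le (by norm_num) (by linarith)
  have ht1 : t ≤ 1 / 4 := by nlinarith
  have hcond : 2 * K * t ^ 2 ≤ 1 / 2 := by
    have : 2 * K * t ≤ 1 := by nlinarith
    nlinarith
  have h1 := hbound t ht0 (by linarith) hcond
  have h2 : (2 * K * t ^ 2) ^ (n - 1) * 8 ^ n = R * t ^ (n - 2) * t ^ n := by
    rw [hR, mul_pow, ← pow_mul]
    have : t ^ (2 * (n - 1)) = t ^ (n - 2) * t ^ n := by
      rw [← pow_add]; congr 1; omega
    rw [this]; ring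
  rw [h2] at h1
  have h3 : R * t ^ (n - 2) < 1 := by
    calc R * t ^ (n - 2) ≤ R * t := by
          gcongr
          exact pow_le_of_le_one ht0.le (by linarith) (by omega)
      _ < 1 := by linarith
  have h4 : 0 < t ^ n := by positivity
  nlinarith

end RegularNilpotent

/-! ### Failure of joint continuity and of the polydisk formula at scalar matrices. -/

section Scalar

open scoped Matrix.Norms.Elementwise

open Polynomial (X C)

variable {n : ℕ}

/-- The Lempert function distinguishes `0` from a regular nilpotent matrix. -/
theorem exists_lempert_lt_lempert_zero (hn : 2 ≤ n) :
    ∃ J B : Matrix (Fin n) (Fin n) ℂ, J.charpoly = X ^ n ∧ B ∈ spectralBall n ∧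
      lempert (spectralBall n) J B < lempert (spectralBall n) 0 B := by
  let i₀ : Fin n := ⟨n - 1, by omega⟩
  -- The eigenvalues of J x are the n-th roots of x, so the spectral radius at parameter x exceeds
  -- ‖x‖ for 0 < ‖x‖ < 1.
  let J : ℂ → Matrix (Fin n) (Fin n) ℂ := fun x => firstColumnCompanion (Pi.single i₀ x)
  have hJ : ∀ x, (J x).charpoly = X ^ n - C x := by
    intro x
    simp only [J, charpoly_firstColumnCompanion]
    rw [Finset.sum_eq_single i₀]
    · have : n - (n - 1 + 1) = 0 := by omega
      simp [i₀, this]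
    · intro j _ hj
      simp [hj]
    · simp
  have hmem : ∀ x ∈ ball (0 : ℂ) 1, J x ∈ spectralBall n := by
    intro x hx
    rw [mem_spectralBall_iff]
    intro t ht
    rw [hJ, Polynomial.IsRoot, Polynomial.eval_sub, Polynomial.eval_pow, Polynomial.eval_X,
      Polynomial.eval_C, sub_eq_zero] at ht
    rw [mem_ball_zero_iff, ← ht, norm_pow] at hx
    exact (pow_lt_one_iff_of_nonneg (norm_nonneg _) (by omega)).1 hx
  have hp : (1 / 4 : ℂ) ∈ ball (0 : ℂ) 1 := by rw [mem_ball_zero_iff]; norm_num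
  refine ⟨J 0, J (1 / 4), by rw [hJ]; simp, hmem _ hp, ?_⟩
  have hle : lempert (spectralBall n) (J 0) (J (1 / 4)) ≤ ‖(1 / 4 : ℂ)‖ₑ := by
    refine lempert_le hp ?_ hmem rfl rfl
    refine differentiableOn_matrix_iff.2 ?_
    intro i j
    simp only [J, firstColumnCompanion, Matrix.of_apply, Pi.single_apply]
    split_ifs <;> fun_prop
  obtain ⟨t, ht⟩ := exists_isRoot_charpoly (by omega) (J (1 / 4))
  rw [lempert_zero_left (hmem _ hp)]
  refine hle.trans_lt (lt_of_lt_of_le ?_ (enorm_le_spectralRadius ht))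
  rw [hJ, Polynomial.IsRoot, Polynomial.eval_sub, Polynomial.eval_pow, Polynomial.eval_X,
    Polynomial.eval_C, sub_eq_zero] at ht
  have ht' : ‖t‖ ^ n = 1 / 4 := by rw [← norm_pow, ht]; norm_num
  rw [enorm_eq_nnnorm, enorm_eq_nnnorm, ENNReal.coe_lt_coe, ← NNReal.coe_lt_coe, coe_nnnorm,
    coe_nnnorm]
  by_contra! hlt
  have h4 : ‖(1 / 4 : ℂ)‖ = 1 / 4 := by norm_num
  rw [h4] at hlt
  have h2 : ‖t‖ ^ n ≤ ‖t‖ ^ 2 := pow_le_pow_of_le_one (norm_nonneg _) (by linarith) hn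
  nlinarith [norm_nonneg t]

/-- After moving the pole to 0: conjugates of J converge to 0 and share the value of J at B, which
is strictly below the value of 0 at B. -/
theorem not_continuousWithinAt_lempert_of_isScalarMatrix {A : Matrix (Fin n) (Fin n) ℂ}
    (hn : 2 ≤ n) (hA : A ∈ spectralBall n) (hs : IsScalarMatrix A) :
    ∃ B ∈ spectralBall n, ¬ ContinuousWithinAt
      (fun p : Matrix (Fin n) (Fin n) ℂ × Matrix (Fin n) (Fin n) ℂ =>
        lempert (spectralBall n) p.1 p.2) (spectralBall n ×ˢ spectralBall n) (A, B) := by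
  obtain ⟨μ, rfl⟩ := hs
  have hμ := norm_lt_one_of_smul_one_mem (by omega) hA
  have hμ' : ‖-μ‖ < 1 := by simpa using hμ
  obtain ⟨J, B, hJ, hB, hlt⟩ := exists_lempert_lt_lempert_zero hn
  refine ⟨matrixMoebius (-μ) B, matrixMoebius_mem hμ' hB, fun hc => ?_⟩
  rw [← matrixMoebius_neg_zero] at hc
  have h0 := continuousWithinAt_lempert_of_matrixMoebius hμ' zero_mem_spectralBall hB hc
  have h1 : ContinuousWithinAt (fun Y => lempert (spectralBall n) Y B) (spectralBall n) 0 :=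
    h0.comp (f := fun Y => (Y, B)) (x := (0 : Matrix (Fin n) (Fin n) ℂ))
      (by fun_prop) fun Y hY => ⟨hY, hB⟩
  have h2 := h1.eventually_const_lt hlt
  rw [isOpen_spectralBall.nhdsWithin_eq zero_mem_spectralBall] at h2
  obtain ⟨Y, hY, hYJ⟩ := mem_closure_iff_nhds.1 (zero_mem_closure_orbit hJ) _ h2
  exact (lempert_eq_of_isConj_left (B := B) hYJ).not_lt hY

/-- J and 0 have the same `sigma`, so the polydisk bound at J applies to 0, and it lies strictly
below the value for 0 and B. -/
theorem not_lempert_eq_symPolydisk_of_isScalarMatrix {A : Matrix (Fin n) (Fin n) ℂ}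
    (hn : 2 ≤ n) (hA : A ∈ spectralBall n) (hs : IsScalarMatrix A) :
    ∃ B ∈ spectralBall n,
      lempert (spectralBall n) A B ≠ lempert (symPolydisk n) (sigma A) (sigma B) := by
  obtain ⟨μ, rfl⟩ := hs
  have hμ := norm_lt_one_of_smul_one_mem (by omega) hA
  have hμ' : ‖-μ‖ < 1 := by simpa using hμ
  obtain ⟨J, B, hJ, hB, hlt⟩ := exists_lempert_lt_lempert_zero hn
  have hJm := mem_spectralBall_of_charpoly_eq_X_pow hJ
  refine ⟨matrixMoebius (-μ) B, matrixMoebius_mem hμ' hB, fun he => ?_⟩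
  rw [← matrixMoebius_neg_zero, lempert_matrixMoebius hμ' zero_mem_spectralBall hB,
    ← charpoly_eq_iff_sigma_eq.1 (charpoly_matrixMoebius_eq hμ' hJm
      (hJ.trans charpoly_zero_eq.symm))] at he
  refine hlt.not_ge (he.le.trans ((lempert_symPolydisk_le _ _).trans ?_))
  rw [lempert_matrixMoebius hμ' hJm hB]

end Scalar

/-! ### Degeneration of nilpotent matrices to a single off-diagonal entry. -/

section Degeneration

open Polynomial (X C)

variable {n : ℕ}

theorem isConj_submatrix_perm (A : Matrix (Fin n) (Fin n) ℂ) (τ : Equiv.Perm (Fin n)) :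
    IsConj A (A.submatrix τ τ) := by
  refine isConj_of_det_ne_zero (P := (1 : Matrix (Fin n) (Fin n) ℂ).submatrix τ id) ?_ ?_
  · rw [Matrix.det_permute]
    simp
  · ext i j
    rw [Matrix.mul_apply, Matrix.mul_apply]
    rw [Finset.sum_eq_single (τ i), Finset.sum_eq_single (τ.symm j)]
    · simp [Matrix.one_apply]
    · intro b _ hb
      have : τ b ≠ j := fun h => hb (by simp [← h])
      simp [this]
    · simp
    · intro b _ hb
      simp [Ne.symm hb]
    · simp

theorem isConj_single_single {i j k l : Fin n} (hij : i ≠ j) (hkl : k ≠ l) {c d : ℂ} (hc : c ≠ 0)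
    (hd : d ≠ 0) : IsConj (Matrix.single i j c) (Matrix.single k l d) := by
  obtain ⟨τ, hτi, hτj⟩ : ∃ τ : Equiv.Perm (Fin n), τ i = k ∧ τ j = l := by
    refine ⟨Equiv.swap (Equiv.swap i k j) l * Equiv.swap i k, ?_, ?_⟩
    · have h1 : k ≠ Equiv.swap i k j := by
        intro h
        have := congrArg (Equiv.swap i k) h
        simp at this
        exact hij this
      simp [Equiv.swap_apply_of_ne_of_ne h1 hkl]
    · simp
  have h1 := isConj_submatrix_perm (Matrix.single k l d) τ
  have h2 : (Matrix.single k l d).submatrix τ τ = Matrix.single i j d := by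
    ext a b
    simp [Matrix.single_apply, ← hτi, ← hτj]
  rw [h2] at h1
  refine IsConj.trans ?_ h1.symm
  have h3 := isConj_diagonal (fun a : Fin n => if a = i then d / c else 1)
    (fun a => by split_ifs <;> simp [hc, hd]) (Matrix.single i j c)
  convert h3 using 1
  ext a b
  by_cases ha : i = a <;> by_cases hb : j = b
  · subst ha hb
    simp [hij.symm, hc]
  all_goals simp [Matrix.single_apply, ha, hb]

/-- Every nonzero nilpotent matrix degenerates to a matrix with a single nonzero entry. -/
theorem exists_single_mem_closure_orbit {M : Matrix (Fin n) (Fin n) ℂ} (hM : M.charpoly = X ^ n)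
    (hM0 : M ≠ 0) : ∃ i j : Fin n, ∃ c : ℂ, i ≠ j ∧ c ≠ 0 ∧
      Matrix.single i j c ∈ closure {B | IsConj M B} := by
  obtain ⟨T, hMT, hT⟩ := exists_isConj_upperTriangular M
  have hdiag : ∀ i, T i i = 0 := by
    intro i
    apply isRoot_X_pow (n := n)
    rw [← hM, hMT.charpoly_eq, charpoly_eq_of_upperTriangular hT, isRoot_prod_X_sub_C]
    exact ⟨i, rfl⟩
  have hT' : ∀ i j, j ≤ i → T i j = 0 := fun i j h => by
    rcases h.lt_or_eq with h | rfl
    · exact hT i j h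
    · exact hdiag _
  have hT0 : T ≠ 0 := by
    rintro rfl
    obtain ⟨c, hc⟩ := hMT
    rw [SemiconjBy, zero_mul, Units.mul_right_eq_zero] at hc
    exact hM0 hc
  classical
  have hrow : (Finset.univ.filter fun i => ∃ j, T i j ≠ 0).Nonempty := by
    by_contra! h
    apply hT0
    ext i j
    by_contra hij
    have : i ∈ Finset.univ.filter fun i => ∃ j, T i j ≠ 0 := by simpa using ⟨j, hij⟩
    rw [h] at this
    simp at this
  obtain ⟨i, hi, himax⟩ := Finset.exists_max_image _ id hrow
  simp only [Finset.mem_filter, Finset.mem_univ, true_and, id_eq] at hi himax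
  have hcol : (Finset.univ.filter fun j => T i j ≠ 0).Nonempty := by
    obtain ⟨j, hj⟩ := hi
    exact ⟨j, by simpa using hj⟩
  obtain ⟨j, hj, hjmin⟩ := Finset.exists_min_image _ id hcol
  simp only [Finset.mem_filter, Finset.mem_univ, true_and, id_eq] at hj hjmin
  have hij : i < j := by
    by_contra! h
    exact hj (hT' i j h)
  refine ⟨i, j, T i j, hij.ne, hj, ?_⟩
  -- Row i is the last nonzero row of T and j its first nonzero column. The weight is strictly
  -- increasing up to i, constant from i to j, and larger beyond j, so (i, j) is the only nonzero
  -- entry joining equal weights.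
  let w : Fin n → ℕ := fun l => if l ≤ i then l else if l ≤ j then i else i + 1
  have h := mem_closure_orbit_of_weights (A := T) w (fun a b hab => hT a b (by
    by_contra! hle
    simp only [w] at hab
    split_ifs at hab <;> omega))
  have hset : {B | IsConj T B} = {B | IsConj M B} := by
    ext B
    exact ⟨fun h => hMT.trans h, fun h => hMT.symm.trans h⟩
  rw [hset] at h
  convert h using 1
  ext a b
  rw [Matrix.single_apply, Matrix.of_apply]
  by_cases hab : T a b = 0
  · rw [hab, ite_self]
    rw [if_neg]
    rintro ⟨rfl, rfl⟩
    exact hj hab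
  · have h1 : a < b := by
      by_contra! h
      exact hab (hT' a b h)
    have h2 : a ≤ i := himax a ⟨b, hab⟩
    by_cases hw : w a = w b
    · have h3 : a = i ∧ b ≤ j := by
        simp only [w] at hw
        split_ifs at hw <;> constructor <;> omega
      obtain ⟨rfl, h4⟩ := h3
      have h5 : j = b := le_antisymm (hjmin b hab) h4
      subst h5
      rw [if_pos hw, if_pos ⟨rfl, rfl⟩]
    · rw [if_neg hw, if_neg]
      rintro ⟨rfl, rfl⟩
      apply hw
      simp [w, hij.not_ge]

theorem lempert_le_lempert_single {M B : Matrix (Fin n) (Fin n) ℂ} (hM : M.charpoly = X ^ n)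
    (hM0 : M ≠ 0) {i j : Fin n} (hij : i ≠ j) {c : ℂ} (hc : c ≠ 0) :
    lempert (spectralBall n) M B ≤ lempert (spectralBall n) (Matrix.single i j c) B := by
  obtain ⟨k, l, d, hkl, hd, hcl⟩ := exists_single_mem_closure_orbit hM hM0
  rw [lempert_spectralBall_comm M, lempert_spectralBall_comm _ B,
    lempert_eq_of_isConj_right (isConj_single_single hij hkl hc hd)]
  exact lempert_le_of_mem_closure hcl

end Degeneration

/-! ### The upper bound for derogatory nilpotent matrices. -/

section ShearDisc

open scoped Matrix.Norms.Elementwise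
open Polynomial (X C)

variable {n : ℕ}

theorem sum_ite_val_eq_le {a : ℝ} (ha : 0 ≤ a) (m : ℕ) :
    ∑ j : Fin n, (if (j : ℕ) = m then a else 0) ≤ a := by
  by_cases hm : m < n
  · rw [Finset.sum_eq_single ⟨m, hm⟩]
    · simp
    · intro j _ hj
      rw [if_neg]
      exact fun h => hj (Fin.ext h)
    · simp
  · rw [Finset.sum_eq_zero]
    · exact ha
    · intro j _
      rw [if_neg]
      omega

theorem charpoly_smul_one_add_eq {A B : Matrix (Fin n) (Fin n) ℂ} (h : A.charpoly = B.charpoly)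
    {c : ℂ} (hc : c ≠ 0) : (c • (1 + A)).charpoly = (c • (1 + B)).charpoly := by
  have e : ∀ (t : ℂ) (Y : Matrix (Fin n) (Fin n) ℂ),
      (c • (1 + Y)).charpoly.eval t = c ^ n * Y.charpoly.eval ((t - c) / c) := by
    intro t Y
    rw [eval_charpoly_eq_det, ← det_smul_one_sub_smul hc]
    congr 1
    rw [smul_add, sub_smul]
    abel
  refine Polynomial.funext fun t => ?_
  rw [e, e, h]

/-- The disc x ↦ θ (x • 1 + b E + x • Y), with E a matrix unit, starts at a multiple of E and equals
θ α (1 + Z) at α, where Z has the eigenvalues n - 1, -1, …, -1. All eigenvalues of 1 + Z but one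
vanish, and the remaining one is n. The fixed shear b E is what lets Y stay small. -/
theorem exists_small_disc (hn : 2 ≤ n) {i₀ i₁ : Fin n} (hi₀ : (i₀ : ℕ) = 0) (hi₁ : (i₁ : ℕ) = 1) :
    ∃ c : ℂ, c ≠ 0 ∧ ∃ ε : ℝ, 0 < ε ∧ ∀ α : ℝ, 0 < α → α < ε →
      ∃ B : Matrix (Fin n) (Fin n) ℂ, B ∈ spectralBall n ∧
        B.charpoly = (Matrix.diagonal fun k : Fin n =>
          if k = i₀ then (((n - 1 / 4 : ℝ) * α : ℝ) : ℂ) else 0).charpoly ∧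
        lempert (spectralBall n) (Matrix.single i₀ i₁ c) B ≤ ‖(α : ℂ)‖ₑ := by
  have hn2 : (2 : ℝ) ≤ n := by exact_mod_cast hn
  set D : Matrix (Fin n) (Fin n) ℂ := Matrix.diagonal fun k => if k = i₀ then (n : ℂ) - 1 else -1
    with hD
  have hn0 : 0 < n := by omega
  have hi₀' : i₀ = ⟨0, hn0⟩ := Fin.ext hi₀
  have hD0 : sigma D i₀ = 0 := by
    rw [hi₀', sigma_mk_zero_eq_trace, hD, Matrix.trace_diagonal, sum_ite_eq_add]
    push_cast [Nat.cast_sub hn0]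
    ring
  set k : Fin n → ℂ := fun j => (-1) ^ (j : ℕ) * sigma D j with hk
  have hk0 : k i₀ = 0 := by rw [hk]; simp [hD0]
  set S : ℝ := ∑ j, ‖k j‖ with hS
  have hkS : ∀ j, ‖k j‖ ≤ S := fun j =>
    Finset.single_le_sum (f := fun j => ‖k j‖) (fun _ _ => norm_nonneg _) (Finset.mem_univ j)
  have hS0 : 0 ≤ S := Finset.sum_nonneg fun _ _ => norm_nonneg _
  -- With θ = 1 - 4b this gives θ n = n - 1/4 exactly, and the row sums are at most θ (1 + 3b) < 1.
  set b : ℝ := 1 / (16 * n) with hb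
  have hb0 : 0 < b := by positivity
  have hb1 : b ≤ 1 := by
    rw [hb, div_le_one (by positivity)]; linarith
  have hbn : b * n = 1 / 16 := by rw [hb]; field_simp
  set θ : ℝ := 1 - 4 * b with hθ
  have hθ0 : 0 < θ := by rw [hθ]; nlinarith
  have hbC : (b : ℂ) ≠ 0 := by exact_mod_cast hb0.ne'
  have hθC : (θ : ℂ) ≠ 0 := by exact_mod_cast hθ0.ne'
  refine ⟨θ * b, mul_ne_zero hθC hbC, b ^ n * b / (S + 1), by positivity, fun α hα hαε => ?_⟩
  have hαC : (α : ℂ) ≠ 0 := by exact_mod_cast hα.ne'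
  have hακ : α * S ≤ b ^ n * b := by
    rw [lt_div_iff₀ (by positivity)] at hαε
    nlinarith
  have hα1 : α < 1 := by
    refine hαε.trans_le ?_
    rw [div_le_one (by positivity)]
    have : b ^ n ≤ 1 := pow_le_one₀ hb0.le hb1
    nlinarith
  have hbpow : ∀ i : Fin n, b ^ n ≤ b ^ (i : ℕ) := fun i =>
    pow_le_pow_of_le_one hb0.le hb1 i.2.le
  -- This scaling makes the superdiagonal of Z equal to b / α in row 0 and b below, so α Z contains
  -- the fixed shear b in row 0. The first column is O(α), except for its top entry, which vanishes
  -- because D has trace zero.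
  set d : Fin n → ℂ := fun i => if (i : ℕ) = 0 then 1 else α / b ^ (i : ℕ) with hd
  have hd0 : ∀ i, d i ≠ 0 := by
    intro i
    simp only [hd]
    split_ifs
    · exact one_ne_zero
    · exact div_ne_zero hαC (pow_ne_zero _ hbC)
  have hdk : ∀ i, ‖d i * k i‖ ≤ b := by
    intro i
    by_cases hi : (i : ℕ) = 0
    · have : i = i₀ := Fin.ext (hi.trans hi₀.symm)
      rw [this, hk0, mul_zero, norm_zero]
      exact hb0.le
    · simp only [hd, if_neg hi]
      rw [norm_mul, norm_div, norm_pow, Complex.norm_real, Complex.norm_real,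
        Real.norm_of_nonneg hα.le, Real.norm_of_nonneg hb0.le, div_mul_eq_mul_div,
        div_le_iff₀ (by positivity)]
      calc α * ‖k i‖ ≤ α * S := by gcongr; exact hkS i
        _ ≤ b ^ n * b := hακ
        _ ≤ b * b ^ (i : ℕ) := by rw [mul_comm]; exact mul_le_mul_of_nonneg_left (hbpow i) hb0.le
  set Z : Matrix (Fin n) (Fin n) ℂ :=
    Matrix.of fun i j => d i * companionOfSigma (sigma D) i j * (d j)⁻¹ with hZ
  have hZc : Z.charpoly = D.charpoly := by
    rw [← (isConj_diagonal d hd0 (companionOfSigma (sigma D))).charpoly_eq,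
      charpoly_eq_iff_sigma_eq, sigma_companionOfSigma]
  set Y : Matrix (Fin n) (Fin n) ℂ := Matrix.of fun i j =>
    (if (j : ℕ) = 0 then d i * k i else 0) +
      if (j : ℕ) = i + 1 then (if (i : ℕ) = 0 then 0 else (b : ℂ)) else 0 with hY
  have hYZ : (b : ℂ) • Matrix.single i₀ i₁ (1 : ℂ) + (α : ℂ) • Y = (α : ℂ) • Z := by
    ext i j
    simp only [hY, hZ, Matrix.add_apply, Matrix.smul_apply, Matrix.of_apply, Matrix.single_apply,
      companionOfSigma, firstColumnCompanion, smul_eq_mul, Fin.ext_iff, hi₀, hi₁, hd, hk]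
    by_cases hj : (j : ℕ) = 0
    · simp [hj]
    by_cases hij : (j : ℕ) = i + 1
    · by_cases hi : (i : ℕ) = 0
      · simp [hi, hij, mul_div_cancel₀ _ hαC]
      · have h0 : ¬ (0 = (i : ℕ)) := Ne.symm hi
        have h1 : (α : ℂ) / b ^ (i : ℕ) * ((α : ℂ) / b ^ ((i : ℕ) + 1))⁻¹ = b := by
          rw [pow_succ]
          field_simp
        simp only [hi, hij, h0, false_and, if_false, if_true, Nat.succ_ne_zero, zero_add, mul_one,
          mul_zero, h1]
    · have h1 : ¬ ((i : ℕ) + 1 = j) := fun h => hij h.symm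
      have h2 : ¬ (0 = (i : ℕ) ∧ 1 = (j : ℕ)) := by omega
      simp [hj, hij, h1, h2]
  refine ⟨((θ * α : ℝ) : ℂ) • (1 + Z), ?_⟩
  have hcharp : (((θ * α : ℝ) : ℂ) • (1 + Z)).charpoly = (Matrix.diagonal fun k : Fin n =>
      if k = i₀ then (((n - 1 / 4 : ℝ) * α : ℝ) : ℂ) else 0).charpoly := by
    rw [charpoly_smul_one_add_eq hZc (by exact_mod_cast (mul_pos hθ0 hα).ne')]
    congr 1
    rw [hD, ← Matrix.diagonal_one, Matrix.diagonal_add, ← Matrix.diagonal_smul]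
    congr 1
    ext i
    simp only [Pi.smul_apply, smul_eq_mul]
    split_ifs
    · have : (n - 1 / 4 : ℝ) = θ * n := by rw [hθ]; linarith
      rw [this]
      push_cast
      ring
    · simp
  have hφm : ∀ x ∈ ball (0 : ℂ) 1, (θ : ℂ) • (x • 1 + (b : ℂ) • Matrix.single i₀ i₁ (1 : ℂ) +
      x • Y) ∈ spectralBall n := by
    intro x hx
    rw [mem_ball_zero_iff] at hx
    refine mem_spectralBall_of_row_sum fun i => ?_
    calc ∑ j, ‖((θ : ℂ) • (x • 1 + (b : ℂ) • Matrix.single i₀ i₁ (1 : ℂ) + x • Y)) i j‖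
        ≤ ∑ j : Fin n, θ * ((if (j : ℕ) = i then 1 else 0) + (if (j : ℕ) = 1 then b else 0) +
            ((if (j : ℕ) = 0 then b else 0) + if (j : ℕ) = i + 1 then b else 0)) := by
          refine Finset.sum_le_sum fun j _ => ?_
          rw [Matrix.smul_apply, norm_smul, Complex.norm_real, Real.norm_of_nonneg hθ0.le]
          refine mul_le_mul_of_nonneg_left ?_ hθ0.le
          rw [Matrix.add_apply, Matrix.add_apply]
          refine (norm_add_le _ _).trans (add_le_add ((norm_add_le _ _).trans (add_le_add ?_ ?_)) ?_)
          · rw [Matrix.smul_apply, Matrix.one_apply, smul_eq_mul]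
            by_cases hij : i = j
            · simp [hij, hx.le]
            · simp only [if_neg hij, mul_zero, norm_zero]
              split_ifs <;> norm_num
          · rw [Matrix.smul_apply, Matrix.single_apply, smul_eq_mul]
            by_cases hij : i₀ = i ∧ i₁ = j
            · rw [if_pos hij, mul_one, Complex.norm_real, Real.norm_of_nonneg hb0.le, ← hij.2,
                if_pos hi₁]
            · rw [if_neg hij, mul_zero, norm_zero]
              split_ifs
              exacts [hb0.le, le_rfl]
          · rw [Matrix.smul_apply, norm_smul]
            refine (mul_le_of_le_one_left (norm_nonneg _) hx.le).trans ?_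
            simp only [hY, Matrix.of_apply]
            refine (norm_add_le _ _).trans (add_le_add ?_ ?_)
            · split_ifs
              · exact hdk i
              · simp
            · split_ifs
              · simpa using hb0.le
              · rw [Complex.norm_real, Real.norm_of_nonneg hb0.le]
              · simp
      _ ≤ θ * (1 + b + (b + b)) := by
          rw [← Finset.mul_sum, Finset.sum_add_distrib, Finset.sum_add_distrib,
            Finset.sum_add_distrib]
          gcongr <;> exact sum_ite_val_eq_le (by positivity) _
      _ < 1 := by rw [hθ]; nlinarith
  have hval : (θ : ℂ) • ((α : ℂ) • 1 + (b : ℂ) • Matrix.single i₀ i₁ (1 : ℂ) + (α : ℂ) • Y) =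
      ((θ * α : ℝ) : ℂ) • (1 + Z) := by
    rw [add_assoc, hYZ, ← smul_add, smul_smul]
    push_cast
    rfl
  have hαm : (α : ℂ) ∈ ball (0 : ℂ) 1 := by
    rwa [mem_ball_zero_iff, Complex.norm_real, Real.norm_of_nonneg hα.le]
  refine ⟨hval ▸ hφm _ hαm, hcharp, lempert_le (φ := fun x => (θ : ℂ) • (x • 1 +
    (b : ℂ) • Matrix.single i₀ i₁ (1 : ℂ) + x • Y)) hαm ?_ hφm ?_ hval⟩
  · fun_prop
  · simp

end ShearDisc

/-! ### Perturbation of characteristic polynomials and their divisibility. -/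

section Perturbation

open scoped Matrix.Norms.Elementwise
open Polynomial (X C)

variable {n : ℕ}

theorem eq_of_eqOn_ball_diff_singleton {f g : ℂ → ℂ} {a : ℂ}
    (hf : DifferentiableOn ℂ f (ball 0 1)) (hg : DifferentiableOn ℂ g (ball 0 1))
    (h : ∀ x ∈ ball (0 : ℂ) 1, x ≠ a → f x = g x) {x : ℂ} (hx : x ∈ ball (0 : ℂ) 1) :
    f x = g x := by
  by_cases hxa : x = a
  · have hn := isOpen_ball.mem_nhds hx
    refine Filter.EventuallyEq.eq_of_nhds ((ContinuousAt.eventuallyEq_nhds_iff_eventuallyEq_nhdsNE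
      (hf.continuousOn.continuousAt hn) (hg.continuousOn.continuousAt hn)).1 ?_)
    filter_upwards [nhdsWithin_le_nhds hn, self_mem_nhdsWithin] with y hy hya
    exact h y hy (hxa ▸ hya)
  · exact h x hx hxa

theorem coeff_charpoly_smul (c : ℂ) (A : Matrix (Fin n) (Fin n) ℂ) {i : ℕ} (hi : i < n) :
    (c • A).charpoly.coeff i = c ^ (n - i) * A.charpoly.coeff i := by
  by_cases hc : c = 0
  · rw [hc, zero_smul, charpoly_zero_eq, Polynomial.coeff_X_pow, if_neg hi.ne,
      zero_pow (by omega), zero_mul]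
  · have h : (c • A).charpoly.comp (C c * X) = C (c ^ n) * A.charpoly := by
      refine Polynomial.funext fun t => ?_
      rw [Polynomial.eval_comp, Polynomial.eval_mul, Polynomial.eval_mul, Polynomial.eval_C,
        Polynomial.eval_C, Polynomial.eval_X, eval_charpoly_eq_det, eval_charpoly_eq_det, mul_smul,
        ← smul_sub, Matrix.det_smul, Fintype.card_fin]
    have h2 := congrArg (fun p => p.coeff i) h
    simp only [Polynomial.comp_C_mul_X_coeff, Polynomial.coeff_C_mul] at h2
    have h3 : c ^ n = c ^ (n - i) * c ^ i := by rw [← pow_add]; congr 1; omega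
    rw [h3, mul_right_comm] at h2
    exact mul_right_cancel₀ (pow_ne_zero i hc) h2

theorem coeff_charpoly_firstColumnCompanion (g : ℕ → ℂ) {i : ℕ} (hi : i < n) :
    (firstColumnCompanion fun j : Fin n => -g (n - ((j : ℕ) + 1))).charpoly.coeff i = g i := by
  rw [charpoly_firstColumnCompanion, sum_fin_rev (fun k => C (-g k) * X ^ k),
    Polynomial.coeff_sub, Polynomial.coeff_X_pow, if_neg hi.ne, Polynomial.finsetSum_coeff,
    Finset.sum_eq_single i]
  · rw [Polynomial.coeff_C_mul_X_pow, if_pos rfl]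
    ring
  · intro k _ hk
    rw [Polynomial.coeff_C_mul_X_pow, if_neg hk.symm]
  · intro h
    exact absurd (Finset.mem_range.2 hi) h

theorem norm_pow_sub_pow_le {a b : ℂ} (ha : ‖a‖ ≤ 2) (hb : ‖b‖ ≤ 2) (j : ℕ) :
    ‖a ^ j - b ^ j‖ ≤ j * 2 ^ j * ‖a - b‖ := by
  induction j with
  | zero => simp
  | succ j ih =>
    have h1 : a ^ (j + 1) - b ^ (j + 1) = a * (a ^ j - b ^ j) + (a - b) * b ^ j := by ring
    rw [h1]
    have h2 : ‖b‖ ^ j ≤ 2 ^ j := by gcongr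
    calc ‖a * (a ^ j - b ^ j) + (a - b) * b ^ j‖
        ≤ ‖a‖ * ‖a ^ j - b ^ j‖ + ‖a - b‖ * ‖b‖ ^ j := by
          refine (norm_add_le _ _).trans_eq ?_
          rw [norm_mul, norm_mul, norm_pow]
      _ ≤ 2 * (j * 2 ^ j * ‖a - b‖) + ‖a - b‖ * 2 ^ j := by gcongr
      _ ≤ 2 * (j * 2 ^ j * ‖a - b‖) + ‖a - b‖ * (2 * 2 ^ j) := by
          gcongr
          have : (0 : ℝ) ≤ 2 ^ j := by positivity
          linarith
      _ = _ := by push_cast; ring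

theorem pow_le_norm_eval_charpoly {A : Matrix (Fin n) (Fin n) ℂ} (hA : A ∈ spectralBall n) {y : ℂ}
    (hy : 1 ≤ ‖y‖) : (‖y‖ - 1) ^ n ≤ ‖A.charpoly.eval y‖ := by
  obtain ⟨d, hd, -⟩ := exists_diagonal_mem_closure A
  rw [hd, Polynomial.eval_prod, norm_prod]
  calc (‖y‖ - 1) ^ n = ∏ _i : Fin n, (‖y‖ - 1) := by simp
    _ ≤ _ := by
        refine Finset.prod_le_prod (fun _ _ => by linarith) fun i _ => ?_
        simp only [Polynomial.eval_sub, Polynomial.eval_X, Polynomial.eval_C]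
        have : ‖d i‖ < 1 := mem_spectralBall_iff.1 hA _ (by
          rw [hd, isRoot_prod_X_sub_C]; exact ⟨i, rfl⟩)
        linarith [norm_sub_norm_le y (d i)]

theorem eval_charpoly_eq_sum (A : Matrix (Fin n) (Fin n) ℂ) (y : ℂ) :
    A.charpoly.eval y = ∑ i ∈ Finset.range n, A.charpoly.coeff i * y ^ i + y ^ n := by
  have hdeg : A.charpoly.natDegree = n := by simp [Matrix.charpoly_natDegree_eq_dim]
  have h1 : A.charpoly.coeff n = 1 := by
    have := A.charpoly_monic.coeff_natDegree
    rwa [hdeg] at this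
  rw [Polynomial.eval_eq_sum_range, hdeg, Finset.sum_range_succ, h1, one_mul]

/-- Continuity of roots: a small perturbation of the characteristic polynomial of a matrix in the
spectral ball has its roots in a slightly larger disc. -/
theorem norm_root_le_of_coeff_close (hn : 1 ≤ n) {A B : Matrix (Fin n) (Fin n) ℂ}
    (hA : A ∈ spectralBall n) {η δ : ℝ} (hη : 0 < η)
    (hδ : n * δ ≤ η * (η / (1 + η)) ^ (n - 1))
    (h : ∀ i < n, ‖A.charpoly.coeff i - B.charpoly.coeff i‖ ≤ δ) {y : ℂ}
    (hy : B.charpoly.IsRoot y) : ‖y‖ ≤ 1 + η := by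
  by_contra! hlt
  have hy1 : 1 ≤ ‖y‖ := by linarith
  have h1 : ‖A.charpoly.eval y‖ ≤ n * δ * ‖y‖ ^ (n - 1) := by
    have : A.charpoly.eval y = ∑ i ∈ Finset.range n,
        (A.charpoly.coeff i - B.charpoly.coeff i) * y ^ i := by
      rw [← sub_zero (A.charpoly.eval y), ← hy.eq_zero, eval_charpoly_eq_sum, eval_charpoly_eq_sum,
        add_sub_add_right_eq_sub, ← Finset.sum_sub_distrib]
      exact Finset.sum_congr rfl fun i _ => by ring
    rw [this]
    refine (norm_sum_le _ _).trans ?_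
    calc ∑ i ∈ Finset.range n, ‖(A.charpoly.coeff i - B.charpoly.coeff i) * y ^ i‖
        ≤ ∑ _i ∈ Finset.range n, δ * ‖y‖ ^ (n - 1) := by
          refine Finset.sum_le_sum fun i hi => ?_
          have hi' := Finset.mem_range.1 hi
          rw [norm_mul, norm_pow]
          have h2 := h i hi'
          have h3 : ‖y‖ ^ i ≤ ‖y‖ ^ (n - 1) := pow_le_pow_right₀ hy1 (by omega)
          have h4 : 0 ≤ δ := (norm_nonneg _).trans h2
          gcongr
      _ = _ := by rw [Finset.sum_const, Finset.card_range, nsmul_eq_mul, mul_assoc]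
  -- The lower bound (‖y‖ - 1) ^ n meets the upper bound n δ ‖y‖ ^ (n - 1). Beyond 1 + η one has ‖y‖
  -- - 1 ≥ η / (1 + η) * ‖y‖, and δ is chosen so that the two clash.
  have h2 := (pow_le_norm_eval_charpoly hA hy1).trans h1
  have h3 : η / (1 + η) * ‖y‖ ≤ ‖y‖ - 1 := by
    rw [div_mul_eq_mul_div, div_le_iff₀ (by linarith)]
    nlinarith
  have h4 : (η / (1 + η) * ‖y‖) ^ (n - 1) * (‖y‖ - 1) ≤ (‖y‖ - 1) ^ n := by
    obtain ⟨m, rfl⟩ : ∃ m, n = m + 1 := ⟨n - 1, by omega⟩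
    rw [pow_succ (‖y‖ - 1), Nat.add_sub_cancel]
    have : 0 ≤ ‖y‖ - 1 := by linarith
    gcongr
  have h5 : 0 < (η / (1 + η) * ‖y‖) ^ (n - 1) := by positivity
  have h6 : n * δ * ‖y‖ ^ (n - 1) ≤ (η / (1 + η) * ‖y‖) ^ (n - 1) * η := by
    rw [mul_pow]
    calc n * δ * ‖y‖ ^ (n - 1) ≤ η * (η / (1 + η)) ^ (n - 1) * ‖y‖ ^ (n - 1) := by gcongr
      _ = _ := by ring
  nlinarith

/-- If all rows but one of `φ α` vanish, then the coefficients of the characteristic polynomial of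
`φ` are divisible by powers of `x - α`. -/
theorem exists_coeff_charpoly_eq_pow_mul {φ : ℂ → Matrix (Fin n) (Fin n) ℂ} {α : ℂ} {i₀ : Fin n}
    (hφ : DifferentiableOn ℂ φ (ball 0 1)) (hα : α ∈ ball (0 : ℂ) 1)
    (h : ∀ k, k ≠ i₀ → ∀ l, φ α k l = 0) :
    ∃ q : ℕ → ℂ → ℂ, (∀ i, DifferentiableOn ℂ (q i) (ball 0 1)) ∧ ∀ i < n, ∀ x ∈ ball (0 : ℂ) 1,
      (φ x).charpoly.coeff i = (x - α) ^ (n - 1 - i) * q i x := by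
  obtain ⟨G, hG, hφG⟩ := exists_row_factor hφ hα h
  -- The pencil (x - α) X • 1 - φ x with x - α divided out of all rows but i₀. Comparing
  -- coefficients of X ^ i leaves the exponent n - 1 - i.
  let R : ℂ → Matrix (Fin n) (Fin n) (Polynomial ℂ) := fun x => Matrix.of fun k l =>
    (if k = l then (if k = i₀ then C (x - α) * X else X) else 0) - C (G x k l)
  have hq : ∀ i, DifferentiableOn ℂ (fun x => (R x).det.coeff i) (ball 0 1) := by
    refine fun i => differentiableOn_coeff_det (fun k l m => ?_) i
    have hd := differentiableOn_matrix_iff.1 hG k l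
    simp only [R, Matrix.of_apply, Polynomial.coeff_sub]
    refine DifferentiableOn.sub ?_ ?_
    · split_ifs
      · simp only [Polynomial.coeff_C_mul]
        fun_prop
      · fun_prop
      · fun_prop
    · simp only [Polynomial.coeff_C]
      split_ifs
      · exact hd
      · fun_prop
  refine ⟨fun i x => (R x).det.coeff i, hq, fun i hi x hx => ?_⟩
  refine eq_of_eqOn_ball_diff_singleton (a := α) (f := fun x => (φ x).charpoly.coeff i)
    (g := fun x => (x - α) ^ (n - 1 - i) * (R x).det.coeff i) (hφ.charpoly_coeff i)
    (DifferentiableOn.mul (by fun_prop) (hq i)) (fun x _ hxα => ?_) hx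
  have hx0 : x - α ≠ 0 := sub_ne_zero.2 hxα
  have hpol : (φ x).charpoly.comp (C (x - α) * X) = C ((x - α) ^ (n - 1)) * (R x).det := by
    refine Polynomial.funext fun s => ?_
    rw [Polynomial.eval_comp, Polynomial.eval_mul, Polynomial.eval_mul, Polynomial.eval_C,
      Polynomial.eval_C, Polynomial.eval_X, eval_charpoly_eq_det,
      ← Polynomial.coe_evalRingHom, RingHom.map_det, ← prod_ite_eq_pow i₀, ← Matrix.det_diagonal,
      ← Matrix.det_mul]
    congr 1
    ext k l
    rw [hφG x, Matrix.diagonal_mul, Matrix.sub_apply, Matrix.smul_apply, Matrix.diagonal_mul,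
      Matrix.one_apply]
    simp only [R, RingHom.mapMatrix_apply, Matrix.map_apply, Matrix.of_apply,
      Polynomial.coe_evalRingHom, Polynomial.eval_sub, Polynomial.eval_C]
    split_ifs <;> simp; ring
  have h2 := congrArg (fun p => p.coeff i) hpol
  simp only [Polynomial.comp_C_mul_X_coeff, Polynomial.coeff_C_mul] at h2
  have h3 : (x - α) ^ (n - 1) = (x - α) ^ (n - 1 - i) * (x - α) ^ i := by
    rw [← pow_add]; congr 1; omega
  rw [h3, mul_right_comm] at h2
  exact mul_right_cancel₀ (pow_ne_zero i hx0) h2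

end Perturbation

/-! ### The lower bound for nilpotent matrices of index below n. -/

section Derogatory

open scoped Matrix.Norms.Elementwise
open Polynomial (X C)

variable {n : ℕ}

theorem norm_trace_le_of_root_zero (hn : 1 ≤ n) {A : Matrix (Fin n) (Fin n) ℂ} {R : ℝ}
    (h : ∀ t, A.charpoly.IsRoot t → ‖t‖ ≤ R) (h0 : A.charpoly.IsRoot 0) :
    ‖A.charpoly.coeff (n - 1)‖ ≤ (n - 1) * R := by
  obtain ⟨d, hd, -⟩ := exists_diagonal_mem_closure A
  have htr : A.charpoly.coeff (n - 1) = -∑ i, d i := by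
    have h1 := sigma_mk_zero_eq_trace hn (Matrix.diagonal d)
    rw [sigma, charpoly_diagonal', ← hd, Matrix.trace_diagonal] at h1
    rw [← h1]
    simp
  have hle : ∀ i, ‖d i‖ ≤ R := fun i => h _ (by rw [hd, isRoot_prod_X_sub_C]; exact ⟨i, rfl⟩)
  rw [hd, isRoot_prod_X_sub_C] at h0
  obtain ⟨k, hk⟩ := h0
  rw [htr, norm_neg, ← Finset.add_sum_erase _ _ (Finset.mem_univ k), hk, zero_add]
  refine (norm_sum_le _ _).trans ((Finset.sum_le_card_nsmul _ _ R fun i _ => hle i).trans_eq ?_)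
  rw [Finset.card_erase_of_mem (Finset.mem_univ _), Finset.card_univ, Fintype.card_fin,
    nsmul_eq_mul, Nat.cast_sub hn, Nat.cast_one]

/-- If `φ 0` is a derogatory nilpotent matrix then the determinant of `φ` vanishes to second order
at the origin. -/
theorem apply_zero_eq_zero_of_coeff_charpoly {φ : ℂ → Matrix (Fin n) (Fin n) ℂ} {α : ℂ}
    (hn : 2 ≤ n) (hφ : DifferentiableOn ℂ φ (ball 0 1)) (h0 : φ 0 ^ (n - 1) = 0) (hα0 : α ≠ 0)
    {g : ℂ → ℂ} (hg : DifferentiableOn ℂ g (ball 0 1))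
    (h : ∀ x ∈ ball (0 : ℂ) 1, (φ x).charpoly.coeff 0 = (x - α) ^ (n - 1) * (x * g x)) :
    g 0 = 0 := by
  have h0m : (0 : ℂ) ∈ ball (0 : ℂ) 1 := by simp
  obtain ⟨H, hH, hφH⟩ := exists_eq_smul_of_apply_eq_zero (hφ.matrix_pow (n - 1)) h0m h0
  -- Since φ ^ (n - 1) vanishes at 0, its determinant (det φ) ^ (n - 1) is divisible by x ^ n. One
  -- factor x in det φ accounts only for x ^ (n - 1), so a further one is needed.
  have hdet : ∀ x ∈ ball (0 : ℂ) 1, x ≠ 0 →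
      ((-1) ^ n * (x - α) ^ (n - 1) * g x) ^ (n - 1) = x * (H x).det := by
    intro x hx hx0
    have h1 : (φ x).det = (-1) ^ n * ((x - α) ^ (n - 1) * (x * g x)) := by
      rw [Matrix.det_eq_sign_charpoly_coeff, Fintype.card_fin, h x hx]
    have h2 : (φ x).det ^ (n - 1) = x ^ n * (H x).det := by
      rw [← Matrix.det_pow, hφH x, sub_zero, Matrix.det_smul, Fintype.card_fin]
    have h3 : x ^ n = x ^ (n - 1) * x := by rw [← pow_succ]; congr 1; omega
    rw [h1, h3] at h2
    refine mul_left_cancel₀ (pow_ne_zero (n - 1) hx0) ?_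
    rw [← mul_assoc, ← h2, ← mul_pow]
    congr 1
    ring
  have h4 := eq_of_eqOn_ball_diff_singleton (a := 0)
    (f := fun x => ((-1) ^ n * (x - α) ^ (n - 1) * g x) ^ (n - 1))
    (g := fun x => x * (H x).det) (by fun_prop) (differentiableOn_id.mul hH.matrix_det) hdet h0m
  have h5 : (n : ℕ) - 1 ≠ 0 := by omega
  simpa [h5, hα0] using h4

/-- Lower bound for discs from a derogatory nilpotent matrix to a matrix of rank one. -/
theorem exists_norm_le_of_disc (hn : 2 ≤ n) :
    ∃ ε : ℝ, 0 < ε ∧ ∀ (φ : ℂ → Matrix (Fin n) (Fin n) ℂ) (α t : ℂ) (i₀ : Fin n),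
      DifferentiableOn ℂ φ (ball 0 1) → Set.MapsTo φ (ball 0 1) (spectralBall n) →
      (φ 0).charpoly = X ^ n → φ 0 ^ (n - 1) = 0 → α ≠ 0 → ‖α‖ ≤ ε →
      (φ α = Matrix.diagonal fun k => if k = i₀ then t else 0) → ‖t‖ ≤ (n - 1 / 2) * ‖α‖ := by
  have hn2 : (2 : ℝ) ≤ n := by exact_mod_cast hn
  set K : ℝ := 4 * 8 ^ n with hK
  have hK0 : 0 < K := by positivity
  -- The final estimate is (n - 1)(1 + η) + 2K‖α‖ ≤ n - 1 + 1/8 + 1/8, which is below n - 1/2.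
  set η : ℝ := 1 / (8 * n) with hη
  have hη0 : 0 < η := by positivity
  have hηn : η * n = 1 / 8 := by rw [hη]; field_simp
  set ρ : ℝ := η * (η / (1 + η)) ^ (n - 1) with hρ
  have hρ0 : 0 < ρ := by positivity
  set ε : ℝ := min (1 / 2) (min (1 / (16 * K)) (ρ / (n * (K * (n * 2 ^ n))))) with hε
  refine ⟨ε, by positivity, fun φ α t i₀ hφ hm h0 h0' hα0 hαε h1 => ?_⟩
  have hα2 : ‖α‖ ≤ 1 / 2 := hαε.trans (min_le_left _ _)
  have hαK : ‖α‖ * (16 * K) ≤ 1 := by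
    rw [← le_div_iff₀ (by positivity)]
    exact hαε.trans ((min_le_right _ _).trans (min_le_left _ _))
  have hαρ : n * (K * (n * 2 ^ n * ‖α‖)) ≤ ρ := by
    have : ‖α‖ ≤ ρ / (n * (K * (n * 2 ^ n))) :=
      hαε.trans ((min_le_right _ _).trans (min_le_right _ _))
    rw [le_div_iff₀ (by positivity)] at this
    linarith
  have h0m : (0 : ℂ) ∈ ball (0 : ℂ) 1 := by simp
  have hαm : α ∈ ball (0 : ℂ) 1 := by rw [mem_ball_zero_iff]; linarith
  obtain ⟨q, hq, hcq⟩ := exists_coeff_charpoly_eq_pow_mul (i₀ := i₀) hφ hαm (by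
    intro k hk l
    rw [h1, Matrix.diagonal_apply]
    simp [hk])
  have hq0 : ∀ i, i < n → q i 0 = 0 := by
    intro i hi
    have h2 := hcq i hi 0 h0m
    rw [h0, Polynomial.coeff_X_pow, if_neg hi.ne] at h2
    simpa [hα0] using h2.symm
  have hg : ∀ i, ∃ g : ℂ → ℂ, DifferentiableOn ℂ g (ball 0 1) ∧
      (i < n → ∀ x, q i x = x * g x) := by
    intro i
    by_cases hi : i < n
    · obtain ⟨g, hg, hqg⟩ := exists_eq_smul_of_apply_eq_zero (hq i) h0m (hq0 i hi)
      exact ⟨g, hg, fun _ x => by rw [hqg, sub_zero, smul_eq_mul]⟩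
    · exact ⟨0, differentiableOn_const _, fun h => absurd h hi⟩
  choose g hgd hqg using hg
  have hcg : ∀ i < n, ∀ x ∈ ball (0 : ℂ) 1,
      (φ x).charpoly.coeff i = (x - α) ^ (n - 1 - i) * (x * g i x) := fun i hi x hx => by
    rw [hcq i hi x hx, hqg i hi]
  have hgK : ∀ i < n, ∀ x ∈ ball (0 : ℂ) 1, ‖g i x‖ ≤ K := by
    intro i hi x hx
    have hc : ∀ x ∈ ball (0 : ℂ) 1, ‖(φ x).charpoly.coeff i‖ ≤ 2 ^ n := by
      intro x hx
      refine (norm_coeff_charpoly_le (R := 1)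
        (fun t ht => (mem_spectralBall_iff.1 (hm hx) t ht).le) i).trans ?_
      rw [one_pow, one_mul]
      exact_mod_cast Nat.choose_le_two_pow _ _
    have hqb : ∀ x ∈ ball (0 : ℂ) 1, ‖q i x‖ ≤ 8 ^ n := by
      intro x hx
      refine (norm_le_of_eq_pow_mul hα2 (hq i) hc (hcq i hi) hx).trans ?_
      calc (4 : ℝ) ^ (n - 1 - i) * 2 ^ n ≤ 4 ^ n * 2 ^ n := by
            gcongr
            · norm_num
            · omega
        _ = 8 ^ n := by rw [← mul_pow]; norm_num
    have := norm_le_of_eq_pow_mul (α := 0) (k := 1) (by simp) (hgd i) hqb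
      (fun x _ => by rw [hqg i hi, sub_zero, pow_one]) hx
    rwa [pow_one] at this
  -- A substitute for φ x / x, as φ 0 need not vanish: the coefficients for x • ψ x are x ^ (n - i)
  -- * g i x, close to those for φ x when α is small, so the Schwarz lemma bounds the eigenvalues of
  -- ψ by 1 + η.
  set ψ : ℂ → Matrix (Fin n) (Fin n) ℂ := fun x =>
    firstColumnCompanion fun j : Fin n => -g (n - ((j : ℕ) + 1)) x with hψ
  have hψd : DifferentiableOn ℂ ψ (ball 0 1) := by
    refine differentiableOn_matrix_iff.2 fun i j => ?_
    have := hgd (n - ((i : ℕ) + 1))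
    simp only [hψ, firstColumnCompanion, Matrix.of_apply]
    split_ifs <;> fun_prop
  have hψc : ∀ x, ∀ i < n, (ψ x).charpoly.coeff i = g i x := fun x i hi =>
    coeff_charpoly_firstColumnCompanion (fun k => g k x) hi
  have hroot : ∀ x ∈ ball (0 : ℂ) 1, ∀ t, (ψ x).charpoly.IsRoot t → ‖t‖ ≤ 1 + η := by
    refine norm_root_le_of_smul hψd (by positivity) fun x hx t ht => ?_
    refine norm_root_le_of_coeff_close (by omega) (hm hx) hη0 hαρ (fun i hi => ?_) ht
    have hx1 : ‖x‖ < 1 := mem_ball_zero_iff.1 hx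
    have hpow : x ^ (n - i) = x ^ (n - 1 - i) * x := by rw [← pow_succ]; congr 1; omega
    rw [coeff_charpoly_smul _ _ hi, hψc x i hi, hcg i hi x hx, hpow]
    have he : (x - α) ^ (n - 1 - i) * (x * g i x) - x ^ (n - 1 - i) * x * g i x =
        x * (g i x * ((x - α) ^ (n - 1 - i) - x ^ (n - 1 - i))) := by ring
    rw [he, norm_mul, norm_mul]
    refine (mul_le_of_le_one_left (by positivity) hx1.le).trans ?_
    refine mul_le_mul (hgK i hi x hx) ?_ (norm_nonneg _) hK0.le
    refine (norm_pow_sub_pow_le (by linarith [norm_sub_le x α]) (by linarith) _).trans ?_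
    have hle : ((n - 1 - i : ℕ) : ℝ) ≤ n := by exact_mod_cast (by omega : n - 1 - i ≤ n)
    have hle2 : (2 : ℝ) ^ (n - 1 - i) ≤ 2 ^ n := pow_le_pow_right₀ (by norm_num) (by omega)
    rw [sub_sub_cancel_left, norm_neg]
    gcongr
  -- The second-order vanishing of the determinant makes 0 an eigenvalue of ψ 0, so at most n - 1
  -- eigenvalues contribute to its trace.
  have hg0 : g 0 0 = 0 := by
    refine apply_zero_eq_zero_of_coeff_charpoly hn hφ h0' hα0 (hgd 0) fun x hx => ?_
    exact hcg 0 (by omega) x hx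
  have hψ0 : (ψ 0).charpoly.IsRoot 0 := by
    rw [Polynomial.IsRoot, ← Polynomial.coeff_zero_eq_eval_zero, hψc 0 0 (by omega), hg0]
  have hlast : n - 1 < n := by omega
  have htr := norm_trace_le_of_root_zero (by omega) (hroot 0 h0m) hψ0
  rw [hψc 0 _ hlast] at htr
  have hlip : dist (g (n - 1) α) (g (n - 1) 0) ≤ 2 * K / 1 * dist α 0 := by
    refine Complex.dist_le_div_mul_dist_of_mapsTo_ball (hgd (n - 1)) (fun x hx => ?_) hαm
    rw [mem_closedBall, dist_eq_norm]
    linarith [norm_sub_le (g (n - 1) x) (g (n - 1) 0), hgK _ hlast x hx, hgK _ hlast 0 h0m]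
  rw [dist_eq_norm, dist_zero_right, div_one] at hlip
  -- The trace of φ α is t, and the coefficient of index n - 1 carries no factor x - α.
  have ht : ‖t‖ = ‖α‖ * ‖g (n - 1) α‖ := by
    have h2 := hcg _ hlast α hαm
    have h3 := sigma_mk_zero_eq_trace (by omega : 0 < n) (φ α)
    rw [sigma, zero_add, h2, h1, Matrix.trace_diagonal, sum_ite_eq_add] at h3
    simp only [Nat.sub_self, pow_zero, pow_one, one_mul, mul_zero, add_zero] at h3
    rw [← h3, norm_mul, norm_neg, norm_one, one_mul, norm_mul]
  rw [ht, mul_comm]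
  refine mul_le_mul_of_nonneg_right ?_ (norm_nonneg _)
  have h2 : ‖g (n - 1) α‖ ≤ ‖g (n - 1) 0‖ + 2 * K * ‖α‖ := by
    linarith [norm_sub_norm_le (g (n - 1) α) (g (n - 1) 0)]
  nlinarith

/-- Take the characteristic polynomial with single nonzero root (n - 1/4)a. Since M degenerates to a
single entry, `exists_small_disc` reaches some matrix with this polynomial at cost a. For small a
the diagonal one costs at least κ a, and κ > 1. -/
theorem LempertInvariant.false_of_pow_eq_zero {M : Matrix (Fin n) (Fin n) ℂ} (hn : 2 ≤ n)
    (h : LempertInvariant M) (hM : M.charpoly = X ^ n) (hM0 : M ≠ 0)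
    (hM1 : M ^ (n - 1) = 0) : False := by
  have hn2 : (2 : ℝ) ≤ n := by exact_mod_cast hn
  set i₀ : Fin n := ⟨0, by omega⟩ with hi₀
  set i₁ : Fin n := ⟨1, by omega⟩ with hi₁
  obtain ⟨c, hc, ε, hε, hup⟩ := exists_small_disc hn (i₀ := i₀) (i₁ := i₁) rfl rfl
  obtain ⟨ε', hε', hlow⟩ := exists_norm_le_of_disc hn
  set κ : ℝ := (n - 1 / 4) / (n - 1 / 2) with hκ
  have hκ1 : 1 < κ := by rw [hκ, one_lt_div (by linarith)]; linarith
  obtain ⟨a, ha0, ha⟩ := exists_between (lt_min hε (div_pos hε' (by linarith : 0 < κ)))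
  obtain ⟨B, hB, hBc, hBl⟩ := hup a ha0 (ha.trans_le (min_le_left _ _))
  have haκ : a * κ < ε' := by
    rw [← lt_div_iff₀ (by linarith)]
    exact ha.trans_le (min_le_right _ _)
  have hle : lempert (spectralBall n) M (Matrix.diagonal fun k : Fin n =>
      if k = i₀ then (((n - 1 / 4 : ℝ) * a : ℝ) : ℂ) else 0) < ((a * κ).toNNReal : ℝ≥0∞) := by
    rw [← h B _ hB hBc]
    refine ((lempert_le_lempert_single hM hM0 (by simp [hi₀, hi₁]) hc).trans hBl).trans_lt ?_
    rw [enorm_eq_nnnorm, ENNReal.coe_lt_coe, ← NNReal.coe_lt_coe, coe_nnnorm, Complex.norm_real,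
      Real.norm_of_nonneg ha0.le, Real.coe_toNNReal _ (by positivity)]
    nlinarith
  obtain ⟨α, hα, hα0, hαc, φ, hφ, hm, h0, h1⟩ := exists_disc_of_lempert_lt hle
  rw [enorm_eq_nnnorm, ENNReal.coe_lt_coe, ← NNReal.coe_lt_coe, coe_nnnorm,
    Real.coe_toNNReal _ (by positivity)] at hαc
  have h2 := hlow φ α _ i₀ hφ hm (by rw [h0, hM]) (by rw [h0, hM1]) hα0 (by linarith) h1
  rw [Complex.norm_real, Real.norm_of_nonneg (by nlinarith)] at h2
  have h3 : (n - 1 / 2 : ℝ) * (a * κ) = (n - 1 / 4) * a := by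
    have : (n - 1 / 2 : ℝ) ≠ 0 := by linarith
    rw [hκ, mul_left_comm, mul_div_cancel₀ _ this, mul_comm]
  have h4 : (n - 1 / 2 : ℝ) * ‖α‖ < (n - 1 / 2) * (a * κ) :=
    mul_lt_mul_of_pos_left hαc (by linarith)
  linarith

end Derogatory

/-! ### Assembly of the classification. -/

section Main

open Polynomial (X C)

variable {n : ℕ} {A : Matrix (Fin n) (Fin n) ℂ}

theorem IsCyclicTwoDouble.not_isScalarMatrix (h : IsCyclicTwoDouble A) : ¬ IsScalarMatrix A := by
  obtain ⟨rfl, hc, -⟩ := h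
  exact isCyclicMatrix_two_iff.1 hc

theorem charpoly_eq_sq_of_roots {A : Matrix (Fin 2) (Fin 2) ℂ} {μ : ℂ}
    (h : A.charpoly.roots = {μ, μ}) : A.charpoly = (X - C μ) ^ 2 := by
  rw [(IsAlgClosed.splits A.charpoly).eq_prod_roots_of_monic A.charpoly_monic, h]
  simp [sq]

theorem IsCyclicTwoDouble.continuousWithinAt_lempert (h : IsCyclicTwoDouble A)
    (hA : A ∈ spectralBall n) {B : Matrix (Fin n) (Fin n) ℂ} (hB : B ∈ spectralBall n) :
    ContinuousWithinAt (fun p : Matrix (Fin n) (Fin n) ℂ × Matrix (Fin n) (Fin n) ℂ =>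
      lempert (spectralBall n) p.1 p.2) (spectralBall n ×ˢ spectralBall n) (A, B) := by
  have hns := h.not_isScalarMatrix
  obtain ⟨rfl, -, μ, hμ⟩ := h
  exact continuousWithinAt_lempert_two hA hns (charpoly_eq_sq_of_roots hμ) hB

theorem IsCyclicTwoDouble.lempert_eq_symPolydisk (h : IsCyclicTwoDouble A)
    (hA : A ∈ spectralBall n) {B : Matrix (Fin n) (Fin n) ℂ} (hB : B ∈ spectralBall n) :
    lempert (spectralBall n) A B = lempert (symPolydisk n) (sigma A) (sigma B) := by
  have hns := h.not_isScalarMatrix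
  obtain ⟨rfl, -, μ, hμ⟩ := h
  exact lempert_eq_symPolydisk_two hA hns (charpoly_eq_sq_of_roots hμ) hB

theorem LempertInvariant.isScalarMatrix_or (h : LempertInvariant A) (hn : 1 ≤ n)
    (hA : A ∈ spectralBall n) : IsScalarMatrix A ∨ IsCyclicTwoDouble A := by
  by_cases hs : IsScalarMatrix A
  · exact Or.inl hs
  obtain ⟨μ, hμ, hc⟩ := h.exists_charpoly_eq_pow hn hA
  have hn1 : n ≠ 1 := by
    rintro rfl
    refine hs ⟨A 0 0, ?_⟩
    ext i j
    simp [Subsingleton.elim i 0, Subsingleton.elim j 0]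
  by_cases hn2 : n = 2
  · subst hn2
    refine Or.inr ⟨rfl, isCyclicMatrix_two_iff.2 hs, μ, ?_⟩
    rw [hc, Polynomial.roots_pow, Polynomial.roots_X_sub_C, two_nsmul]
    rfl
  have hinv := h.matrixMoebius hμ hA
  have hX := charpoly_matrixMoebius_of_eq_pow hμ hA hc
  have hne := matrixMoebius_ne_zero_of_not_isScalarMatrix hμ hA hs
  -- Here n ≥ 3 and the Möbius image is a nonzero nilpotent matrix, derogatory or regular according
  -- to this power.
  by_cases hp : _root_.matrixMoebius μ A ^ (n - 1) = 0
  · exact (hinv.false_of_pow_eq_zero (by omega) hX hne hp).elim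
  · exact (hinv.false_of_pow_ne_zero (by omega) hX hp).elim

theorem continuousOn_lempert_of_continuousWithinAt (hA : A ∈ spectralBall n)
    (h : ∀ B ∈ spectralBall n, ContinuousWithinAt
      (fun p : Matrix (Fin n) (Fin n) ℂ × Matrix (Fin n) (Fin n) ℂ =>
        lempert (spectralBall n) p.1 p.2) (spectralBall n ×ˢ spectralBall n) (A, B)) :
    ContinuousOn (fun B => lempert (spectralBall n) A B) (spectralBall n) := fun B hB =>
  (h B hB).comp (f := fun B => (A, B)) (by fun_prop) fun _ hY => ⟨hA, hY⟩

theorem lempertInvariant_of_lempert_eq_symPolydisk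
    (h : ∀ B ∈ spectralBall n,
      lempert (spectralBall n) A B = lempert (symPolydisk n) (sigma A) (sigma B)) :
    LempertInvariant A := by
  intro B B' hB hBB'
  rw [h B hB, h B' (mem_spectralBall_of_charpoly_eq hBB' hB), charpoly_eq_iff_sigma_eq.1 hBB']

end Main

theorem theorem1 (n : ℕ) (hn : 1 ≤ n) (A : Matrix (Fin n) (Fin n) ℂ)
    (hA : A ∈ spectralBall n) :
    (ContinuousOn (fun B => lempert (spectralBall n) A B) (spectralBall n) ↔
      IsScalarMatrix A ∨ IsCyclicTwoDouble A) ∧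
    (2 ≤ n → List.TFAE [
      ∀ B ∈ spectralBall n,
        ContinuousWithinAt
          (fun p : Matrix (Fin n) (Fin n) ℂ × Matrix (Fin n) (Fin n) ℂ =>
            lempert (spectralBall n) p.1 p.2)
          (spectralBall n ×ˢ spectralBall n) (A, B),
      ∀ B ∈ spectralBall n,
        lempert (spectralBall n) A B = lempert (symPolydisk n) (sigma A) (sigma B),
      IsCyclicTwoDouble A]) := by
  refine ⟨⟨fun h => (lempertInvariant_of_continuousOn h).isScalarMatrix_or hn hA, ?_⟩, fun hn2 => ?_⟩
  · rintro (h | h)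
    · exact continuousOn_lempert_of_isScalarMatrix hn hA h
    · exact continuousOn_lempert_of_continuousWithinAt hA fun B hB =>
        h.continuousWithinAt_lempert hA hB
  · tfae_have 1 → 3 := fun h => by
      refine ((lempertInvariant_of_continuousOn
        (continuousOn_lempert_of_continuousWithinAt hA h)).isScalarMatrix_or hn hA).resolve_left
          fun hs => ?_
      obtain ⟨B, hB, hBn⟩ := not_continuousWithinAt_lempert_of_isScalarMatrix hn2 hA hs
      exact hBn (h B hB)
    tfae_have 2 → 3 := fun h => by
      refine ((lempertInvariant_of_lempert_eq_symPolydisk h).isScalarMatrix_or hn hA).resolve_left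
          fun hs => ?_
      obtain ⟨B, hB, hBn⟩ := not_lempert_eq_symPolydisk_of_isScalarMatrix hn2 hA hs
      exact hBn (h B hB)
    tfae_have 3 → 1 := fun h B hB => h.continuousWithinAt_lempert hA hB
    tfae_have 3 → 2 := fun h B hB => h.lempert_eq_symPolydisk hA hB
    tfae_finish
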